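/- **Setting.** Let $R$ be a commutative $\mathbb{C}$-algebra, $I\subset R$ an ideal and $h,\xi\in I$ (the main case is $R=\mathbb{C}[[h,\xi]]$, $I=(h,\xi)$). All algebras are complete for the $I$-adic topology, tensor products are completed, i.e. $T\hat\otimes T=\varprojlim_n (T/I^nT)\otimes (T/I^nT)$, and exponentials and logarithms are the usual series. Let $U_q(sl(2))$, $q=e^h$, be the complete algebra topologically generated by $H,E_+,E_-$ with $$[H,E_\pm]=\pm E_\pm,\qquad [E_+,E_-]=\frac{e^{hH}-e^{-hH}}{1-e^{-h}},$$ the quotient being understood as a power series in $h$ with coefficients polynomial in $H$. Put $\omega=\ln\big((\xi E_++1)e^{hH}\big)$, $\ \mathcal F_{q\mathcal J}(h,\xi)=e^{H\otimes\omega}e^{-hH\otimes H}$ and $$\mathcal R_q=e^{hH\otimes H}\sum_{m\ge 0}\frac{(1-e^{-h})^m}{[m]!}\,(E_-\otimes E_+)^m e^{\frac14 hm(m-1)},\qquad [m]=\frac{e^{mh/2}-e^{-mh/2}}{e^{h/2}-e^{-h/2}} .$$ Universal $R$-matrices are invertible and satisfy $\mathcal R\Delta=\Delta^{op}\mathcal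 R$, $(\Delta\otimes id)\mathcal R=\mathcal R_{13}\mathcal R_{23}$, $(id\otimes\Delta)\mathcal R=\mathcal R_{13}\mathcal R_{12}$. **Theorem.** 1. $U_q(sl(2))$ is a topological Hopf algebra with $\Delta_q(H)=H\otimes1+1\otimes H$, $\Delta_q(E_+)=E_+\otimes1+e^{hH}\otimes E_+$, $\Delta_q(E_-)=E_-\otimes e^{-hH}+1\otimes E_-$, and it is quasitriangular with universal $R$-matrix $\mathcal R_q$. The element $\mathcal F=\mathcal F_{q\mathcal J}(h,\xi)$ is a twisting element: it is invertible, $(\epsilon\otimes id)\mathcal F=(id\otimes\epsilon)\mathcal F=1$ and $\mathcal F_{12}(\Delta_q\otimes id)(\mathcal F)=\mathcal F_{23}(id\otimes\Delta_q)(\mathcal F)$. 2. Twisting by $\mathcal F$ gives a topological Hopf algebra $U_{q\mathcal J}(sl(2))(h,\xi)$ with the same algebra and counit and with coproduct $\Delta_{q\mathcal J}(a)=\mathcal F\Delta_q(a)\mathcal F^{-1}$, and $$\Delta_{q\mathcal J}(H)=H\otimes1+e^{\mathrm{ad}(H\otimes\omega)}\circ(1\otimes H),$$ $$\xi\,\Delta_{q\mathcal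 J}(E_+)=(e^\omega\otimes e^\omega)\cdot e^{\mathrm{ad}(H\otimes\omega)}\circ(e^{-hH}\otimes e^{-hH})-1\otimes1,$$ $$\Delta_{q\mathcal J}(E_-)=E_-\otimes e^{-\omega}+e^{\mathrm{ad}(H\otimes\omega)}\circ(e^{hH}\otimes E_-).$$ If $\xi c\in I^{n+1}$ implies $c\in I^n$ for all $n\ge0$, $c\in R$ (as in $\mathbb C[[h,\xi]]$), the second formula determines $\Delta_{q\mathcal J}(E_+)$ uniquely, i.e. one may divide by $\xi$. 3. $U_{q\mathcal J}(sl(2))(h,\xi)$ is quasitriangular with universal $R$-matrix $$\mathcal R_{q\mathcal J}=e^{\omega\otimes H}e^{-hH\otimes H}\,\mathcal R_q\,e^{hH\otimes H}e^{-H\otimes\omega}=\mathcal F_{21}\mathcal R_q\mathcal F^{-1}.$$ 4. (Boundary $\xi=0$.) On every reduction modulo $I^n$, and modulo $\xi$, one has $\mathcal F=1\otimes1$, $\Delta_{q\mathcal J}=\Delta_q$, $S_{q\mathcal J}=S_q$, $\mathcal R_{q\mathcal J}=\mathcal R_q$. In particular $U_{q\mathcal J}(sl(2))(h,0)=U_q(sl(2))$.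 5. (Boundary $h=0$.) The reduction of $U_{q\mathcal J}(sl(2))(h,\xi)$ modulo $h$ is, with $H\mapsto\mathrm{diag}(\frac12,-\frac12)$, $E_+\mapsto e_{12}$, $E_-\mapsto e_{21}$, isomorphic as a Hopf algebra to the Jordanian quantization $U_{\mathcal J}(sl(2))$ over $R/hR$, i.e. to the twist of $U(sl(2))$ (with its cocommutative coproduct) by the twisting element $e^{H\otimes\sigma}$, $\sigma=\ln(1+\xi E_+)$; $\mathcal F$ and $\mathcal R_{q\mathcal J}$ are mapped to $e^{H\otimes\sigma}$ and to $e^{\sigma\otimes H}e^{-H\otimes\sigma}$, and the latter is a universal $R$-matrix of $U_{\mathcal J}(sl(2))$. 6. (Classical $r$-matrix.) If $h=\zeta\xi$ with $\zeta\in\mathbb C$, then modulo $I^2$ (for $R=\mathbb C[[\xi]]$, $I=(\xi)$: modulo $\xi^2$) $$\mathcal R_{q\mathcal J}= 1\otimes 1+\xi\, r_{q\mathcal J},\qquad r_{q\mathcal J}=E_+\wedge H+\zeta\,(H\otimes H+E_-\otimes E_+),$$ where $E_+\wedge H=E_+\otimes H-H\otimes E_+$; and for every $\zeta\in\mathbb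 C$ the element $r_{q\mathcal J}$ of $U(sl(2))\otimes U(sl(2))$ satisfies the classical Yang–Baxter equation $[r_{12},r_{13}]+[r_{12},r_{23}]+[r_{13},r_{23}]=0$. -/

import Mathlib

open scoped TensorProduct

universe u

noncomputable section

namespace HybridSl2

/-! ### Complete algebras, given by their reductions

A complete algebra over a (commutative) ring `R` with a linear topology defined by ideals
`J 0 ⊇ J 1 ⊇ …` is given by its reductions `T n` modulo `J n`, and their transition maps.  An element
of the complete algebra `lim T n` is a compatible family of elements of the `T n`, and the
completed tensor product `T ⊗̂ T` is `lim (T n ⊗ T n)`. -/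

section Tower

variable {R : Type u} [CommRing R]

/-- A complete `R`-algebra: the tower of its reductions modulo the ideals `J n`. -/
structure Tower (R : Type u) [CommRing R] (J : ℕ → Ideal R) where
  obj : ℕ → Type u
  [ring : ∀ n, Ring (obj n)]
  [algebra : ∀ n, Algebra R (obj n)]
  ann : ∀ (n : ℕ) (c : R), c ∈ J n → ∀ x : obj n, c • x = 0
  tr : ∀ n, obj (n + 1) →ₐ[R] obj n

attribute [instance] Tower.ring Tower.algebra

variable {J : ℕ → Ideal R}

/-- The reductions of `T ⊗̂ T`. -/
abbrev Tower.T2 (T : Tower R J) (n : ℕ) : Type u := T.obj n ⊗[R] T.obj n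

/-- The reductions of `T ⊗̂ T ⊗̂ T`. -/
abbrev Tower.T3 (T : Tower R J) (n : ℕ) : Type u := (T.obj n ⊗[R] T.obj n) ⊗[R] T.obj n

/-- The transition maps of `T ⊗̂ T`. -/
def Tower.tr2 (T : Tower R J) (n : ℕ) : T.T2 (n + 1) →ₐ[R] T.T2 n :=
  Algebra.TensorProduct.map (T.tr n) (T.tr n)

/-- The family `x` is an element of `T ⊗̂ T`. -/
def Tower.Compat2 (T : Tower R J) (x : ∀ n, T.T2 n) : Prop :=
  ∀ n, T.tr2 n (x (n + 1)) = x n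

/-- `a ⊗ b ⊗ c ↦ a ⊗ (b ⊗ c)` and back. -/
def assocInv (A : Type u) [Ring A] [Algebra R A] : A ⊗[R] (A ⊗[R] A) →ₐ[R] (A ⊗[R] A) ⊗[R] A :=
  (Algebra.TensorProduct.assoc R R R A A A).symm.toAlgHom

/-- `x ↦ x₁₂`. -/
def leg12 (A : Type u) [Ring A] [Algebra R A] : A ⊗[R] A →ₐ[R] (A ⊗[R] A) ⊗[R] A :=
  Algebra.TensorProduct.includeLeft

/-- `x ↦ x₁₃`. -/
def leg13 (A : Type u) [Ring A] [Algebra R A] : A ⊗[R] A →ₐ[R] (A ⊗[R] A) ⊗[R] A :=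
  Algebra.TensorProduct.map Algebra.TensorProduct.includeLeft (AlgHom.id R A)

/-- `x ↦ x₂₃`. -/
def leg23 (A : Type u) [Ring A] [Algebra R A] : A ⊗[R] A →ₐ[R] (A ⊗[R] A) ⊗[R] A :=
  Algebra.TensorProduct.map Algebra.TensorProduct.includeRight (AlgHom.id R A)

/-- The flip `x ↦ x₂₁`. -/
def swap (A : Type u) [Ring A] [Algebra R A] : A ⊗[R] A →ₐ[R] A ⊗[R] A :=
  (Algebra.TensorProduct.comm R A A).toAlgHom

/-- A topological Hopf algebra structure on the complete algebra `T`: continuous algebra maps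
`Δ : T → T ⊗̂ T` and `ε : T → lim R / J n`, and a continuous linear map `S : T → T`, given on the
reductions, with the Hopf algebra axioms. -/
structure Hopf (T : Tower R J) where
  Δ : ∀ n, T.obj n →ₐ[R] T.T2 n
  ε : ∀ n, T.obj n →ₐ[R] R ⧸ J n
  S : ∀ n, T.obj n →ₗ[R] T.obj n
  Δ_tr : ∀ n x, T.tr2 n (Δ (n + 1) x) = Δ n (T.tr n x)
  ε_tr : ∀ n x (r : R), ε (n + 1) x = Ideal.Quotient.mk (J (n + 1)) r →
    ε n (T.tr n x) = Ideal.Quotient.mk (J n) r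
  S_tr : ∀ n x, T.tr n (S (n + 1) x) = S n (T.tr n x)
  coassoc : ∀ n x, Algebra.TensorProduct.map (Δ n) (AlgHom.id R _) (Δ n x) =
    assocInv _ (Algebra.TensorProduct.map (AlgHom.id R _) (Δ n) (Δ n x))
  counit_left : ∀ n x, Algebra.TensorProduct.map (ε n) (AlgHom.id R _) (Δ n x) = 1 ⊗ₜ[R] x
  counit_right : ∀ n x, Algebra.TensorProduct.map (AlgHom.id R _) (ε n) (Δ n x) = x ⊗ₜ[R] 1
  antipode_left : ∀ n x (r : R), ε n x = Ideal.Quotient.mk (J n) r →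
    LinearMap.mul' R (T.obj n) (TensorProduct.map (S n) LinearMap.id (Δ n x)) = algebraMap R _ r
  antipode_right : ∀ n x (r : R), ε n x = Ideal.Quotient.mk (J n) r →
    LinearMap.mul' R (T.obj n) (TensorProduct.map LinearMap.id (S n) (Δ n x)) = algebraMap R _ r

variable {T : Tower R J}

/-- `F ∈ T ⊗̂ T` is a twisting element of the Hopf algebra `A`: it is invertible,
`(ε ⊗ id) F = (id ⊗ ε) F = 1` and `F₁₂ (Δ ⊗ id) F = F₂₃ (id ⊗ Δ) F`. -/
structure Hopf.IsTwist (A : Hopf T) (F : ∀ n, T.T2 n) : Prop where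
  compat : T.Compat2 F
  isUnit : ∀ n, IsUnit (F n)
  counit_left : ∀ n, Algebra.TensorProduct.map (A.ε n) (AlgHom.id R _) (F n) = 1
  counit_right : ∀ n, Algebra.TensorProduct.map (AlgHom.id R _) (A.ε n) (F n) = 1
  cocycle : ∀ n, leg12 _ (F n) * Algebra.TensorProduct.map (A.Δ n) (AlgHom.id R _) (F n) =
    leg23 _ (F n) * assocInv _ (Algebra.TensorProduct.map (AlgHom.id R _) (A.Δ n) (F n))

/-- `B` is the twist of `A` by `F`: the same algebra and counit, `Δ_F (a) = F Δ(a) F⁻¹`. -/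
structure Hopf.IsTwistOf (B A : Hopf T) (F : ∀ n, T.T2 n) : Prop where
  comul : ∀ n x, B.Δ n x = F n * A.Δ n x * Ring.inverse (F n)
  counit : ∀ n x, B.ε n x = A.ε n x

/-- `Q ∈ T ⊗̂ T` is a universal R-matrix of `A`. -/
structure Hopf.IsUniversalR (A : Hopf T) (Q : ∀ n, T.T2 n) : Prop where
  compat : T.Compat2 Q
  isUnit : ∀ n, IsUnit (Q n)
  comm : ∀ n x, Q n * A.Δ n x = swap _ (A.Δ n x) * Q n
  comul_left : ∀ n, Algebra.TensorProduct.map (A.Δ n) (AlgHom.id R _) (Q n) =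
    leg13 _ (Q n) * leg23 _ (Q n)
  comul_right : ∀ n, assocInv _ (Algebra.TensorProduct.map (AlgHom.id R _) (A.Δ n) (Q n)) =
    leg13 _ (Q n) * leg12 _ (Q n)

end Tower

/-! ### Power series in a nilpotent element -/

section Series

open PowerSeries

variable (R : Type u) [CommRing R] [Algebra ℂ R]

/-- The value `p(a)` of a power series, for `a` with `a ^ n = 0`. -/
def ev {A : Type u} [Ring A] [Algebra R A] (n : ℕ) (p : ℂ⟦X⟧) (a : A) : A :=
  ∑ i ∈ Finset.range n, algebraMap ℂ R (coeff i p) • a ^ i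

/-- `e ^ a`, for `a` with `a ^ n = 0`. -/
def nexp {A : Type u} [Ring A] [Algebra R A] (n : ℕ) (a : A) : A := ev R n (PowerSeries.exp ℂ) a

/-- `ln a`, for `a` with `(a - 1) ^ n = 0`. -/
def nlog {A : Type u} [Ring A] [Algebra R A] (n : ℕ) (a : A) : A :=
  ev R n (PowerSeries.log ℂ) (a - 1)

/-- `e ^ {ad a} ∘ b`, with `ad a ∘ b = a b - b a`. -/
def expAd {A : Type u} [Ring A] [Algebra R A] (n : ℕ) (a b : A) : A :=
  nexp R n (LinearMap.mulLeft R a - LinearMap.mulRight R a : Module.End R A) b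

/-- The power series `e ^ {c X}`. -/
def expS (c : ℂ) : ℂ⟦X⟧ := rescale c (PowerSeries.exp ℂ)

/-- `f / X`, for `f` without constant term. -/
def divX (f : ℂ⟦X⟧) : ℂ⟦X⟧ := PowerSeries.mk fun i => coeff (i + 1) f

/-- `f / g`, for `f` and `g` without constant term and `g` with a nonzero linear term. -/
def quo (f g : ℂ⟦X⟧) : ℂ⟦X⟧ := divX f * (divX g)⁻¹

theorem X_mul_divX {f : ℂ⟦X⟧} (hf : constantCoeff f = 0) : X * divX f = f := by
  ext i
  cases i with
  | zero => simp [hf]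
  | succ i => simp [divX, coeff_succ_X_mul]

theorem quo_mul {f g : ℂ⟦X⟧} (hf : constantCoeff f = 0) (hg : constantCoeff g = 0)
    (hg' : coeff 1 g ≠ 0) : quo f g * g = f := by
  have h0 : constantCoeff (divX g) ≠ 0 := by
    simpa [divX, ← coeff_zero_eq_constantCoeff_apply] using hg'
  have h1 := PowerSeries.mul_inv_cancel (divX g) h0
  calc quo f g * g = divX f * (divX g)⁻¹ * (X * divX g) := by rw [X_mul_divX hg, quo]
    _ = X * divX f * (divX g * (divX g)⁻¹) := by ring
    _ = f := by rw [h1, mul_one, X_mul_divX hf]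

/-- `[m] = (e^{m h / 2} - e^{- m h / 2}) / (e^{h / 2} - e^{- h / 2})`, as a power series in `h`. -/
def qnum (m : ℕ) : ℂ⟦X⟧ :=
  quo (expS (m / 2) - expS (-(m / 2))) (expS (1 / 2) - expS (-(1 / 2)))

/-- `[m]! = [1] [2] ⋯ [m]`. -/
def qfact (m : ℕ) : ℂ⟦X⟧ := ∏ j ∈ Finset.range m, qnum (j + 1)

/-- `(1 - e^{-h})^m / [m]! · e^{h m (m - 1) / 4}`, as a power series in `h`; the denominator has
constant term `m!`. -/
def rcoeff (m : ℕ) : ℂ⟦X⟧ :=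
  (1 - expS (-1)) ^ m * (qfact m)⁻¹ * expS ((m : ℂ) * ((m : ℂ) - 1) / 4)

/-- `(e^{h x} - e^{-h x}) / (1 - e^{-h})`, for `h` with `h ^ n = 0`.  Numerator and denominator are
divided by `h`: it is the inverse of `(1 - e^{-h}) / h` times `∑ i, cᵢ₊₁ hⁱ xⁱ⁺¹`, with `cᵢ` the
coefficients of `e^X - e^{-X}`. -/
def qbracket {A : Type u} [Ring A] [Algebra R A] (n : ℕ) (h : R) (x : A) : A :=
  ev R n (divX (1 - expS (-1)))⁻¹ h •
    ∑ i ∈ Finset.range n,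
      (algebraMap ℂ R (coeff (i + 1) (expS 1 - expS (-1))) * h ^ i) • x ^ (i + 1)

variable {R}

theorem map_qbracket {A B : Type u} [Ring A] [Algebra R A] [Ring B] [Algebra R B] (f : A →ₐ[R] B)
    (n : ℕ) (h : R) (x : A) : f (qbracket R n h x) = qbracket R n h (f x) := by
  simp [qbracket, map_sum]

theorem qbracket_succ {A : Type u} [Ring A] [Algebra R A] (n : ℕ) (h : R)
    (hn : ∀ y : A, h ^ n • y = 0) (x : A) : qbracket R (n + 1) h x = qbracket R n h x := by
  simp only [qbracket, ev, Finset.sum_range_succ, mul_smul, add_smul, hn, smul_zero, add_zero,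
    smul_eq_mul]

end Series

/-! ### The algebra `U_q(sl(2))` -/

section Uq

variable {R : Type u} [CommRing R] [Algebra ℂ R]

/-- The generators `H`, `E₊`, `E₋`. -/
inductive Gen : Type u
  | H | Ep | Em

/-- The relations of the reduction of `U_q(sl(2))` modulo `I ^ n`, with `q = e ^ h`. -/
inductive Rel (I : Ideal R) (h : R) (n : ℕ) :
    FreeAlgebra R Gen.{u} → FreeAlgebra R Gen.{u} → Prop
  | base (c : R) (hc : c ∈ I ^ n) : Rel I h n (algebraMap R _ c) 0
  | H_Ep : Rel I h n
      (FreeAlgebra.ι R Gen.H * FreeAlgebra.ι R Gen.Ep -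
        FreeAlgebra.ι R Gen.Ep * FreeAlgebra.ι R Gen.H) (FreeAlgebra.ι R Gen.Ep)
  | H_Em : Rel I h n
      (FreeAlgebra.ι R Gen.H * FreeAlgebra.ι R Gen.Em -
        FreeAlgebra.ι R Gen.Em * FreeAlgebra.ι R Gen.H) (-FreeAlgebra.ι R Gen.Em)
  | Ep_Em : Rel I h n
      (FreeAlgebra.ι R Gen.Ep * FreeAlgebra.ι R Gen.Em -
        FreeAlgebra.ι R Gen.Em * FreeAlgebra.ι R Gen.Ep) (qbracket R n h (FreeAlgebra.ι R Gen.H))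

/-- The reduction of `U_q(sl(2))` modulo `I ^ n`. -/
abbrev UqMod (I : Ideal R) (h : R) (n : ℕ) : Type u := RingQuot (Rel I h n)

/-- The class of a generator. -/
def gen (I : Ideal R) (h : R) (n : ℕ) (g : Gen.{u}) : UqMod I h n :=
  RingQuot.mkAlgHom R (Rel I h n) (FreeAlgebra.ι R g)

theorem uqMod_ann (I : Ideal R) (h : R) (n : ℕ) (c : R) (hc : c ∈ I ^ n) (x : UqMod I h n) :
    c • x = 0 := by
  have h1 := RingQuot.mkAlgHom_rel R (Rel.base (I := I) (h := h) (n := n) c hc)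
  rw [AlgHom.commutes, map_zero] at h1
  rw [Algebra.smul_def, h1, zero_mul]

/-- The transition map; it is the identity on generators. -/
def uqTr (I : Ideal R) (h : R) (hh : h ∈ I) (n : ℕ) : UqMod I h (n + 1) →ₐ[R] UqMod I h n :=
  RingQuot.liftAlgHom R ⟨RingQuot.mkAlgHom R (Rel I h n), by
    intro x y hxy
    cases hxy with
    | base c hc =>
      exact RingQuot.mkAlgHom_rel R (Rel.base c (Ideal.pow_le_pow_right (Nat.le_succ n) hc))
    | H_Ep => exact RingQuot.mkAlgHom_rel R Rel.H_Ep
    | H_Em => exact RingQuot.mkAlgHom_rel R Rel.H_Em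
    | Ep_Em =>
      rw [RingQuot.mkAlgHom_rel R (Rel.Ep_Em (I := I) (h := h) (n := n)), map_qbracket,
        map_qbracket,
        qbracket_succ n h (uqMod_ann I h n _ (Ideal.pow_mem_pow hh n))]⟩

/-- `U_q(sl(2))` over the `I`-adic completion of `R`, at `q = e ^ h`: the complete algebra
topologically generated by `H`, `E₊`, `E₋` with
`[H, E±] = ± E±` and `[E₊, E₋] = (e^{hH} - e^{-hH}) / (1 - e^{-h})`. -/
def Uq (I : Ideal R) (h : R) (hh : h ∈ I) : Tower R (fun n => I ^ n) where
  obj := UqMod I h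
  ann := uqMod_ann I h
  tr := uqTr I h hh

/-- The generator `H` of `U_q(sl(2))`. -/
def UqH (I : Ideal R) (h : R) (hh : h ∈ I) (n : ℕ) : (Uq I h hh).obj n := gen I h n Gen.H

/-- The generator `E₊` of `U_q(sl(2))`. -/
def UqEp (I : Ideal R) (h : R) (hh : h ∈ I) (n : ℕ) : (Uq I h hh).obj n := gen I h n Gen.Ep

/-- The generator `E₋` of `U_q(sl(2))`. -/
def UqEm (I : Ideal R) (h : R) (hh : h ∈ I) (n : ℕ) : (Uq I h hh).obj n := gen I h n Gen.Em

end Uq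

/-! ### The algebra `U(sl(2))` -/

section Usl

/-- The enveloping algebra of `sl(2, ℂ)`. -/
abbrev USl2 : Type := UniversalEnvelopingAlgebra ℂ (LieAlgebra.SpecialLinear.sl (Fin 2) ℂ)

/-- `H = diag (1/2, -1/2)` in `sl(2)`, so that `[H, E±] = ± E±` and `[E₊, E₋] = 2 H`. -/
def slH : LieAlgebra.SpecialLinear.sl (Fin 2) ℂ :=
  LieAlgebra.SpecialLinear.singleSubSingle 0 1 (1 / 2)

/-- `E₊` in `sl(2)`. -/
def slEp : LieAlgebra.SpecialLinear.sl (Fin 2) ℂ :=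
  LieAlgebra.SpecialLinear.single 0 1 (by decide) 1

/-- `E₋` in `sl(2)`. -/
def slEm : LieAlgebra.SpecialLinear.sl (Fin 2) ℂ :=
  LieAlgebra.SpecialLinear.single 1 0 (by decide) 1

variable {R : Type u} [CommRing R] [Algebra ℂ R]

/-- `U(sl(2))` over the completion `lim R / J n`. -/
def Usl (J : ℕ → Ideal R) (hJ : ∀ n, J (n + 1) ≤ J n) : Tower R J where
  obj n := (R ⧸ J n) ⊗[ℂ] USl2
  ann n c hc x := by
    induction x using TensorProduct.induction_on with
    | zero => simp
    | tmul a b =>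
      obtain ⟨r, rfl⟩ := Ideal.Quotient.mk_surjective a
      have : c • (Ideal.Quotient.mk (J n) r) = 0 := by
        rw [Algebra.smul_def]
        change Ideal.Quotient.mk (J n) c * _ = 0
        rw [Ideal.Quotient.eq_zero_iff_mem.mpr hc, zero_mul]
      rw [TensorProduct.smul_tmul', this, TensorProduct.zero_tmul]
    | add a b ha hb => rw [smul_add, ha, hb, add_zero]
  tr n := Algebra.TensorProduct.map (Ideal.Quotient.factorₐ R (hJ n)) (AlgHom.id ℂ USl2)

/-- The element of `U(sl(2))` given by `x ∈ sl(2)`. -/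
def slElt (J : ℕ → Ideal R) (hJ : ∀ n, J (n + 1) ≤ J n)
    (x : LieAlgebra.SpecialLinear.sl (Fin 2) ℂ) (n : ℕ) : (Usl J hJ).obj n :=
  (1 : R ⧸ J n) ⊗ₜ[ℂ] UniversalEnvelopingAlgebra.ι ℂ x

end Usl

/-- The filtration of `R` that defines the `I`-adic topology of `R / h R`. -/
def modFilt {R : Type u} [CommRing R] (I : Ideal R) (h : R) (n : ℕ) : Ideal R := I ^ n ⊔ Ideal.span {h}

theorem modFilt_le {R : Type u} [CommRing R] (I : Ideal R) (h : R) (n : ℕ) : modFilt I h (n + 1) ≤ modFilt I h n :=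
  sup_le_sup_right (Ideal.pow_le_pow_right (Nat.le_succ n)) _

/-! ### Twisting elements and R-matrices

The formulas below make sense in any algebra in which `h` and `ξ` are small, and are given on its
reduction modulo `I ^ n`. -/

section Formulas

variable (R : Type u) [CommRing R] [Algebra ℂ R] {A : Type u} [Ring A] [Algebra R A]

/-- `ω = ln ((ξ E₊ + 1) e^{hH})`. -/
def omega (n : ℕ) (h ξ : R) (H Ep : A) : A := nlog R n ((ξ • Ep + 1) * nexp R n (h • H))

/-- The quantum Jordanian twist `e^{H ⊗ ω} e^{-h H ⊗ H}`. -/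
def twistQJ (n : ℕ) (h ξ : R) (H Ep : A) : A ⊗[R] A :=
  nexp R n (H ⊗ₜ[R] omega R n h ξ H Ep) * nexp R n (-(h • (H ⊗ₜ[R] H)))

/-- `R_q = e^{h H ⊗ H} ∑ₘ (1 - e^{-h})^m / [m]! · (E₋ ⊗ E₊)^m e^{h m (m - 1) / 4}`; the terms with
`m ≥ n` vanish modulo `h ^ n`. -/
def matQ (n : ℕ) (h : R) (H Ep Em : A) : A ⊗[R] A :=
  nexp R n (h • (H ⊗ₜ[R] H)) *
    ∑ m ∈ Finset.range n, ev R n (rcoeff m) h • (Em ⊗ₜ[R] Ep) ^ m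

/-- `R_{qJ} = e^{ω ⊗ H} e^{-h H ⊗ H} R_q e^{h H ⊗ H} e^{-H ⊗ ω}`. -/
def matQJ (n : ℕ) (h ξ : R) (H Ep Em : A) : A ⊗[R] A :=
  nexp R n (omega R n h ξ H Ep ⊗ₜ[R] H) * nexp R n (-(h • (H ⊗ₜ[R] H))) *
    matQ R n h H Ep Em *
    nexp R n (h • (H ⊗ₜ[R] H)) * nexp R n (-(H ⊗ₜ[R] omega R n h ξ H Ep))

/-- The Jordanian twist `e^{H ⊗ σ}`, `σ = ln (1 + ξ E₊)`. -/
def twistJ (n : ℕ) (ξ : R) (H Ep : A) : A ⊗[R] A :=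
  nexp R n (H ⊗ₜ[R] nlog R n (1 + ξ • Ep))

/-- The Jordanian R-matrix `e^{σ ⊗ H} e^{-H ⊗ σ}`, `σ = ln (1 + ξ E₊)`. -/
def matJ (n : ℕ) (ξ : R) (H Ep : A) : A ⊗[R] A :=
  nexp R n (nlog R n (1 + ξ • Ep) ⊗ₜ[R] H) * nexp R n (-(H ⊗ₜ[R] nlog R n (1 + ξ • Ep)))

/-- `E₊ ∧ H + ζ (H ⊗ H + E₋ ⊗ E₊)`. -/
def rHybrid (ζ : R) (H Ep Em : A) : A ⊗[R] A :=
  (Ep ⊗ₜ[R] H - H ⊗ₜ[R] Ep) + ζ • (H ⊗ₜ[R] H + Em ⊗ₜ[R] Ep)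

variable {R}

/-- The classical Yang–Baxter equation `[r₁₂, r₁₃] + [r₁₂, r₂₃] + [r₁₃, r₂₃] = 0`. -/
def CYBE (r : A ⊗[R] A) : Prop :=
  (leg12 A r * leg13 A r - leg13 A r * leg12 A r) +
    (leg12 A r * leg23 A r - leg23 A r * leg12 A r) +
    (leg13 A r * leg23 A r - leg23 A r * leg13 A r) = 0

end Formulas

/-! ### Hopf algebra structures -/

section Structures

variable {R : Type u} [CommRing R] [Algebra ℂ R]

/-- The standard Hopf algebra structure of `U_q(sl(2))`. -/
structure IsStandard {I : Ideal R} {h : R} {hh : h ∈ I} (A : Hopf (Uq I h hh)) : Prop where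
  comul_H : ∀ n, A.Δ n (UqH I h hh n) =
    UqH I h hh n ⊗ₜ[R] 1 + 1 ⊗ₜ[R] UqH I h hh n
  comul_Ep : ∀ n, A.Δ n (UqEp I h hh n) =
    UqEp I h hh n ⊗ₜ[R] 1 + nexp R n (h • UqH I h hh n) ⊗ₜ[R] UqEp I h hh n
  comul_Em : ∀ n, A.Δ n (UqEm I h hh n) =
    UqEm I h hh n ⊗ₜ[R] nexp R n (-(h • UqH I h hh n)) + 1 ⊗ₜ[R] UqEm I h hh n

/-- The element `ω` of `U_q(sl(2))`. -/
def UqOmega (I : Ideal R) (h ξ : R) (hh : h ∈ I) (n : ℕ) : (Uq I h hh).obj n :=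
  omega R n h ξ (UqH I h hh n) (UqEp I h hh n)

/-- The quantum Jordanian twist, as an element of `U_q(sl(2)) ⊗̂ U_q(sl(2))`. -/
def UqF (I : Ideal R) (h ξ : R) (hh : h ∈ I) (n : ℕ) : (Uq I h hh).T2 n :=
  twistQJ R n h ξ (UqH I h hh n) (UqEp I h hh n)

/-- `R_q`, as an element of `U_q(sl(2)) ⊗̂ U_q(sl(2))`. -/
def UqR (I : Ideal R) (h : R) (hh : h ∈ I) (n : ℕ) : (Uq I h hh).T2 n :=
  matQ R n h (UqH I h hh n) (UqEp I h hh n) (UqEm I h hh n)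

/-- `R_{qJ}`, as an element of `U_q(sl(2)) ⊗̂ U_q(sl(2))`. -/
def UqRJ (I : Ideal R) (h ξ : R) (hh : h ∈ I) (n : ℕ) : (Uq I h hh).T2 n :=
  matQJ R n h ξ (UqH I h hh n) (UqEp I h hh n) (UqEm I h hh n)

/-- `e^{ω} ⊗ e^{ω} · e^{ad (H ⊗ ω)} ∘ (e^{-hH} ⊗ e^{-hH}) - 1 ⊗ 1`. -/
def UqEpRhs (I : Ideal R) (h ξ : R) (hh : h ∈ I) (n : ℕ) : (Uq I h hh).T2 n :=
  (nexp R n (UqOmega I h ξ hh n) ⊗ₜ[R] nexp R n (UqOmega I h ξ hh n)) *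
    expAd R n (UqH I h hh n ⊗ₜ[R] UqOmega I h ξ hh n)
      (nexp R n (-(h • UqH I h hh n)) ⊗ₜ[R] nexp R n (-(h • UqH I h hh n))) -
  1 ⊗ₜ[R] 1

/-- The coproducts of the hybrid Hopf algebra `U_{qJ}(sl(2))` on the generators; the second is
`Δ(E₊) = ξ⁻¹ (e^{ω} ⊗ e^{ω} · e^{ad (H ⊗ ω)} ∘ (e^{-hH} ⊗ e^{-hH}) - 1 ⊗ 1)`, and the division
by `ξ` has a unique result if `ξ` is regular for the `I`-adic filtration, as it is for
`R = ℂ⟦h, ξ⟧` and `I = (h, ξ)`. -/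
structure IsHybrid {I : Ideal R} {h : R} {hh : h ∈ I} (ξ : R) (B : Hopf (Uq I h hh)) : Prop where
  comul_H : ∀ n, B.Δ n (UqH I h hh n) =
    UqH I h hh n ⊗ₜ[R] 1 +
      expAd R n (UqH I h hh n ⊗ₜ[R] UqOmega I h ξ hh n) (1 ⊗ₜ[R] UqH I h hh n)
  comul_Ep : ∀ n, ξ • B.Δ n (UqEp I h hh n) = UqEpRhs I h ξ hh n
  comul_Ep_unique : (∀ (n : ℕ) (c : R), ξ * c ∈ I ^ (n + 1) → c ∈ I ^ n) →
    ∀ x : ∀ n, (Uq I h hh).T2 n, (Uq I h hh).Compat2 x →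
      (∀ n, ξ • x n = UqEpRhs I h ξ hh n) → ∀ n, x n = B.Δ n (UqEp I h hh n)
  comul_Em : ∀ n, B.Δ n (UqEm I h hh n) =
    UqEm I h hh n ⊗ₜ[R] nexp R n (-UqOmega I h ξ hh n) +
      expAd R n (UqH I h hh n ⊗ₜ[R] UqOmega I h ξ hh n)
        (nexp R n (h • UqH I h hh n) ⊗ₜ[R] UqEm I h hh n)

/-- The twist of `U(sl(2))` by which `U_J(sl(2))` is defined. -/
def UslF {J : ℕ → Ideal R} (hJ : ∀ n, J (n + 1) ≤ J n) (ξ : R) (n : ℕ) : (Usl J hJ).T2 n :=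
  twistJ R n ξ (slElt J hJ slH n) (slElt J hJ slEp n)

/-- The R-matrix of `U_J(sl(2))`. -/
def UslRJ {J : ℕ → Ideal R} (hJ : ∀ n, J (n + 1) ≤ J n) (ξ : R) (n : ℕ) : (Usl J hJ).T2 n :=
  matJ R n ξ (slElt J hJ slH n) (slElt J hJ slEp n)

/-- `D` is the Jordanian quantization `U_J(sl(2))`: the twist of `U(sl(2))`, with its usual
cocommutative Hopf algebra structure, by the Jordanian twist. -/
def IsJordanian {J : ℕ → Ideal R} {hJ : ∀ n, J (n + 1) ≤ J n} (ξ : R)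
    (D : Hopf (Usl J hJ)) : Prop :=
  ∃ C : Hopf (Usl J hJ),
    (∀ n x, C.Δ n (slElt J hJ x n) = slElt J hJ x n ⊗ₜ[R] 1 + 1 ⊗ₜ[R] slElt J hJ x n) ∧
    C.IsTwist (UslF hJ ξ) ∧ D.IsTwistOf C (UslF hJ ξ)

/-- `Φ : T → T'` is a surjective map of topological Hopf algebras with kernel `h T`; that is, it
identifies `T / h T` with `T'`. -/
structure IsReduction {J J' : ℕ → Ideal R} {T : Tower R J} {T' : Tower R J'} (h : R)
    (B : Hopf T) (D : Hopf T') (Φ : ∀ n, T.obj n →ₐ[R] T'.obj n) : Prop where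
  compat : ∀ n x, T'.tr n (Φ (n + 1) x) = Φ n (T.tr n x)
  surjective : ∀ n, Function.Surjective (Φ n)
  ker : ∀ n x, Φ n x = 0 ↔ ∃ y, x = h • y
  comul : ∀ n x, D.Δ n (Φ n x) = Algebra.TensorProduct.map (Φ n) (Φ n) (B.Δ n x)
  counit : ∀ n x (r : R), B.ε n x = Ideal.Quotient.mk (J n) r →
    D.ε n (Φ n x) = Ideal.Quotient.mk (J' n) r
  antipode : ∀ n x, D.S n (Φ n x) = Φ n (B.S n x)

end Structures

end HybridSl2

end

open HybridSl2

/-! On the reduction modulo `I ^ n` every element of `I A` is nilpotent. Exponentials, logarithms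
and series in `h` are therefore finite sums, and identities between formal power series pass to them
through `ev`. The theorem becomes a family of identities in ordinary algebras, compatible with the
transition maps.

Two facts hold for any Hopf algebra whose antipode reverses products: conjugating the coproduct by a
twisting element `F` gives a Hopf algebra with antipode `u S(x) v`, and `F₂₁ R F⁻¹` is a universal
R-matrix for it if `R` was one before (`Hopf.twist`, `Hopf.twist_isUniversalR`). What is special to
`sl(2)` is the input to these facts.

The Hopf structure of `U_q(sl(2))` is defined on generators, and the only relation that needs
thought is the one for `[E₊, E₋]`; it comes from the addition formula `Killed.qbracket_add`. In
`R_q`, put `p = e^{-h}`. The coefficients of the `q`-exponential obey the one-step recursion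
`rcoeff_succ`. This recursion makes `R Δ = Δ^op R` a telescoping sum (`SlTriple.qexp_comul_Ep`), and
it gives the addition formula `Killed.qexp_add` for arguments that commute up to `p`, from which
both coproduct formulas for `R_q` follow.

The pivot for the twist is `F Δ(e^ω) = (e^ω ⊗ e^ω) F` (`SlTriple.twistQJ_comul_nexp_omega`): after
twisting, `e^ω` is group-like and `ω` is primitive. The cocycle identity then only asks for some
exponentials in `Hᵢ Hⱼ` and `Hᵢ ωⱼ` to commute. Together with `ξ E₊ = e^ω e^{-hH} - 1` the same
identity gives the coproduct of `E₊`. That one may divide by `ξ` follows from a basis of monomials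
`E₋ ^ a H ^ b E₊ ^ c` over `R / I ^ n`.

Modulo `ξ` one has `ω ≡ h H`, hence `F ≡ 1`. Modulo `h`, the algebra `U_q(sl(2))` becomes
`U(sl(2))`, and the Hopf structure, the twist and the R-matrix descend along this quotient map. The
classical r-matrix is the first-order term of a product of factors `1 + ξ a`, and its Yang–Baxter
equation is a direct expansion. -/

noncomputable section

namespace HybridSl2

/-! ### Power series evaluated at nilpotent elements. -/

section Nilpotent

open PowerSeries

variable {R : Type u} [CommRing R] [Algebra ℂ R] {A B : Type u} [Ring A] [Algebra R A]
  [Ring B] [Algebra R B]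

theorem ev_add (n : ℕ) (p q : ℂ⟦X⟧) (a : A) : ev R n (p + q) a = ev R n p a + ev R n q a := by
  simp [ev, add_smul, Finset.sum_add_distrib]

theorem ev_sub (n : ℕ) (p q : ℂ⟦X⟧) (a : A) : ev R n (p - q) a = ev R n p a - ev R n q a := by
  simp [ev, sub_smul, Finset.sum_sub_distrib]

theorem ev_succ {n : ℕ} (p : ℂ⟦X⟧) {a : A} (ha : a ^ n = 0) : ev R (n + 1) p a = ev R n p a := by
  simp [ev, Finset.sum_range_succ, ha]

theorem map_ev (f : A →ₐ[R] B) (n : ℕ) (p : ℂ⟦X⟧) (a : A) : f (ev R n p a) = ev R n p (f a) := by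
  simp [ev]

theorem ev_C {n : ℕ} (c : ℂ) {a : A} (ha : a ^ n = 0) :
    ev R n (C c) a = algebraMap R A (algebraMap ℂ R c) := by
  cases n with
  | zero =>
    -- For `n = 0` the hypothesis `a ^ 0 = 0` says `1 = 0`, so the algebra is trivial.
    have : Subsingleton A := subsingleton_of_zero_eq_one (by simpa using ha.symm)
    exact Subsingleton.elim _ _
  | succ n => simp [ev, coeff_C, Algebra.algebraMap_eq_smul_one]

theorem ev_X_mul {n : ℕ} (p : ℂ⟦X⟧) {a : A} (ha : a ^ n = 0) :
    ev R n (X * p) a = a * ev R n p a := by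
  cases n with
  | zero =>
    have : Subsingleton A := subsingleton_of_zero_eq_one (by simpa using ha.symm)
    exact Subsingleton.elim _ _
  | succ n =>
    rw [ev, ev, Finset.sum_range_succ', Finset.sum_range_succ, mul_add, Finset.mul_sum]
    simp only [coeff_succ_X_mul, mul_smul_comm, ← pow_succ', ha]
    simp

theorem ev_X_pow_mul {n : ℕ} (k : ℕ) (p : ℂ⟦X⟧) {a : A} (ha : a ^ n = 0) :
    ev R n (X ^ k * p) a = a ^ k * ev R n p a := by
  induction k with
  | zero => simp
  | succ k ih => rw [pow_succ', mul_assoc, ev_X_mul _ ha, ih, pow_succ', mul_assoc]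

theorem ev_C_mul (n : ℕ) (c : ℂ) (p : ℂ⟦X⟧) (a : A) :
    ev R n (C c * p) a = algebraMap ℂ R c • ev R n p a := by
  simp [ev, Finset.smul_sum, mul_smul]

theorem ev_congr {n : ℕ} {p q : ℂ⟦X⟧} (h : ∀ i < n, coeff i p = coeff i q) (a : A) :
    ev R n p a = ev R n q a :=
  Finset.sum_congr rfl fun i hi => by rw [h i (Finset.mem_range.1 hi)]

theorem ev_sum {ι : Type*} (s : Finset ι) (n : ℕ) (p : ι → ℂ⟦X⟧) (a : A) :
    ev R n (∑ i ∈ s, p i) a = ∑ i ∈ s, ev R n (p i) a := by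
  simp only [ev, map_sum, Finset.sum_smul]
  rw [Finset.sum_comm]

/-- Coefficients of a product below degree `n` see only the truncation of `p`, so `p` may be
replaced by a polynomial; multiplication by each of its monomials is `ev_X_pow_mul`. -/
theorem ev_mul {n : ℕ} (p q : ℂ⟦X⟧) {a : A} (ha : a ^ n = 0) :
    ev R n (p * q) a = ev R n p a * ev R n q a := by
  have h1 : ev R n (p * q) a = ev R n ((trunc n p : Polynomial ℂ) * q) a := by
    refine ev_congr (fun i hi => ?_) a
    rw [coeff_mul, coeff_mul]
    refine Finset.sum_congr rfl fun x hx => ?_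
    rw [Polynomial.coeff_coe, coeff_trunc, if_pos]
    have := Finset.HasAntidiagonal.mem_antidiagonal.1 hx
    omega
  have h2 : ((trunc n p : Polynomial ℂ) : ℂ⟦X⟧) =
      ∑ i ∈ Finset.range n, C (coeff i p) * X ^ i := by
    ext j
    simp [coeff_trunc, coeff_X_pow]
  rw [h1, h2, Finset.sum_mul, ev_sum]
  conv_rhs => rw [ev, Finset.sum_mul]
  refine Finset.sum_congr rfl fun i _ => ?_
  rw [mul_assoc, ev_C_mul, ev_X_pow_mul _ _ ha, smul_mul_assoc]

theorem ev_one {n : ℕ} {a : A} (ha : a ^ n = 0) : ev R n (1 : ℂ⟦X⟧) a = 1 := by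
  have := ev_C (R := R) 1 ha
  simpa using this

theorem ev_X {n : ℕ} {a : A} (ha : a ^ n = 0) : ev R n (X : ℂ⟦X⟧) a = a := by
  have := ev_X_mul (R := R) 1 ha
  simpa [ev_one ha] using this

theorem ev_pow {n : ℕ} (p : ℂ⟦X⟧) (k : ℕ) {a : A} (ha : a ^ n = 0) :
    ev R n (p ^ k) a = ev R n p a ^ k := by
  induction k with
  | zero => simp [ev_one ha]
  | succ k ih => rw [pow_succ, ev_mul _ _ ha, ih, pow_succ]

/-- A power series without constant term takes nilpotent values. -/
theorem ev_pow_eq_zero {n : ℕ} {q : ℂ⟦X⟧} (hq : constantCoeff q = 0) {a : A} (ha : a ^ n = 0) :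
    ev R n q a ^ n = 0 := by
  rw [← X_mul_divX hq, ← ev_pow _ _ ha, mul_pow, ev_X_pow_mul _ _ ha, ha, zero_mul]

/-- Since `X` divides `q`, the power `q ^ i` has no terms below degree `i`. Modulo degree `n` the
substitution is therefore a finite sum, and `ev` is multiplicative on it. -/
theorem ev_subst {n : ℕ} (p : ℂ⟦X⟧) {q : ℂ⟦X⟧} (hq : constantCoeff q = 0) {a : A}
    (ha : a ^ n = 0) : ev R n (p.subst q) a = ev R n p (ev R n q a) := by
  have hs : HasSubst q := HasSubst.of_constantCoeff_zero' hq
  have h1 : ev R n (p.subst q) a =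
      ev R n (∑ i ∈ Finset.range n, C (coeff i p) * q ^ i) a := by
    refine ev_congr (fun j hj => ?_) a
    rw [coeff_subst' hs, finsum_eq_sum_of_support_subset (s := Finset.range n)]
    · simp
    · intro i hi
      by_contra hin
      refine hi ?_
      have : n ≤ i := by simpa using hin
      have h2 : (X : ℂ⟦X⟧) ^ i ∣ q ^ i := pow_dvd_pow_of_dvd (X_dvd_iff.2 hq) i
      have h3 := (X_pow_dvd_iff.1 h2) j (by omega)
      simp [h3]
  rw [h1, ev_sum]
  conv_rhs => rw [ev]
  refine Finset.sum_congr rfl fun i _ => ?_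
  rw [ev_C_mul, ev_pow _ _ ha]

/-- Both sides vanish at `0` and have derivative `1`; for the left side substitute `exp - 1` into
`log' · (1 + X) = 1`. -/
theorem log_subst_exp : (PowerSeries.log ℂ).subst (PowerSeries.exp ℂ - 1) = X := by
  have hs : HasSubst (PowerSeries.exp ℂ - 1) := HasSubst.exp_sub_one
  refine derivative.ext ?_ ?_
  · rw [derivative_subst hs, map_sub, derivative_exp, derivative_X]
    have h1 : d⁄dX ℂ (PowerSeries.log ℂ) * (1 + X) = 1 := by
      rw [deriv_log]
      ext n
      cases n with
      | zero => simp
      | succ n => simp [mul_add, coeff_succ_mul_X, coeff_one, pow_succ]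
    have h2 := congrArg (fun f => f.subst (PowerSeries.exp ℂ - 1)) h1
    simp only [subst_mul hs, subst_add hs, subst_X hs] at h2
    have h3 : (1 : ℂ⟦X⟧).subst (PowerSeries.exp ℂ - 1) = (1 : ℂ⟦X⟧) := by
      have := substAlgHom (R := ℂ) hs
      rw [← coe_substAlgHom hs, map_one]
    rw [h3] at h2
    simpa using h2
  · simp only [constantCoeff_X]
    exact constantCoeff_subst_eq_zero (by
      rw [← PowerSeries.constantCoeff.eq_def]; simp [constantCoeff_exp]) _ constantCoeff_log

/-- The series `log` has a two-sided inverse `q` for composition. Composing `log ∘ (exp - 1) = X`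
with `q` identifies `q` with `exp - 1`. -/
theorem exp_subst_log : (PowerSeries.exp ℂ - 1).subst (PowerSeries.log ℂ) = X := by
  have hs : HasSubst (PowerSeries.exp ℂ - 1) := HasSubst.exp_sub_one
  have hl : HasSubst (PowerSeries.log ℂ) := HasSubst.log
  have hu : IsUnit ((PowerSeries.log ℂ).coeff 1) := by simp
  have h1 := subst_substInvOfIsUnit_right (PowerSeries.log ℂ) constantCoeff_log hu
  have h2 := subst_substInvOfIsUnit_left (PowerSeries.log ℂ) constantCoeff_log hu
  have hq := HasSubst.substInvOfIsUnit (PowerSeries.log ℂ) hu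
  set q := (PowerSeries.log ℂ).substInvOfIsUnit hu
  have h3 : q = PowerSeries.exp ℂ - 1 := by
    have := subst_comp_subst_apply hl hs q
    rw [h2, subst_X hs, log_subst_exp] at this
    rw [this, X_subst]
  rw [← h3, h2]

theorem nexp_nlog {n : ℕ} {a : A} (ha : (a - 1) ^ n = 0) : nexp R n (nlog R n a) = a := by
  have h := congrArg (fun f => ev R n f (a - 1)) exp_subst_log
  simp only [ev_subst _ constantCoeff_log ha, ev_X ha, ev_sub] at h
  rw [ev_one (ev_pow_eq_zero constantCoeff_log ha)] at h
  exact sub_left_injective h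

theorem nlog_nexp {n : ℕ} {a : A} (ha : a ^ n = 0) : nlog R n (nexp R n a) = a := by
  have h := congrArg (fun f => ev R n f a) log_subst_exp
  have hc : constantCoeff (PowerSeries.exp ℂ - 1) = 0 := by simp [constantCoeff_exp]
  simp only [ev_subst _ hc ha, ev_X ha, ev_sub, ev_one ha] at h
  exact h

theorem map_nexp (f : A →ₐ[R] B) (n : ℕ) (a : A) : f (nexp R n a) = nexp R n (f a) :=
  map_ev f n _ a

theorem map_nlog (f : A →ₐ[R] B) (n : ℕ) (a : A) : f (nlog R n a) = nlog R n (f a) := by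
  rw [nlog, map_ev, map_sub, map_one, nlog]

theorem nexp_succ {n : ℕ} {a : A} (ha : a ^ n = 0) : nexp R (n + 1) a = nexp R n a :=
  ev_succ _ ha

/-- If `a x = x b` then `p(a) x = x p(b)`. -/
theorem ev_intertwine {a b x : A} (h : a * x = x * b) (n : ℕ) (p : ℂ⟦X⟧) :
    ev R n p a * x = x * ev R n p b := by
  have h1 : ∀ i : ℕ, a ^ i * x = x * b ^ i := by
    intro i
    induction i with
    | zero => simp
    | succ i ih => rw [pow_succ, mul_assoc, h, ← mul_assoc, ih, mul_assoc, pow_succ]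
  simp [ev, Finset.sum_mul, Finset.mul_sum, h1]

theorem nexp_intertwine {a b x : A} (h : a * x = x * b) (n : ℕ) :
    nexp R n a * x = x * nexp R n b :=
  ev_intertwine h n _

theorem nexp_commute {a x : A} (h : Commute a x) (n : ℕ) : Commute (nexp R n a) x :=
  nexp_intertwine h n

/-- Gives access to the functional equation of `IsNilpotent.exp`, which is stated over `ℚ`. -/
theorem nexp_eq_exp [Module ℚ A] {n : ℕ} {a : A} (ha : a ^ n = 0) :
    nexp R n a = IsNilpotent.exp a := by
  rw [IsNilpotent.exp_eq_sum ha, nexp, ev]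
  refine Finset.sum_congr rfl fun i _ => ?_
  -- An additive map between rational vector spaces is `ℚ`-linear; applied to `c ↦ c • a ^ i` this
  -- matches the complex and the rational `1 / i!`.
  let f : ℂ →+ A := ((smulAddHom R A).flip (a ^ i)).comp (algebraMap ℂ R).toAddMonoidHom
  have h := map_rat_smul f (i.factorial : ℚ)⁻¹ 1
  have h1 : f 1 = a ^ i := by simp [f]
  rw [h1] at h
  rw [← h]
  simp [f, Rat.smul_def]

variable (R) in
/-- An algebra over `R` is a `ℚ`-vector space. -/
abbrev ratModule (A : Type u) [Ring A] [Algebra R A] : Module ℚ A :=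
  Module.compHom A ((algebraMap ℂ R).comp (algebraMap ℚ ℂ))

theorem nexp_add {n : ℕ} {a b : A} (h : Commute a b) (ha : a ^ n = 0) (hb : b ^ n = 0)
    (hab : (a + b) ^ n = 0) : nexp R n (a + b) = nexp R n a * nexp R n b := by
  let := ratModule R A
  rw [nexp_eq_exp ha, nexp_eq_exp hb, nexp_eq_exp hab,
    IsNilpotent.exp_add_of_commute h ⟨n, ha⟩ ⟨n, hb⟩]

theorem nexp_zero {n : ℕ} (h : (0 : A) ^ n = 0) : nexp R n (0 : A) = 1 := by
  let := ratModule R A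
  rw [nexp_eq_exp h, IsNilpotent.exp_zero]

theorem nexp_mul_neg {n : ℕ} {a : A} (ha : a ^ n = 0) : nexp R n a * nexp R n (-a) = 1 := by
  let := ratModule R A
  rw [nexp_eq_exp ha, nexp_eq_exp (by rw [neg_pow, ha, mul_zero]),
    IsNilpotent.exp_mul_exp_neg_self ⟨n, ha⟩]

theorem nexp_neg_mul {n : ℕ} {a : A} (ha : a ^ n = 0) : nexp R n (-a) * nexp R n a = 1 := by
  have := nexp_mul_neg (R := R) (a := -a) (n := n) (by rw [neg_pow, ha, mul_zero])
  rwa [neg_neg] at this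

end Nilpotent

/-! ### Elements of `I A` in an algebra killed by `I ^ n`. -/

section Small

open PowerSeries

variable {R : Type u} [CommRing R] {A B : Type u} [Ring A] [Algebra R A]
  [Ring B] [Algebra R B] {I : Ideal R} {n : ℕ}

/-- `A` is killed by `I ^ n`. -/
def Killed (I : Ideal R) (n : ℕ) (A : Type u) [Ring A] [Algebra R A] : Prop :=
  ∀ c ∈ I ^ n, ∀ x : A, c • x = 0

/-- `a` lies in `I A`. -/
def Small (I : Ideal R) (a : A) : Prop := a ∈ I • (⊤ : Submodule R A)

theorem Killed.tensor (hA : Killed I n A) : Killed I n (A ⊗[R] B) := by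
  intro c hc x
  induction x using TensorProduct.induction_on with
  | zero => simp
  | tmul a b => rw [TensorProduct.smul_tmul', hA c hc, TensorProduct.zero_tmul]
  | add a b ha hb => rw [smul_add, ha, hb, add_zero]

theorem Small.add {a b : A} (ha : Small I a) (hb : Small I b) : Small I (a + b) :=
  Submodule.add_mem _ ha hb

theorem Small.neg {a : A} (ha : Small I a) : Small I (-a) := Submodule.neg_mem _ ha

theorem Small.zero : Small I (0 : A) := Submodule.zero_mem _

theorem Small.smul (c : R) {a : A} (ha : Small I a) : Small I (c • a) :=
  Submodule.smul_mem _ c ha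

theorem small_smul {c : R} (hc : c ∈ I) (a : A) : Small I (c • a) :=
  Submodule.smul_mem_smul hc trivial

theorem Small.map_linear {M N : Type u} [Ring M] [Algebra R M] [Ring N] [Algebra R N]
    (f : M →ₗ[R] N) {a : M} (ha : Small I a) : Small I (f a) := by
  refine Submodule.smul_induction_on ha (fun c hc x _ => ?_) (fun x y hx hy => ?_)
  · rw [map_smul]
    exact small_smul hc _
  · rw [map_add]
    exact hx.add hy

theorem Small.map (f : A →ₐ[R] B) {a : A} (ha : Small I a) : Small I (f a) :=
  ha.map_linear f.toLinearMap

theorem Small.mul_right {a : A} (ha : Small I a) (b : A) : Small I (a * b) :=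
  ha.map_linear (LinearMap.mulRight R b)

theorem Small.mul_left {a : A} (ha : Small I a) (b : A) : Small I (b * a) :=
  ha.map_linear (LinearMap.mulLeft R b)

theorem Small.tmul_left {a : A} (ha : Small I a) (b : B) : Small I (a ⊗ₜ[R] b) :=
  ha.map_linear ((TensorProduct.mk R A B).flip b)

theorem Small.tmul_right {b : B} (hb : Small I b) (a : A) : Small I (a ⊗ₜ[R] b) :=
  hb.map_linear (TensorProduct.mk R A B a)

theorem Small.pow_mem {a : A} (ha : Small I a) (k : ℕ) :
    a ^ k ∈ I ^ k • (⊤ : Submodule R A) := by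
  induction k with
  | zero => simp
  | succ k ih =>
    rw [_root_.pow_succ a, _root_.pow_succ I]
    refine Submodule.smul_induction_on ih (fun c hc x _ => ?_) (fun x y hx hy => ?_)
    · rw [smul_mul_assoc, Submodule.mul_smul]
      exact Submodule.smul_mem_smul hc (ha.mul_left x)
    · rw [add_mul]
      exact Submodule.add_mem _ hx hy

theorem Killed.eq_zero (hA : Killed I n A) {a : A} (ha : a ∈ I ^ n • (⊤ : Submodule R A)) :
    a = 0 := by
  refine Submodule.smul_induction_on ha (fun c hc x _ => hA c hc x) (fun x y hx hy => ?_)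
  rw [hx, hy, add_zero]

/-- The source of all nilpotency in the file: `a ^ n ∈ I ^ n A = 0`. -/
theorem Killed.pow (hA : Killed I n A) {a : A} (ha : Small I a) : a ^ n = 0 :=
  hA.eq_zero (ha.pow_mem n)

theorem Killed.zero_pow (hA : Killed I n A) : (0 : A) ^ n = 0 := hA.pow Small.zero

theorem Killed.isUnit_of_small_sub_one (hA : Killed I n A) {a : A} (ha : Small I (a - 1)) :
    IsUnit a := by
  have h : IsNilpotent (a - 1) := ⟨n, hA.pow ha⟩
  have := h.isUnit_one_add
  rwa [add_sub_cancel] at this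

theorem small_algebraMap {h : R} (hh : h ∈ I) : Small I (algebraMap R A h) := by
  rw [Algebra.algebraMap_eq_smul_one]
  exact small_smul hh _

variable [Algebra ℂ R]

theorem small_ev {p : ℂ⟦X⟧} (hp : constantCoeff p = 0) {a : A} (ha : Small I a) :
    Small I (ev R n p a) := by
  refine Submodule.sum_mem _ fun i _ => ?_
  cases i with
  | zero => simp [hp]
  | succ i =>
    rw [pow_succ]
    exact (ha.mul_left _).smul _

theorem Killed.small_nexp_sub_one (hA : Killed I n A) {a : A} (ha : Small I a) :
    Small I (nexp R n a - 1) := by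
  rw [nexp, ← ev_one (R := R) (hA.pow ha), ← ev_sub]
  exact small_ev (by simp [constantCoeff_exp]) ha

theorem small_nlog {a : A} (ha : Small I (a - 1)) : Small I (nlog R n a) :=
  small_ev constantCoeff_log ha

theorem Killed.nexp_add (hA : Killed I n A) {a b : A} (h : Commute a b) (ha : Small I a)
    (hb : Small I b) : nexp R n (a + b) = nexp R n a * nexp R n b :=
  HybridSl2.nexp_add h (hA.pow ha) (hA.pow hb) (hA.pow (ha.add hb))

theorem Killed.nexp_zero (hA : Killed I n A) : nexp R n (0 : A) = 1 :=
  HybridSl2.nexp_zero hA.zero_pow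

theorem Killed.nexp_mul_neg (hA : Killed I n A) {a : A} (ha : Small I a) :
    nexp R n a * nexp R n (-a) = 1 :=
  HybridSl2.nexp_mul_neg (hA.pow ha)

theorem Killed.nexp_neg_mul (hA : Killed I n A) {a : A} (ha : Small I a) :
    nexp R n (-a) * nexp R n a = 1 :=
  HybridSl2.nexp_neg_mul (hA.pow ha)

/-- `ad a` is the sum of the commuting operators of left multiplication by `a` and right
multiplication by `-a`. The functional equation, applied in `Module.End R A`, turns its exponential
into conjugation. -/
theorem Killed.expAd_eq (hA : Killed I n A) {a : A} (ha : Small I a) (b : A) :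
    expAd R n a b = nexp R n a * b * nexp R n (-a) := by
  have hE : Killed I n (Module.End R A) := by
    intro c hc f
    ext x
    simp [hA c hc]
  have hl : Small I (LinearMap.mulLeft R a : Module.End R A) := ha.map (Algebra.lmul R A)
  have hr : Small I (LinearMap.mulRight R (-a) : Module.End R A) :=
    ha.neg.map_linear (LinearMap.mul R A).flip
  have h1 : (LinearMap.mulLeft R a - LinearMap.mulRight R a : Module.End R A) =
      LinearMap.mulLeft R a + LinearMap.mulRight R (-a) := by
    ext x; simp [sub_eq_add_neg]
  have hc : Commute (LinearMap.mulLeft R a : Module.End R A) (LinearMap.mulRight R (-a)) := by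
    ext x; simp [mul_assoc]
  have e1 : nexp R n (LinearMap.mulLeft R a : Module.End R A) =
      LinearMap.mulLeft R (nexp R n a) := (map_nexp (Algebra.lmul R A) n a).symm
  have e2 : nexp R n (LinearMap.mulRight R (-a) : Module.End R A) =
      LinearMap.mulRight R (nexp R n (-a)) := by
    ext x
    simp [nexp, ev, Finset.mul_sum]
  rw [expAd, h1, hE.nexp_add hc hl hr, e1, e2]
  simp [mul_assoc]

/-- In `R` itself `h` need not be nilpotent, but its image in `A` is. Scalars given by series in `h`
are moved into `A` so that multiplicativity of `ev` applies. -/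
theorem smul_ev {h : R} (p : ℂ⟦X⟧) (x : A) :
    ev R n p h • x = ev R n p (algebraMap R A h) * x := by
  rw [Algebra.smul_def]
  exact congrArg (· * x) (map_ev (Algebra.ofId R A) n p h)

theorem ev_commute {a x : A} (h : Commute a x) (n : ℕ) (p : ℂ⟦X⟧) : Commute (ev R n p a) x :=
  ev_intertwine h n p

theorem ev_algebraMap_commute (h : R) (x : A) (n : ℕ) (p : ℂ⟦X⟧) :
    Commute (ev R n p (algebraMap R A h)) x :=
  ev_commute (Algebra.commutes h x) n p

theorem ev_expS (c : ℂ) (a : A) : ev R n (expS c) a = nexp R n (algebraMap ℂ R c • a) := by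
  refine Finset.sum_congr rfl fun i _ => ?_
  rw [expS, coeff_rescale, map_mul, smul_pow, smul_smul, map_pow, mul_comm]

end Small

/-! ### The bracket `(e^{hx} - e^{-hx}) / (1 - e^{-h})` and its addition formula. -/

section QBracket

open PowerSeries

variable {R : Type u} [CommRing R] [Algebra ℂ R] {A B : Type u} [Ring A] [Algebra R A]
  [Ring B] [Algebra R B] {I : Ideal R} {n : ℕ}

/-- `(e^{h x} - 1) / h`, for `h` with `h ^ n = 0`. -/
def expDiv (n : ℕ) (h : R) (x : A) : A :=
  ∑ i ∈ Finset.range n,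
    (algebraMap ℂ R (coeff (i + 1) (PowerSeries.exp ℂ)) * h ^ i) • x ^ (i + 1)

theorem nexp_smul_eq {h : R} (hn : ∀ y : A, h ^ n • y = 0) (x : A) :
    nexp R n (h • x) = 1 + h • expDiv n h x := by
  have hx : (h • x) ^ n = 0 := by rw [smul_pow, hn]
  -- One vanishing term is added to `nexp`: dividing by `h` shifts the index, so `n` terms of
  -- `expDiv` correspond to degrees `1` to `n`.
  rw [← nexp_succ hx, nexp, ev, Finset.sum_range_succ', expDiv, Finset.smul_sum, add_comm]
  congr 1
  · simp
  · refine Finset.sum_congr rfl fun i _ => ?_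
    rw [smul_pow, smul_smul, smul_smul]
    congr 1
    ring

/-- Dividing the functional equation of `e^{hx}` by `h` is not allowed, since `h` may be a zero
divisor. Instead `(e^{hx} - 1) / h` is read off as the upper right entry of the exponential of the
matrix with rows `(h x, x)` and `(0, 0)`. Such matrices commute when `x` and `y` do, so `nexp_add`
applies to them. -/
theorem expDiv_add {h : R} (hn : ∀ y : A, h ^ n • y = 0) {x y : A} (hxy : Commute x y) :
    expDiv n h (x + y) = expDiv n h x + nexp R n (h • x) * expDiv n h y := by
  let M : A → Matrix (Fin 2) (Fin 2) A := fun x => !![h • x, x; 0, 0]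
  have hpow : ∀ (x : A) (k : ℕ), M x ^ (k + 1) = !![h ^ (k + 1) • x ^ (k + 1), h ^ k • x ^ (k + 1); 0, 0] := by
    intro x k
    induction k with
    | zero => simp [M]
    | succ k ih =>
      rw [pow_succ, ih]
      simp only [M, Matrix.mul_fin_two]
      congr 1
      simp [← pow_succ]
      rw [smul_smul, ← pow_succ']
  -- The exponent is `n + 1` because the upper right entry of `M x ^ k` carries only `h ^ (k - 1)`.
  have hnil : ∀ x, M x ^ (n + 1) = 0 := by
    intro x
    rw [hpow, pow_succ' h, mul_smul, hn]
    ext i j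
    fin_cases i <;> fin_cases j <;> simp
  have hexp : ∀ x, nexp R (n + 1) (M x) = !![nexp R n (h • x), expDiv n h x; 0, 1] := by
    intro x
    rw [nexp_smul_eq hn, nexp, ev, Finset.sum_range_succ']
    ext i j
    rw [Matrix.add_apply, Matrix.sum_apply]
    simp only [hpow]
    fin_cases i <;> fin_cases j
    · simp [expDiv, Finset.smul_sum, smul_smul, pow_succ]
      rw [add_comm]
      congr 1
      refine Finset.sum_congr rfl fun i _ => ?_
      congr 1
      ring
    · simp [expDiv, smul_smul]
    · simp
    · simp
  have hadd : M (x + y) = M x + M y := by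
    ext i j
    fin_cases i <;> fin_cases j <;> simp [M]
  have hcomm : Commute (M x) (M y) := by
    ext i j
    fin_cases i <;> fin_cases j <;> simp [M, Matrix.mul_apply, hxy.eq]
  have key := HybridSl2.nexp_add (R := R) hcomm (hnil x) (hnil y) (by rw [← hadd]; exact hnil _)
  rw [← hadd, hexp, hexp, hexp] at key
  have := congrFun (congrFun key 0) 1
  simpa [Matrix.mul_apply, add_comm] using this

theorem qbracket_eq (n : ℕ) (h : R) (x : A) :
    qbracket R n h x =
      ev R n (divX (1 - expS (-1)))⁻¹ h • (expDiv n h x - expDiv n h (-x)) := by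
  rw [qbracket, expDiv, expDiv, ← Finset.sum_sub_distrib]
  congr 1
  refine Finset.sum_congr rfl fun i _ => ?_
  rw [neg_pow x]
  have h1 : ((-1 : A) ^ (i + 1)) * x ^ (i + 1) = ((-1 : R) ^ (i + 1)) • x ^ (i + 1) := by
    rw [Algebra.smul_def]
    simp
  rw [h1, smul_smul, ← sub_smul]
  congr 1
  simp only [expS, map_sub, coeff_rescale, map_mul, map_pow, map_neg, map_one]
  ring

theorem qbracket_neg (n : ℕ) (h : R) (x : A) : qbracket R n h (-x) = -qbracket R n h x := by
  rw [qbracket_eq, qbracket_eq, neg_neg, ← smul_neg, neg_sub]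

theorem qbracket_zero (n : ℕ) (h : R) : qbracket R n h (0 : A) = 0 := by
  simp [qbracket]

theorem expDiv_commute {x y : A} (hxy : Commute x y) (n : ℕ) (h : R) :
    Commute (expDiv n h x) y :=
  Commute.sum_left _ _ _ fun _ _ => ((hxy.pow_left _).smul_left _)

/-- With `D(x) = (e^{hx} - 1) / h`, expand `D(x + y)` starting from `x`, but `D(-(x + y))` starting
from `-y`. What is left over is `D(x) (1 - e^{-hy})` and `(e^{hx} - 1) D(-y)`, and these cancel
because both reduce to multiples `∓ h D(x) D(-y)`. -/
theorem Killed.qbracket_add (hA : Killed I n A) {h : R} (hh : h ∈ I) {x y : A}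
    (hxy : Commute x y) : qbracket R n h (x + y) =
      qbracket R n h x * nexp R n (-(h • y)) + nexp R n (h • x) * qbracket R n h y := by
  have hn : ∀ y : A, h ^ n • y = 0 := fun y => hA _ (Ideal.pow_mem_pow hh n) y
  simp only [qbracket_eq, smul_mul_assoc, mul_smul_comm, ← smul_add]
  congr 1
  have e1 : expDiv n h (-(x + y)) = expDiv n h (-y) + nexp R n (h • (-y)) * expDiv n h (-x) := by
    rw [neg_add_rev]
    exact expDiv_add hn hxy.symm.neg_left.neg_right
  have c1 : Commute (expDiv n h x) (expDiv n h (-y)) :=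
    expDiv_commute (expDiv_commute hxy.symm.neg_left n h).symm n h
  have c2 : Commute (expDiv n h (-x)) (expDiv n h (-y)) :=
    expDiv_commute (expDiv_commute hxy.symm.neg_left.neg_right n h).symm n h
  rw [e1, expDiv_add hn hxy, ← smul_neg, nexp_smul_eq hn, nexp_smul_eq hn (-y)]
  simp only [sub_mul, mul_add, mul_sub, add_mul, mul_one, one_mul, smul_mul_assoc,
    mul_smul_comm, c1.eq, c2.eq, smul_sub]
  abel

/-- Recovers the undivided numerator; it is needed where a coefficient of the R-matrix supplies the
factor `1 - e^{-h}`. -/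
theorem Killed.one_sub_mul_qbracket (hA : Killed I n A) {h : R} (hh : h ∈ I) (x : A) :
    ev R n (1 - expS (-1)) (algebraMap R A h) * qbracket R n h x =
      nexp R n (h • x) - nexp R n (-(h • x)) := by
  have hn : ∀ y : A, h ^ n • y = 0 := fun y => hA _ (Ideal.pow_mem_pow hh n) y
  have h0 : (algebraMap R A h) ^ n = 0 := hA.pow (small_algebraMap hh)
  have hc : constantCoeff (1 - expS (-1)) = 0 := by
    rw [← coeff_zero_eq_constantCoeff_apply, map_sub, expS, coeff_rescale]
    simp
  have hu : (1 - expS (-1)) * (divX (1 - expS (-1)))⁻¹ = X := by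
    have h1 : constantCoeff (divX (1 - expS (-1))) ≠ 0 := by
      simp [divX, ← coeff_zero_eq_constantCoeff_apply, expS, coeff_one]
    calc (1 - expS (-1)) * (divX (1 - expS (-1)))⁻¹ =
          X * divX (1 - expS (-1)) * (divX (1 - expS (-1)))⁻¹ := by rw [X_mul_divX hc]
      _ = X := by rw [mul_assoc, PowerSeries.mul_inv_cancel _ h1, mul_one]
  rw [qbracket_eq, smul_ev, ← mul_assoc, ← ev_mul _ _ h0, hu, ev_X h0, ← smul_neg,
    nexp_smul_eq hn, nexp_smul_eq hn, ← Algebra.smul_def, smul_sub]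
  abel

end QBracket

/-! ### Leg notation and permutations in the triple tensor product. -/

section Legs

variable {R : Type u} [CommRing R] {A : Type u} [Ring A] [Algebra R A]

@[simp] theorem assocInv_tmul (a b c : A) :
    assocInv (R := R) A (a ⊗ₜ (b ⊗ₜ c)) = (a ⊗ₜ b) ⊗ₜ c := rfl

@[simp] theorem leg12_apply (z : A ⊗[R] A) : leg12 A z = z ⊗ₜ[R] (1 : A) := rfl

@[simp] theorem leg13_tmul (a b : A) : leg13 (R := R) A (a ⊗ₜ b) = (a ⊗ₜ 1) ⊗ₜ b := rfl

@[simp] theorem leg23_tmul (a b : A) : leg23 (R := R) A (a ⊗ₜ b) = (1 ⊗ₜ a) ⊗ₜ b := rfl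

@[simp] theorem swap_tmul (a b : A) : swap (R := R) A (a ⊗ₜ b) = b ⊗ₜ a := rfl

/-- `a ⊗ b ⊗ c ↦ c ⊗ a ⊗ b`. -/
def rot (A : Type u) [Ring A] [Algebra R A] : (A ⊗[R] A) ⊗[R] A →ₐ[R] (A ⊗[R] A) ⊗[R] A :=
  (assocInv A).comp (Algebra.TensorProduct.comm R (A ⊗[R] A) A).toAlgHom

/-- `a ⊗ b ⊗ c ↦ b ⊗ a ⊗ c`. -/
def flip12 (A : Type u) [Ring A] [Algebra R A] : (A ⊗[R] A) ⊗[R] A →ₐ[R] (A ⊗[R] A) ⊗[R] A :=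
  Algebra.TensorProduct.map (swap A) (AlgHom.id R A)

/-- `x ↦ Δ(x₁) ⊗ x₂`. -/
def comulLeft (Δ : A →ₐ[R] A ⊗[R] A) : A ⊗[R] A →ₐ[R] (A ⊗[R] A) ⊗[R] A :=
  Algebra.TensorProduct.map Δ (AlgHom.id R A)

/-- `x ↦ x₁ ⊗ Δ(x₂)`. -/
def comulRight (Δ : A →ₐ[R] A ⊗[R] A) : A ⊗[R] A →ₐ[R] (A ⊗[R] A) ⊗[R] A :=
  (assocInv A).comp (Algebra.TensorProduct.map (AlgHom.id R A) Δ)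

@[simp] theorem rot_tmul (w : A ⊗[R] A) (c : A) : rot A (w ⊗ₜ[R] c) = assocInv A (c ⊗ₜ[R] w) := rfl

@[simp] theorem flip12_tmul (w : A ⊗[R] A) (c : A) :
    flip12 A (w ⊗ₜ[R] c) = swap A w ⊗ₜ[R] c := rfl

@[simp] theorem comulLeft_tmul (Δ : A →ₐ[R] A ⊗[R] A) (a b : A) :
    comulLeft Δ (a ⊗ₜ b) = Δ a ⊗ₜ b := rfl

@[simp] theorem comulRight_tmul (Δ : A →ₐ[R] A ⊗[R] A) (a b : A) :
    comulRight Δ (a ⊗ₜ b) = assocInv A (a ⊗ₜ[R] Δ b) := rfl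

@[simp] theorem swap_swap (z : A ⊗[R] A) : swap A (swap A z) = z := by
  induction z using TensorProduct.induction_on with
  | zero => simp
  | tmul a b => simp
  | add x y hx hy => simp [hx, hy]

theorem leg23_eq (z : A ⊗[R] A) : leg23 A z = assocInv A (1 ⊗ₜ[R] z) := by
  induction z using TensorProduct.induction_on with
  | zero => simp
  | tmul a b => simp
  | add x y hx hy => simp [hx, hy, TensorProduct.tmul_add]

/-- `b ↦ 1 ⊗ b ⊗ 1`. -/
def leg2 (b : A) : (A ⊗[R] A) ⊗[R] A := (1 ⊗ₜ[R] b) ⊗ₜ[R] 1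

/-- Lets an element on legs 1 and 3 pass the leftover factor on leg 2 in the permuted cocycle
identities. -/
theorem leg2_commute (b : A) (z : A ⊗[R] A) : Commute (leg2 (R := R) b) (leg13 A z) := by
  induction z using TensorProduct.induction_on with
  | zero => simp
  | tmul a c => simp [leg2, Commute, SemiconjBy]
  | add x y hx hy => rw [map_add]; exact hx.add_right hy

theorem rot_assocInv (a : A) (w : A ⊗[R] A) :
    rot A (assocInv A (a ⊗ₜ[R] w)) = leg13 A (swap A w) * leg2 a := by
  induction w using TensorProduct.induction_on with
  | zero => simp
  | tmul b c => simp [leg2]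
  | add x y hx hy => simp only [TensorProduct.tmul_add, map_add, add_mul, hx, hy]

theorem flip12_assocInv (a : A) (w : A ⊗[R] A) :
    flip12 A (assocInv A (a ⊗ₜ[R] w)) = leg13 A w * leg2 a := by
  induction w using TensorProduct.induction_on with
  | zero => simp
  | tmul b c => simp [leg2]
  | add x y hx hy => simp only [TensorProduct.tmul_add, map_add, add_mul, hx, hy]

theorem rot_rot_tmul (w : A ⊗[R] A) (c : A) :
    rot A (rot A (w ⊗ₜ[R] c)) = leg13 A (swap A w) * leg2 c := by
  rw [rot_tmul, rot_assocInv]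

theorem rot_rot_assocInv (a : A) (w : A ⊗[R] A) :
    rot A (rot A (assocInv A (a ⊗ₜ[R] w))) = w ⊗ₜ[R] a := by
  induction w using TensorProduct.induction_on with
  | zero => simp
  | tmul b c => simp
  | add x y hx hy => simp only [TensorProduct.tmul_add, map_add, hx, hy, TensorProduct.add_tmul]

theorem flip12_rot_tmul (w : A ⊗[R] A) (c : A) :
    flip12 A (rot A (w ⊗ₜ[R] c)) = leg13 A w * leg2 c := by
  rw [rot_tmul, flip12_assocInv]

theorem flip12_rot_assocInv (a : A) (w : A ⊗[R] A) :
    flip12 A (rot A (assocInv A (a ⊗ₜ[R] w))) = assocInv A (a ⊗ₜ[R] swap A w) := by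
  induction w using TensorProduct.induction_on with
  | zero => simp
  | tmul b c => simp
  | add x y hx hy => simp only [TensorProduct.tmul_add, map_add, hx, hy]

theorem rot_leg12 (z : A ⊗[R] A) : rot A (leg12 A z) = leg23 A z := by
  rw [leg12_apply, rot_tmul, leg23_eq]

theorem rot_leg23 (z : A ⊗[R] A) : rot A (leg23 A z) = leg13 A (swap A z) := by
  rw [leg23_eq, rot_assocInv]; simp [leg2]
  exact mul_one _

theorem flip12_leg12 (z : A ⊗[R] A) : flip12 A (leg12 A z) = leg12 A (swap A z) := rfl

theorem flip12_leg23 (z : A ⊗[R] A) : flip12 A (leg23 A z) = leg13 A z := by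
  rw [leg23_eq, flip12_assocInv]; simp [leg2]
  exact mul_one _

theorem rot_leg13 (z : A ⊗[R] A) : rot A (leg13 A z) = leg12 A (swap A z) := by
  induction z using TensorProduct.induction_on with
  | zero => simp
  | tmul a b => simp
  | add x y hx hy => simp only [map_add, hx, hy]

theorem flip12_leg13 (z : A ⊗[R] A) : flip12 A (leg13 A z) = leg23 A z := by
  induction z using TensorProduct.induction_on with
  | zero => simp
  | tmul a b => simp
  | add x y hx hy => simp only [map_add, hx, hy]

theorem rot_comulLeft (Δ : A →ₐ[R] A ⊗[R] A) (z : A ⊗[R] A) :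
    rot A (comulLeft Δ z) = comulRight Δ (swap A z) := by
  induction z using TensorProduct.induction_on with
  | zero => simp
  | tmul a b => simp
  | add x y hx hy => simp only [map_add, hx, hy]

theorem rot_rot_comulRight (Δ : A →ₐ[R] A ⊗[R] A) (z : A ⊗[R] A) :
    rot A (rot A (comulRight Δ z)) = comulLeft Δ (swap A z) := by
  induction z using TensorProduct.induction_on with
  | zero => simp
  | tmul a b => simp [rot_rot_assocInv]
  | add x y hx hy => simp only [map_add, hx, hy]

end Legs

/-! ### Twisting a coproduct and its antipode. -/

section Twist

variable {R : Type u} [CommRing R] {A : Type u} [Ring A] [Algebra R A]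

/-- `x ↦ F f(x) G`, for `F` and `G` inverse to each other. -/
def conjHom {B : Type u} [Ring B] [Algebra R B] (f : A →ₐ[R] B) {F G : B} (hFG : F * G = 1)
    (hGF : G * F = 1) : A →ₐ[R] B :=
  AlgHom.ofLinearMap ((LinearMap.mulLeft R F ∘ₗ LinearMap.mulRight R G) ∘ₗ f.toLinearMap)
    (by simp [hFG]) (fun x y => by
      simp only [LinearMap.comp_apply, AlgHom.toLinearMap_apply, map_mul,
        LinearMap.mulLeft_apply, LinearMap.mulRight_apply]
      calc F * (f x * f y * G) = F * (f x * (1 : B) * f y * G) := by rw [mul_one]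
        _ = F * (f x * G) * (F * (f y * G)) := by rw [← hGF]; simp only [mul_assoc])

theorem conjHom_apply {B : Type u} [Ring B] [Algebra R B] (f : A →ₐ[R] B) {F G : B}
    (hFG : F * G = 1) (hGF : G * F = 1) (x : A) : conjHom f hFG hGF x = F * f x * G := by
  simp [conjHom, mul_assoc]

variable {Δ : A →ₐ[R] A ⊗[R] A} {F G : A ⊗[R] A} (hFG : F * G = 1) (hGF : G * F = 1)

theorem comulLeft_conjHom (z : A ⊗[R] A) :
    comulLeft (conjHom Δ hFG hGF) z = leg12 A F * comulLeft Δ z * leg12 A G := by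
  induction z using TensorProduct.induction_on with
  | zero => simp
  | tmul a b => simp [conjHom_apply]
  | add x y hx hy => simp only [map_add, hx, hy, mul_add, add_mul]

theorem comulRight_conjHom (z : A ⊗[R] A) :
    comulRight (conjHom Δ hFG hGF) z = leg23 A F * comulRight Δ z * leg23 A G := by
  induction z using TensorProduct.induction_on with
  | zero => simp
  | tmul a b =>
    rw [leg23_eq, leg23_eq, comulRight_tmul, comulRight_tmul, ← map_mul, ← map_mul, conjHom_apply]
    simp
  | add x y hx hy => simp only [map_add, hx, hy, mul_add, add_mul]

/-- Both iterated twisted coproducts conjugate the old one, by `F₁₂ (Δ ⊗ id) F` and by `F₂₃ (id ⊗ Δ)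
F`. The cocycle identity says these agree, and hence so do their inverses. -/
theorem twist_coassoc (hΔ : ∀ x, comulLeft Δ (Δ x) = comulRight Δ (Δ x))
    (hF : leg12 A F * comulLeft Δ F = leg23 A F * comulRight Δ F) (x : A) :
    comulLeft (conjHom Δ hFG hGF) (conjHom Δ hFG hGF x) =
      comulRight (conjHom Δ hFG hGF) (conjHom Δ hFG hGF x) := by
  have e1 : leg12 A F * comulLeft Δ F * (comulLeft Δ G * leg12 A G) = 1 := by
    rw [mul_assoc, ← mul_assoc (comulLeft Δ F), ← map_mul, hFG, map_one, one_mul, ← map_mul, hFG,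
      map_one]
  have e2 : comulRight Δ G * leg23 A G * (leg23 A F * comulRight Δ F) = 1 := by
    rw [mul_assoc, ← mul_assoc (leg23 A G), ← map_mul, hGF, map_one, one_mul, ← map_mul, hGF,
      map_one]
  have e3 : comulLeft Δ G * leg12 A G = comulRight Δ G * leg23 A G := by
    rw [hF] at e1
    exact (left_inv_eq_right_inv e2 e1).symm
  rw [comulLeft_conjHom, comulRight_conjHom, conjHom_apply]
  simp only [map_mul, hΔ]
  calc _ = (leg12 A F * comulLeft Δ F) * comulRight Δ (Δ x) *
        (comulLeft Δ G * leg12 A G) := by simp only [mul_assoc]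
    _ = _ := by rw [hF, e3]; simp only [mul_assoc]

variable (S : A →ₗ[R] A)

/-- `m ∘ (S ⊗ id)`. -/
def mulSLeft : A ⊗[R] A →ₗ[R] A := LinearMap.mul' R A ∘ₗ TensorProduct.map S LinearMap.id

/-- `m ∘ (id ⊗ S)`. -/
def mulSRight : A ⊗[R] A →ₗ[R] A := LinearMap.mul' R A ∘ₗ TensorProduct.map LinearMap.id S

@[simp] theorem mulSLeft_tmul (a b : A) : mulSLeft S (a ⊗ₜ[R] b) = S a * b := rfl

@[simp] theorem mulSRight_tmul (a b : A) : mulSRight S (a ⊗ₜ[R] b) = a * S b := rfl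

variable {S} (hS : ∀ x y, S (x * y) = S y * S x) (hS1 : S 1 = 1)
include hS

theorem mulSRight_tmul_mul (a b : A) (z : A ⊗[R] A) :
    mulSRight S (a ⊗ₜ b * z) = a * mulSRight S z * S b := by
  induction z using TensorProduct.induction_on with
  | zero => simp
  | tmul x y => simp [hS, mul_assoc]
  | add x y hx hy => simp only [map_add, hx, hy, mul_add, add_mul]

theorem mulSLeft_mul_tmul (a b : A) (z : A ⊗[R] A) :
    mulSLeft S (z * a ⊗ₜ b) = S a * mulSLeft S z * b := by
  induction z using TensorProduct.induction_on with
  | zero => simp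
  | tmul x y => simp [hS, mul_assoc]
  | add x y hx hy => simp only [map_add, hx, hy, mul_add, add_mul]

/-- As `S` reverses products, `m (id ⊗ S)` of a product nests the right factor inside the left one.
If the inner value is a scalar it slides out; this is used with `z = Δ x`. -/
theorem mulSRight_mul_of_central {z : A ⊗[R] A} {r : R} (hz : mulSRight S z = algebraMap R A r)
    (w : A ⊗[R] A) : mulSRight S (w * z) = algebraMap R A r * mulSRight S w := by
  induction w using TensorProduct.induction_on with
  | zero => simp
  | tmul x y =>
    rw [mulSRight_tmul_mul hS, hz, ← Algebra.commutes, mulSRight_tmul, mul_assoc]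
  | add x y hx hy => simp only [map_add, hx, hy, mul_add, add_mul]

theorem mulSLeft_mul_of_central {z : A ⊗[R] A} {r : R} (hz : mulSLeft S z = algebraMap R A r)
    (w : A ⊗[R] A) : mulSLeft S (z * w) = algebraMap R A r * mulSLeft S w := by
  induction w using TensorProduct.induction_on with
  | zero => simp
  | tmul x y =>
    rw [mulSLeft_mul_tmul hS, hz, ← Algebra.commutes, mulSLeft_tmul, mul_assoc]
  | add x y hx hy => simp only [map_add, hx, hy, mul_add]

omit hS in
/-- `x ↦ u S(x) v`. -/
def conjS (S : A →ₗ[R] A) (u v : A) : A →ₗ[R] A :=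
  LinearMap.mulRight R v ∘ₗ LinearMap.mulLeft R u ∘ₗ S

omit hS in
@[simp] theorem conjS_apply (u v x : A) : conjS S u v x = u * S x * v := rfl

theorem sandwich_right (z w : A ⊗[R] A) :
    mulSRight (conjS S (mulSRight S z) 1) w = mulSRight S (w * z) := by
  induction w using TensorProduct.induction_on with
  | zero => simp
  | tmul x y => rw [mulSRight_tmul_mul hS]; simp [mul_assoc]
  | add x y hx hy => simp only [map_add, hx, hy, add_mul]

theorem sandwich_left (z w : A ⊗[R] A) :
    mulSLeft (conjS S 1 (mulSLeft S z)) w = mulSLeft S (z * w) := by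
  induction w using TensorProduct.induction_on with
  | zero => simp
  | tmul x y => rw [mulSLeft_mul_tmul hS]; simp [mul_assoc]
  | add x y hx hy => simp only [map_add, hx, hy, mul_add]

include hS1

/-- The factor `m (id ⊗ S) F` in the new antipode, inserted between the legs of `G`, gives `m (id ⊗
S) (G F) = 1`; so `G` disappears and only `v` remains. -/
theorem mulSRight_conjS_mul (hGF : G * F = 1) (v : A) (z : A ⊗[R] A) :
    mulSRight (conjS S (mulSRight S F) v) (z * G) = mulSRight S z * v := by
  have hK : mulSRight (conjS S (mulSRight S F) 1) G = 1 := by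
    rw [sandwich_right hS, hGF, Algebra.TensorProduct.one_def, mulSRight_tmul, hS1, mul_one]
  induction z using TensorProduct.induction_on with
  | zero => simp
  | tmul x y =>
    have : ∀ w : A ⊗[R] A, mulSRight (conjS S (mulSRight S F) v) (x ⊗ₜ y * w) =
        x * mulSRight (conjS S (mulSRight S F) 1) w * (S y * v) := by
      intro w
      induction w using TensorProduct.induction_on with
      | zero => simp
      | tmul a b => simp [hS, mul_assoc]
      | add a b ha hb => simp only [map_add, ha, hb, mul_add, add_mul]
    rw [this, hK, mul_one, mulSRight_tmul, mul_assoc]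
  | add x y hx hy => simp only [map_add, hx, hy, add_mul]

theorem mulSLeft_conjS_mul (hGF : G * F = 1) (u : A) (z : A ⊗[R] A) :
    mulSLeft (conjS S u (mulSLeft S G)) (F * z) = u * mulSLeft S z := by
  have hK : mulSLeft (conjS S 1 (mulSLeft S G)) F = 1 := by
    rw [sandwich_left hS, hGF, Algebra.TensorProduct.one_def, mulSLeft_tmul, hS1, mul_one]
  induction z using TensorProduct.induction_on with
  | zero => simp
  | tmul x y =>
    have : ∀ w : A ⊗[R] A, mulSLeft (conjS S u (mulSLeft S G)) (w * x ⊗ₜ y) =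
        u * S x * mulSLeft (conjS S 1 (mulSLeft S G)) w * y := by
      intro w
      induction w using TensorProduct.induction_on with
      | zero => simp
      | tmul a b => simp [hS, mul_assoc]
      | add a b ha hb => simp only [map_add, ha, hb, mul_add, add_mul]
    rw [this, hK, mul_one, mulSLeft_tmul, mul_assoc]
  | add x y hx hy => simp only [map_add, hx, hy, mul_add]

omit hS1

/-- The element `m (id ⊗ S) F` is inverse to `m (S ⊗ id) F⁻¹`. -/
theorem twist_antipode_inv (e : A →ₐ[R] A) (he : ∀ x, ∃ r, e x = algebraMap R A r)
    (hl : ∀ x, mulSLeft S (Δ x) = e x) (hr : ∀ x, mulSRight S (Δ x) = e x)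
    (hFl : Algebra.TensorProduct.map e (AlgHom.id R A) F = 1)
    (hFr : Algebra.TensorProduct.map (AlgHom.id R A) e F = 1) (hGF : G * F = 1)
    (hF : leg12 A F * comulLeft Δ F = leg23 A F * comulRight Δ F) :
    mulSRight S F * mulSLeft S G = 1 := by
  -- `φ` sends `a ⊗ b ⊗ c` to `a S(b) c`. It is applied to `F₂₃⁻¹ F₁₂ (Δ ⊗ id) F = (id ⊗ Δ) F`: the
  -- antipode and counit axioms turn the right side into `1` and the left side into the wanted
  -- product.
  let φ : (A ⊗[R] A) ⊗[R] A →ₗ[R] A :=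
    LinearMap.mul' R A ∘ₗ TensorProduct.map (mulSRight S) LinearMap.id
  have h1 : leg23 A G * leg12 A F * comulLeft Δ F = comulRight Δ F := by
    rw [mul_assoc, hF, ← mul_assoc, ← map_mul, hGF, map_one, one_mul]
  have h2 : ∀ K : A ⊗[R] A, φ (comulRight Δ K) =
      LinearMap.mul' R A (Algebra.TensorProduct.map (AlgHom.id R A) e K) := by
    intro K
    induction K using TensorProduct.induction_on with
    | zero => simp
    | tmul a b =>
      have : ∀ w : A ⊗[R] A, φ (assocInv A (a ⊗ₜ w)) = a * mulSLeft S w := by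
        intro w
        induction w using TensorProduct.induction_on with
        | zero => simp
        | tmul c d => simp [φ, mul_assoc]
        | add x y hx hy => simp only [map_add, hx, hy, mul_add, TensorProduct.tmul_add]
      rw [comulRight_tmul, this, hl]
      simp
    | add x y hx hy => simp only [map_add, hx, hy]
  -- The three factors are decoupled, since the reduction to pure tensors needs them to vary
  -- independently.
  have h3 : ∀ F' G' K : A ⊗[R] A, φ (leg23 A G' * leg12 A F' * comulLeft Δ K) =
      mulSRight S F' * mulSLeft S G' *
        LinearMap.mul' R A (Algebra.TensorProduct.map e (AlgHom.id R A) K) := by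
    intro F' G' K
    induction K using TensorProduct.induction_on with
    | zero => simp
    | add x y hx hy => simp only [map_add, hx, hy, mul_add]
    | tmul k k' =>
      induction G' using TensorProduct.induction_on with
      | zero => simp
      | add x y hx hy => simp only [map_add, hx, hy, add_mul, mul_add]
      | tmul g g' =>
        induction F' using TensorProduct.induction_on with
        | zero => simp
        | add x y hx hy => simp only [map_add, hx, hy, add_mul, mul_add]
        | tmul f f' =>
          have : leg23 A (g ⊗ₜ g') * leg12 A (f ⊗ₜ f') * comulLeft Δ (k ⊗ₜ k') =
              (f ⊗ₜ[R] (g * f') * Δ k) ⊗ₜ[R] (g' * k') := by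
            simp
          rw [this]
          obtain ⟨r, hr'⟩ := he k
          simp only [φ, LinearMap.comp_apply, TensorProduct.map_tmul, mulSRight_tmul_mul hS, hr,
            hr', LinearMap.mul'_apply, LinearMap.id_apply, hS, mulSRight_tmul, mulSLeft_tmul,
            Algebra.TensorProduct.map_tmul, AlgHom.id_apply]
          simp only [mul_assoc, Algebra.commutes r]
  have h4 := h3 F G F
  rw [h1, h2, hFl, hFr] at h4
  simpa [Algebra.TensorProduct.one_def] using h4.symm

end Twist

/-! ### Twisting a universal R-matrix. -/

section TwistR

variable {R : Type u} [CommRing R] {A : Type u} [Ring A] [Algebra R A]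
  {Δ : A →ₐ[R] A ⊗[R] A} {F G Q : A ⊗[R] A}

/-- On `a ⊗ b` the two permuted expressions carry `Δ^op(a)` and `Δ(a)` on legs 1 and 3, with `b` on
leg 2, so this is `R Δ = Δ^op R` on the outer legs. The next three lemmas are the other placements
needed. -/
theorem comulLeft_mul_leg13 (hQ : ∀ x, Q * Δ x = swap A (Δ x) * Q) (z : A ⊗[R] A) :
    rot A (rot A (comulLeft Δ z)) * leg13 A Q = leg13 A Q * flip12 A (rot A (comulLeft Δ z)) := by
  induction z using TensorProduct.induction_on with
  | zero => simp
  | tmul a b =>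
    rw [comulLeft_tmul, rot_rot_tmul, flip12_rot_tmul, mul_assoc, (leg2_commute b Q).eq,
      ← mul_assoc, ← mul_assoc, ← map_mul, ← map_mul, hQ]
  | add x y hx hy => simp only [map_add, add_mul, mul_add, hx, hy]

theorem comulRight_mul_leg23 (hQ : ∀ x, Q * Δ x = swap A (Δ x) * Q) (z : A ⊗[R] A) :
    flip12 A (rot A (comulRight Δ z)) * leg23 A Q = leg23 A Q * comulRight Δ z := by
  induction z using TensorProduct.induction_on with
  | zero => simp
  | tmul a b =>
    rw [comulRight_tmul, flip12_rot_assocInv, leg23_eq, ← map_mul, ← map_mul]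
    simp [hQ]
  | add x y hx hy => simp only [map_add, add_mul, mul_add, hx, hy]

theorem comulRight_mul_leg13 (hQ : ∀ x, Q * Δ x = swap A (Δ x) * Q) (z : A ⊗[R] A) :
    rot A (comulRight Δ z) * leg13 A Q = leg13 A Q * flip12 A (comulRight Δ z) := by
  induction z using TensorProduct.induction_on with
  | zero => simp
  | tmul a b =>
    rw [comulRight_tmul, rot_assocInv, flip12_assocInv, mul_assoc, (leg2_commute a Q).eq,
      ← mul_assoc, ← mul_assoc, ← map_mul, ← map_mul, hQ]
  | add x y hx hy => simp only [map_add, add_mul, mul_add, hx, hy]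

theorem comulLeft_mul_leg12 (hQ : ∀ x, Q * Δ x = swap A (Δ x) * Q) (z : A ⊗[R] A) :
    flip12 A (comulLeft Δ z) * leg12 A Q = leg12 A Q * comulLeft Δ z := by
  induction z using TensorProduct.induction_on with
  | zero => simp
  | tmul a b => simp [hQ]
  | add x y hx hy => simp only [map_add, add_mul, mul_add, hx, hy]

variable (hFG : F * G = 1) (hGF : G * F = 1)

theorem twistR_comm (hQ : ∀ x, Q * Δ x = swap A (Δ x) * Q) (x : A) :
    swap A F * Q * G * conjHom Δ hFG hGF x =
      swap A (conjHom Δ hFG hGF x) * (swap A F * Q * G) := by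
  have h1 : swap A G * swap A F = 1 := by rw [← map_mul, hGF, map_one]
  rw [conjHom_apply]
  simp only [map_mul]
  calc swap A F * Q * G * (F * Δ x * G) = swap A F * (Q * ((G * F) * Δ x)) * G := by
        simp only [mul_assoc]
    _ = swap A F * swap A (Δ x) * ((swap A G * swap A F) * Q) * G := by
        rw [hGF, one_mul, hQ, h1, one_mul]; simp only [mul_assoc]
    _ = _ := by simp only [mul_assoc]

include hFG hGF

/-- The unpermuted cocycle identity, solved for the form in which it closes the two computations
below. -/
theorem twist_comul_inv (hF : leg12 A F * comulLeft Δ F = leg23 A F * comulRight Δ F) :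
    comulRight Δ F * comulLeft Δ G * leg12 A G = leg23 A G ∧
      comulLeft Δ F * comulRight Δ G * leg23 A G = leg12 A G := by
  have hl : leg12 A G * leg12 A F = 1 := by rw [← map_mul, hGF, map_one]
  have hl' : leg12 A F * leg12 A G = 1 := by rw [← map_mul, hFG, map_one]
  have hr : leg23 A G * leg23 A F = 1 := by rw [← map_mul, hGF, map_one]
  have hr' : leg23 A F * leg23 A G = 1 := by rw [← map_mul, hFG, map_one]
  have hc : comulLeft Δ F * comulLeft Δ G = 1 := by rw [← map_mul, hFG, map_one]
  have hd : comulRight Δ F * comulRight Δ G = 1 := by rw [← map_mul, hFG, map_one]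
  have e1 : comulRight Δ F = leg23 A G * leg12 A F * comulLeft Δ F := by
    rw [mul_assoc, hF, ← mul_assoc, hr, one_mul]
  have e2 : comulLeft Δ F = leg12 A G * leg23 A F * comulRight Δ F := by
    rw [mul_assoc, ← hF, ← mul_assoc, hl, one_mul]
  constructor
  · rw [e1, mul_assoc (_ * _) (comulLeft Δ F), hc, mul_one, mul_assoc, hl', mul_one]
  · rw [e2, mul_assoc (_ * _) (comulRight Δ F), hd, mul_one, mul_assoc, hr', mul_one]

/-- The cocycle identity is used in three arrangements of the legs. One replaces `F₁₂ (Δ ⊗ id) F₂₁`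
by `F₃₁` times a permuted `(Δ ⊗ id) F`; this passes `R₁₃`. A second arrangement produces `F₁₃⁻¹
F₃₂`, and what follows passes `R₂₃`. The original one collapses the rest to `F₂₃⁻¹`. -/
theorem twistR_comulLeft (hQ : ∀ x, Q * Δ x = swap A (Δ x) * Q)
    (hQl : comulLeft Δ Q = leg13 A Q * leg23 A Q)
    (hF : leg12 A F * comulLeft Δ F = leg23 A F * comulRight Δ F) :
    comulLeft (conjHom Δ hFG hGF) (swap A F * Q * G) =
      leg13 A (swap A F * Q * G) * leg23 A (swap A F * Q * G) := by
  have e1 := congrArg (fun z => rot A (rot A z)) hF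
  simp only [map_mul, rot_leg12, rot_leg23, rot_leg13, swap_swap, rot_rot_comulRight] at e1
  have e2 := congrArg (fun z => flip12 A (rot A z)) hF
  simp only [map_mul, rot_leg12, rot_leg23, flip12_leg23, flip12_leg13] at e2
  have h13 : leg13 A G * leg13 A F = 1 := by rw [← map_mul, hGF, map_one]
  have e3 : flip12 A (rot A (comulLeft Δ F)) =
      leg13 A G * (leg23 A (swap A F) * flip12 A (rot A (comulRight Δ F))) := by
    rw [← e2, ← mul_assoc, h13, one_mul]
  rw [comulLeft_conjHom]
  simp only [map_mul]
  rw [← mul_assoc, ← mul_assoc, ← e1, hQl]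
  calc leg13 A (swap A F) * rot A (rot A (comulLeft Δ F)) * (leg13 A Q * leg23 A Q) *
        comulLeft Δ G * leg12 A G
      = leg13 A (swap A F) * (rot A (rot A (comulLeft Δ F)) * leg13 A Q) * leg23 A Q *
        comulLeft Δ G * leg12 A G := by simp only [mul_assoc]
    _ = leg13 A (swap A F) * leg13 A Q * leg13 A G * (leg23 A (swap A F) *
          (flip12 A (rot A (comulRight Δ F)) * leg23 A Q)) * comulLeft Δ G * leg12 A G := by
        rw [comulLeft_mul_leg13 hQ, e3]; simp only [mul_assoc]
    _ = leg13 A (swap A F) * leg13 A Q * leg13 A G * (leg23 A (swap A F) * (leg23 A Q *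
          (comulRight Δ F * comulLeft Δ G * leg12 A G))) := by
        rw [comulRight_mul_leg23 hQ]; simp only [mul_assoc]
    _ = _ := by rw [(twist_comul_inv hFG hGF hF).1]; simp only [mul_assoc]

theorem twistR_comulRight (hQ : ∀ x, Q * Δ x = swap A (Δ x) * Q)
    (hQr : comulRight Δ Q = leg13 A Q * leg12 A Q)
    (hF : leg12 A F * comulLeft Δ F = leg23 A F * comulRight Δ F) :
    comulRight (conjHom Δ hFG hGF) (swap A F * Q * G) =
      leg13 A (swap A F * Q * G) * leg12 A (swap A F * Q * G) := by
  have e1 := congrArg (fun z => rot A z) hF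
  simp only [map_mul, rot_leg12, rot_leg23, rot_comulLeft] at e1
  have e2 := congrArg (fun z => flip12 A z) hF
  simp only [map_mul, flip12_leg23, flip12_leg12] at e2
  have h13 : leg13 A G * leg13 A F = 1 := by rw [← map_mul, hGF, map_one]
  have e3 : flip12 A (comulRight Δ F) =
      leg13 A G * (leg12 A (swap A F) * flip12 A (comulLeft Δ F)) := by
    rw [e2, ← mul_assoc, h13, one_mul]
  rw [comulRight_conjHom]
  simp only [map_mul]
  rw [← mul_assoc, ← mul_assoc, e1, hQr]
  calc leg13 A (swap A F) * rot A (comulRight Δ F) * (leg13 A Q * leg12 A Q) *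
        comulRight Δ G * leg23 A G
      = leg13 A (swap A F) * (rot A (comulRight Δ F) * leg13 A Q) * leg12 A Q *
        comulRight Δ G * leg23 A G := by simp only [mul_assoc]
    _ = leg13 A (swap A F) * leg13 A Q * leg13 A G * (leg12 A (swap A F) *
          (flip12 A (comulLeft Δ F) * leg12 A Q)) * comulRight Δ G * leg23 A G := by
        rw [comulRight_mul_leg13 hQ, e3]; simp only [mul_assoc]
    _ = leg13 A (swap A F) * leg13 A Q * leg13 A G * (leg12 A (swap A F) * (leg12 A Q *
          (comulLeft Δ F * comulRight Δ G * leg23 A G))) := by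
        rw [comulLeft_mul_leg12 hQ]; simp only [mul_assoc]
    _ = _ := by rw [(twist_comul_inv hFG hGF hF).2]; simp only [mul_assoc]

end TwistR

/-! ### Twists of topological Hopf algebras. -/

section HopfTwist

variable {R : Type u} [CommRing R] {J : ℕ → Ideal R} {T : Tower R J}

/-- `R ⧸ J n` acts on the reduction modulo `J n`. -/
def Tower.unit (T : Tower R J) (n : ℕ) : R ⧸ J n →ₐ[R] T.obj n :=
  Ideal.Quotient.liftₐ (J n) (Algebra.ofId R (T.obj n)) fun c hc => by
    have := T.ann n c hc 1
    rwa [Algebra.smul_def, mul_one] at this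

theorem Tower.unit_mk (T : Tower R J) (n : ℕ) (r : R) :
    T.unit n (Ideal.Quotient.mk (J n) r) = algebraMap R _ r := rfl

namespace Hopf

variable (A : Hopf T)

/-- The counit with values in `T`. -/
def unitCounit (n : ℕ) : T.obj n →ₐ[R] T.obj n := (T.unit n).comp (A.ε n)

theorem unitCounit_eq {n : ℕ} {x : T.obj n} {r : R} (h : A.ε n x = Ideal.Quotient.mk (J n) r) :
    A.unitCounit n x = algebraMap R _ r := by
  rw [unitCounit, AlgHom.comp_apply, h, Tower.unit_mk]

theorem exists_counit (n : ℕ) (x : T.obj n) : ∃ r : R, A.ε n x = Ideal.Quotient.mk (J n) r := by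
  obtain ⟨r, hr⟩ := Ideal.Quotient.mk_surjective (A.ε n x)
  exact ⟨r, hr.symm⟩

theorem mulSLeft_comul (n : ℕ) (x : T.obj n) : mulSLeft (A.S n) (A.Δ n x) = A.unitCounit n x := by
  obtain ⟨r, hr⟩ := A.exists_counit n x
  rw [A.unitCounit_eq hr]
  exact A.antipode_left n x r hr

theorem mulSRight_comul (n : ℕ) (x : T.obj n) :
    mulSRight (A.S n) (A.Δ n x) = A.unitCounit n x := by
  obtain ⟨r, hr⟩ := A.exists_counit n x
  rw [A.unitCounit_eq hr]
  exact A.antipode_right n x r hr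

theorem S_one (n : ℕ) : A.S n 1 = 1 := by
  have h := A.antipode_left n 1 1 (by rw [map_one, map_one])
  simpa [Algebra.TensorProduct.one_def] using h

theorem comul_coassoc (n : ℕ) (x : T.obj n) :
    comulLeft (A.Δ n) (A.Δ n x) = comulRight (A.Δ n) (A.Δ n x) := A.coassoc n x

variable {A} {F : ∀ n, T.T2 n}

theorem IsTwist.map_unitCounit_left (hF : A.IsTwist F) (n : ℕ) :
    Algebra.TensorProduct.map (A.unitCounit n) (AlgHom.id R _) (F n) = 1 := by
  have h := congrArg (Algebra.TensorProduct.map (T.unit n) (AlgHom.id R _)) (hF.counit_left n)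
  rw [map_one, ← AlgHom.comp_apply, ← Algebra.TensorProduct.map_comp] at h
  exact h

theorem IsTwist.map_unitCounit_right (hF : A.IsTwist F) (n : ℕ) :
    Algebra.TensorProduct.map (AlgHom.id R _) (A.unitCounit n) (F n) = 1 := by
  have h := congrArg (Algebra.TensorProduct.map (AlgHom.id R _) (T.unit n)) (hF.counit_right n)
  rw [map_one, ← AlgHom.comp_apply, ← Algebra.TensorProduct.map_comp] at h
  exact h

theorem IsTwist.mul_inverse (hF : A.IsTwist F) (n : ℕ) : F n * Ring.inverse (F n) = 1 :=
  Ring.mul_inverse_cancel _ (hF.isUnit n)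

theorem IsTwist.inverse_mul (hF : A.IsTwist F) (n : ℕ) : Ring.inverse (F n) * F n = 1 :=
  Ring.inverse_mul_cancel _ (hF.isUnit n)

theorem IsTwist.cocycle_eq (hF : A.IsTwist F) (n : ℕ) :
    leg12 _ (F n) * comulLeft (A.Δ n) (F n) = leg23 _ (F n) * comulRight (A.Δ n) (F n) :=
  hF.cocycle n

/-- The transition maps preserve `F`, hence its unique inverse. -/
theorem IsTwist.inverse_compat (hF : A.IsTwist F) : T.Compat2 fun n => Ring.inverse (F n) := by
  intro n
  have h := congrArg (T.tr2 n) (hF.inverse_mul (n + 1))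
  rw [map_mul, hF.compat n, map_one] at h
  exact left_inv_eq_right_inv h (hF.mul_inverse n)

theorem tr_mulSRight {S : ∀ n, T.obj n →ₗ[R] T.obj n}
    (hS : ∀ n x, T.tr n (S (n + 1) x) = S n (T.tr n x)) (n : ℕ) (z : T.T2 (n + 1)) :
    T.tr n (mulSRight (S (n + 1)) z) = mulSRight (S n) (T.tr2 n z) := by
  induction z using TensorProduct.induction_on with
  | zero => simp
  | tmul a b => simp [Tower.tr2, hS]
  | add x y hx hy => simp only [map_add, hx, hy]

theorem tr_mulSLeft {S : ∀ n, T.obj n →ₗ[R] T.obj n}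
    (hS : ∀ n x, T.tr n (S (n + 1) x) = S n (T.tr n x)) (n : ℕ) (z : T.T2 (n + 1)) :
    T.tr n (mulSLeft (S (n + 1)) z) = mulSLeft (S n) (T.tr2 n z) := by
  induction z using TensorProduct.induction_on with
  | zero => simp
  | tmul a b => simp [Tower.tr2, hS]
  | add x y hx hy => simp only [map_add, hx, hy]

/-- The twist of a topological Hopf algebra. -/
def twist (A : Hopf T) (F : ∀ n, T.T2 n) (hF : A.IsTwist F)
    (hS : ∀ n x y, A.S n (x * y) = A.S n y * A.S n x) : Hopf T where
  Δ n := conjHom (A.Δ n) (hF.mul_inverse n) (hF.inverse_mul n)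
  ε := A.ε
  -- The new antipode is `x ↦ u S(x) v` with `u = m (id ⊗ S) F` and `v = m (S ⊗ id) F⁻¹`. Both
  -- antipode axioms below need only the one-sided relation `u v = 1`.
  S n := conjS (A.S n) (mulSRight (A.S n) (F n)) (mulSLeft (A.S n) (Ring.inverse (F n)))
  Δ_tr n x := by
    rw [conjHom_apply, conjHom_apply, map_mul, map_mul, hF.compat n, A.Δ_tr, hF.inverse_compat n]
  ε_tr := A.ε_tr
  S_tr n x := by
    simp only [conjS_apply, map_mul, tr_mulSRight A.S_tr, tr_mulSLeft A.S_tr, A.S_tr]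
    rw [hF.compat n, hF.inverse_compat n]
  coassoc n x := twist_coassoc _ _ (A.comul_coassoc n) (hF.cocycle_eq n) x
  counit_left n x := by
    have h := congrArg (Algebra.TensorProduct.map (A.ε n) (AlgHom.id R _)) (hF.mul_inverse n)
    rw [map_mul, hF.counit_left, one_mul, map_one] at h
    rw [conjHom_apply, map_mul, map_mul, hF.counit_left, A.counit_left, h, one_mul, mul_one]
  counit_right n x := by
    have h := congrArg (Algebra.TensorProduct.map (AlgHom.id R _) (A.ε n)) (hF.mul_inverse n)
    rw [map_mul, hF.counit_right, one_mul, map_one] at h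
    rw [conjHom_apply, map_mul, map_mul, hF.counit_right, A.counit_right, h, one_mul, mul_one]
  antipode_left n x r hr := by
    have huv := twist_antipode_inv (hS n) (A.unitCounit n)
      (fun y => (A.exists_counit n y).imp fun r hr => A.unitCounit_eq hr)
      (A.mulSLeft_comul n) (A.mulSRight_comul n) (hF.map_unitCounit_left n)
      (hF.map_unitCounit_right n) (hF.inverse_mul n) (hF.cocycle_eq n)
    have h := mulSLeft_conjS_mul (hS n) (A.S_one n) (hF.inverse_mul n) (mulSRight (A.S n) (F n))
      (A.Δ n x * Ring.inverse (F n))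
    rw [mulSLeft_mul_of_central (hS n) (A.antipode_left n x r hr), Algebra.left_comm, huv,
      mul_one, ← mul_assoc] at h
    rw [conjHom_apply]
    exact h
  antipode_right n x r hr := by
    have huv := twist_antipode_inv (hS n) (A.unitCounit n)
      (fun y => (A.exists_counit n y).imp fun r hr => A.unitCounit_eq hr)
      (A.mulSLeft_comul n) (A.mulSRight_comul n) (hF.map_unitCounit_left n)
      (hF.map_unitCounit_right n) (hF.inverse_mul n) (hF.cocycle_eq n)
    have h := mulSRight_conjS_mul (hS n) (A.S_one n) (hF.inverse_mul n)
      (mulSLeft (A.S n) (Ring.inverse (F n))) (F n * A.Δ n x)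
    rw [mulSRight_mul_of_central (hS n) (A.antipode_right n x r hr), mul_assoc (algebraMap R _ r), huv,
      mul_one] at h
    rw [conjHom_apply]
    exact h

variable (hF : A.IsTwist F) (hS : ∀ n x y, A.S n (x * y) = A.S n y * A.S n x)

theorem twist_isTwistOf : (A.twist F hF hS).IsTwistOf A F where
  comul n x := conjHom_apply _ (hF.mul_inverse n) (hF.inverse_mul n) x
  counit _ _ := rfl

theorem twist_isUniversalR {Q : ∀ n, T.T2 n} (hQ : A.IsUniversalR Q) :
    (A.twist F hF hS).IsUniversalR fun n => swap _ (F n) * Q n * Ring.inverse (F n) where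
  compat n := by
    have h : ∀ z : T.T2 (n + 1), T.tr2 n (swap _ z) = swap _ (T.tr2 n z) := by
      intro z
      induction z using TensorProduct.induction_on with
      | zero => simp
      | tmul a b => simp [Tower.tr2]
      | add x y hx hy => simp only [map_add, hx, hy]
    rw [map_mul, map_mul, h, hF.compat n, hQ.compat n, hF.inverse_compat n]
  isUnit n := (((hF.isUnit n).map (swap _)).mul (hQ.isUnit n)).mul (hF.isUnit n).ringInverse
  comm n x := twistR_comm (hF.mul_inverse n) (hF.inverse_mul n) (hQ.comm n) x
  comul_left n := twistR_comulLeft (hF.mul_inverse n) (hF.inverse_mul n) (hQ.comm n) (hQ.comul_left n) (hF.cocycle_eq n)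
  comul_right n := twistR_comulRight (hF.mul_inverse n) (hF.inverse_mul n) (hQ.comm n) (hQ.comul_right n) (hF.cocycle_eq n)

end Hopf

end HopfTwist

/-! ### Triples satisfying the relations, their coproduct and antipode. -/

section Triple

open PowerSeries

variable {R : Type u} [CommRing R] [Algebra ℂ R] {A B : Type u} [Ring A] [Algebra R A]
  [Ring B] [Algebra R B] {I : Ideal R} {n : ℕ} {h : R}

/-- The defining relations of `U_q(sl(2))` modulo `h ^ n`. -/
structure SlTriple (n : ℕ) (h : R) (H Ep Em : A) : Prop where
  H_Ep : H * Ep - Ep * H = Ep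
  H_Em : H * Em - Em * H = -Em
  Ep_Em : Ep * Em - Em * Ep = qbracket R n h H

/-- Moving `x` to the left replaces `a` by `a + b`, and the exponential splits because `a` and `b`
commute. Every commutation of a Cartan exponential with a root vector is an instance. -/
theorem Killed.nexp_shift (hA : Killed I n A) {a b x : A} (hax : a * x = x * (a + b))
    (hab : Commute a b) (ha : Small I a) (hb : Small I b) :
    nexp R n a * x = x * nexp R n b * nexp R n a := by
  rw [nexp_intertwine hax, add_comm, hA.nexp_add hab.symm hb ha, mul_assoc]

theorem Killed.ev_mul_smul (hA : Killed I n A) (hh : h ∈ I) (p q : ℂ⟦X⟧) (x : A) :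
    ev R n (p * q) h • x = ev R n p h • ev R n q h • x := by
  simp only [smul_ev, ev_mul p q (hA.pow (small_algebraMap hh)), mul_assoc]

theorem Killed.ev_one_smul (hA : Killed I n A) (hh : h ∈ I) (x : A) :
    ev R n (1 : ℂ⟦X⟧) h • x = x := by
  rw [smul_ev, ev_one (hA.pow (small_algebraMap hh)), one_mul]

theorem expS_add (a b : ℂ) : expS (a + b) = expS a * expS b :=
  (exp_mul_exp_eq_exp_add a b).symm

theorem expS_zero : expS 0 = 1 := by simp [expS]

theorem nexp_smul_one (c : ℂ) (x : A) :
    nexp R n (h • algebraMap ℂ R c • (1 : A)) * x = ev R n (expS c) h • x := by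
  rw [smul_ev, ev_expS, smul_comm, ← Algebra.algebraMap_eq_smul_one h]

theorem Killed.nexp_smul_add (hA : Killed I n A) (hh : h ∈ I) (c : ℂ) (x : A) :
    nexp R n (h • (x + algebraMap ℂ R c • (1 : A))) = ev R n (expS c) h • nexp R n (h • x) := by
  have hc : Commute (h • algebraMap ℂ R c • (1 : A)) (h • x) :=
    (((Commute.one_left x).smul_left _).smul_left _).smul_right _
  rw [smul_add, add_comm, hA.nexp_add hc (small_smul hh _) (small_smul hh _), nexp_smul_one]

theorem Killed.nexp_mul_of_shift (hA : Killed I n A) (hh : h ∈ I) {H x : A} {c : ℂ}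
    (hx : H * x = x * (H + algebraMap ℂ R c • (1 : A))) :
    nexp R n (h • H) * x = ev R n (expS c) h • (x * nexp R n (h • H)) := by
  rw [nexp_intertwine (b := h • (H + algebraMap ℂ R c • (1 : A)))
    (by rw [smul_mul_assoc, hx, mul_smul_comm]), hA.nexp_smul_add hh, mul_smul_comm]

theorem Killed.nexp_neg_mul_of_shift (hA : Killed I n A) (hh : h ∈ I) {H x : A} {c : ℂ}
    (hx : H * x = x * (H + algebraMap ℂ R c • (1 : A))) :
    nexp R n (-(h • H)) * x = ev R n (expS (-c)) h • (x * nexp R n (-(h • H))) := by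
  rw [← smul_neg]
  refine hA.nexp_mul_of_shift hh ?_
  rw [neg_mul, hx, map_neg, neg_smul, ← neg_add, mul_neg]

namespace SlTriple

variable {H Ep Em : A} (t : SlTriple n h H Ep Em)
include t

theorem shift_Ep : H * Ep = Ep * (H + algebraMap ℂ R 1 • (1 : A)) := by
  have := t.H_Ep
  rw [map_one, one_smul, mul_add, mul_one, ← sub_eq_iff_eq_add', this]

theorem shift_Em : H * Em = Em * (H + algebraMap ℂ R (-1) • (1 : A)) := by
  have := t.H_Em
  rw [map_neg, map_one, neg_one_smul, mul_add, mul_neg_one, ← sub_eq_iff_eq_add', this]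

theorem map (f : A →ₐ[R] B) : SlTriple n h (f H) (f Ep) (f Em) where
  H_Ep := by rw [← map_mul, ← map_mul, ← map_sub, t.H_Ep]
  H_Em := by rw [← map_mul, ← map_mul, ← map_sub, t.H_Em, map_neg]
  Ep_Em := by rw [← map_mul, ← map_mul, ← map_sub, t.Ep_Em, map_qbracket]

/-- In the third relation the mixed terms cancel: both products of `e^{hH} ⊗ E₊` and `E₋ ⊗ e^{-hH}`
equal `e^{-h}` times `E₋ e^{hH} ⊗ E₊ e^{-hH}`. What remains is the addition formula for the bracket
at `H ⊗ 1` and `1 ⊗ H`. -/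
theorem comul (hA : Killed I n A) (hh : h ∈ I) :
    SlTriple n h (H ⊗ₜ[R] (1 : A) + (1 : A) ⊗ₜ[R] H)
      (Ep ⊗ₜ[R] (1 : A) + nexp R n (h • H) ⊗ₜ[R] Ep)
      (Em ⊗ₜ[R] nexp R n (-(h • H)) + (1 : A) ⊗ₜ[R] Em) where
  H_Ep := by
    have hK : H * nexp R n (h • H) = nexp R n (h • H) * H :=
      (nexp_commute (a := h • H) (x := H) ((Commute.refl H).smul_left h) n).symm.eq
    have e := t.H_Ep
    rw [sub_eq_iff_eq_add] at e
    simp only [mul_add, add_mul, Algebra.TensorProduct.tmul_mul_tmul, mul_one, one_mul, e, hK,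
      TensorProduct.add_tmul, TensorProduct.tmul_add]
    abel
  H_Em := by
    have hK : H * nexp R n (-(h • H)) = nexp R n (-(h • H)) * H :=
      (nexp_commute (a := -(h • H)) (x := H) ((Commute.refl H).smul_left h).neg_left n).symm.eq
    have e := t.H_Em
    rw [sub_eq_iff_eq_add] at e
    simp only [mul_add, add_mul, Algebra.TensorProduct.tmul_mul_tmul, mul_one, one_mul, e, hK,
      TensorProduct.add_tmul, TensorProduct.tmul_add, TensorProduct.neg_tmul,
      TensorProduct.tmul_neg]
    abel
  Ep_Em := by
    have e1 := hA.nexp_mul_of_shift hh t.shift_Em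
    have e2 := hA.nexp_neg_mul_of_shift hh t.shift_Ep
    have hAA : Killed I n (A ⊗[R] A) := hA.tensor
    have hc : Commute (H ⊗ₜ[R] (1 : A)) ((1 : A) ⊗ₜ[R] H) := by
      simp [Commute, SemiconjBy]
    have q1 : qbracket R n h (H ⊗ₜ[R] (1 : A)) = qbracket R n h H ⊗ₜ[R] 1 :=
      (map_qbracket (Algebra.TensorProduct.includeLeft : A →ₐ[R] A ⊗[R] A) n h H).symm
    have q2 : qbracket R n h ((1 : A) ⊗ₜ[R] H) = 1 ⊗ₜ[R] qbracket R n h H :=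
      (map_qbracket (Algebra.TensorProduct.includeRight : A →ₐ[R] A ⊗[R] A) n h H).symm
    have k1 : nexp R n (h • (H ⊗ₜ[R] (1 : A))) = nexp R n (h • H) ⊗ₜ[R] 1 := by
      rw [TensorProduct.smul_tmul']
      exact (map_nexp (Algebra.TensorProduct.includeLeft : A →ₐ[R] A ⊗[R] A) n _).symm
    have k2 : nexp R n (-(h • ((1 : A) ⊗ₜ[R] H))) = 1 ⊗ₜ[R] nexp R n (-(h • H)) := by
      rw [← TensorProduct.tmul_smul, ← TensorProduct.tmul_neg]
      exact (map_nexp (Algebra.TensorProduct.includeRight : A →ₐ[R] A ⊗[R] A) n _).symm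
    rw [hAA.qbracket_add hh hc, q1, q2, k1, k2]
    simp only [mul_add, add_mul, Algebra.TensorProduct.tmul_mul_tmul, mul_one, one_mul, ← t.Ep_Em,
      e1, e2, TensorProduct.sub_tmul, TensorProduct.tmul_sub, TensorProduct.tmul_smul,
      ← TensorProduct.smul_tmul']
    simp only [sub_mul, mul_sub, Algebra.TensorProduct.tmul_mul_tmul, mul_one, one_mul]
    abel

end SlTriple

theorem op_ev (p : ℂ⟦X⟧) (a : A) :
    ev R n p (MulOpposite.op a) = MulOpposite.op (ev R n p a) := by
  simp [ev]

theorem op_qbracket (h : R) (a : A) :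
    qbracket R n h (MulOpposite.op a) = MulOpposite.op (qbracket R n h a) := by
  simp [qbracket]

/-- An antipode is an algebra map to the opposite algebra, so its values on generators must form a
triple there. In the third relation the Cartan factors cancel because `E₊ E₋` commutes with `H`, and
the sign is `qbracket_neg`. -/
theorem SlTriple.antipode {H Ep Em : A} (t : SlTriple n h H Ep Em) (hA : Killed I n A)
    (hh : h ∈ I) :
    SlTriple n h (MulOpposite.op (-H)) (MulOpposite.op (-(nexp R n (-(h • H)) * Ep)))
      (MulOpposite.op (-(Em * nexp R n (h • H)))) := by
  have hK : H * nexp R n (h • H) = nexp R n (h • H) * H :=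
    (nexp_commute (a := h • H) (x := H) ((Commute.refl H).smul_left h) n).symm.eq
  have hK' : H * nexp R n (-(h • H)) = nexp R n (-(h • H)) * H :=
    (nexp_commute (a := -(h • H)) (x := H) ((Commute.refl H).smul_left h).neg_left n).symm.eq
  have e1 := t.H_Ep
  have e2 := t.H_Em
  rw [sub_eq_iff_eq_add] at e1 e2
  constructor
  · rw [← MulOpposite.op_mul, ← MulOpposite.op_mul, ← MulOpposite.op_sub]
    congr 1
    rw [neg_mul_neg, neg_mul_neg, ← mul_assoc H, hK', mul_assoc _ H, e1]
    simp only [mul_assoc, mul_add]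
    abel
  · rw [← MulOpposite.op_mul, ← MulOpposite.op_mul, ← MulOpposite.op_sub, ← MulOpposite.op_neg]
    congr 1
    rw [neg_mul_neg, neg_mul_neg, ← mul_assoc H, e2, add_mul, mul_assoc Em H, hK]
    simp only [mul_assoc, neg_mul]
    abel
  · rw [← MulOpposite.op_mul, ← MulOpposite.op_mul, ← MulOpposite.op_sub, op_qbracket,
      qbracket_neg, ← t.Ep_Em]
    congr 1
    have hc : Commute H (Ep * Em) := by
      change H * (Ep * Em) = Ep * Em * H
      rw [← mul_assoc, e1, add_mul, mul_assoc Ep H, e2]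
      simp [mul_add, mul_assoc]
    have hc' : nexp R n (-(h • H)) * (Ep * Em) = Ep * Em * nexp R n (-(h • H)) :=
      (nexp_commute (hc.smul_left h).neg_left n).eq
    have hs : Small I (h • H) := small_smul hh H
    rw [neg_mul_neg, neg_mul_neg]
    calc Em * nexp R n (h • H) * (nexp R n (-(h • H)) * Ep) -
          nexp R n (-(h • H)) * Ep * (Em * nexp R n (h • H))
        = Em * (nexp R n (h • H) * nexp R n (-(h • H))) * Ep -
          nexp R n (-(h • H)) * (Ep * Em) * nexp R n (h • H) := by simp only [mul_assoc]
      _ = _ := by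
        rw [hA.nexp_mul_neg hs, hc', mul_assoc (Ep * Em), hA.nexp_neg_mul hs]
        simp

end Triple

/-! ### Universal property of the reductions of `U_q(sl(2))`. -/

section UqHopf

open PowerSeries

variable {R : Type u} [CommRing R] [Algebra ℂ R] {I : Ideal R} {n : ℕ} {h : R}
  {B : Type u} [Ring B] [Algebra R B]

theorem uqMod_triple (I : Ideal R) (h : R) (n : ℕ) :
    SlTriple n h (gen I h n Gen.H) (gen I h n Gen.Ep) (gen I h n Gen.Em) where
  H_Ep := by
    have := RingQuot.mkAlgHom_rel R (Rel.H_Ep (I := I) (h := h) (n := n))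
    simpa [gen] using this
  H_Em := by
    have := RingQuot.mkAlgHom_rel R (Rel.H_Em (I := I) (h := h) (n := n))
    simpa [gen] using this
  Ep_Em := by
    have := RingQuot.mkAlgHom_rel R (Rel.Ep_Em (I := I) (h := h) (n := n))
    rw [map_qbracket] at this
    simpa [gen] using this

/-- Three elements that satisfy the relations define a map from the reduction. -/
def uqModLift (hB : Killed I n B) {H Ep Em : B} (t : SlTriple n h H Ep Em) :
    UqMod I h n →ₐ[R] B :=
  RingQuot.liftAlgHom R ⟨FreeAlgebra.lift R fun g => match g with
      | Gen.H => H
      | Gen.Ep => Ep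
      | Gen.Em => Em, by
    intro x y hxy
    cases hxy with
    | base c hc =>
      rw [AlgHom.commutes, map_zero, Algebra.algebraMap_eq_smul_one]
      exact hB c hc 1
    | H_Ep => simpa using t.H_Ep
    | H_Em => simpa using t.H_Em
    | Ep_Em =>
      rw [map_qbracket]
      simpa using t.Ep_Em⟩

theorem uqModLift_gen (hB : Killed I n B) {H Ep Em : B} (t : SlTriple n h H Ep Em) :
    uqModLift hB t (gen I h n Gen.H) = H ∧ uqModLift hB t (gen I h n Gen.Ep) = Ep ∧
      uqModLift hB t (gen I h n Gen.Em) = Em := by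
  simp [uqModLift, gen]

theorem uqMod_hom_ext {f g : UqMod I h n →ₐ[R] B} (hH : f (gen I h n Gen.H) = g (gen I h n Gen.H))
    (hEp : f (gen I h n Gen.Ep) = g (gen I h n Gen.Ep))
    (hEm : f (gen I h n Gen.Em) = g (gen I h n Gen.Em)) : f = g := by
  apply RingQuot.ringQuot_ext'
  apply FreeAlgebra.hom_ext
  funext x
  cases x
  · exact hH
  · exact hEp
  · exact hEm

theorem uqMod_induction {P : UqMod I h n → Prop} (hr : ∀ r : R, P (algebraMap R _ r))
    (hH : P (gen I h n Gen.H)) (hEp : P (gen I h n Gen.Ep)) (hEm : P (gen I h n Gen.Em))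
    (hadd : ∀ x y, P x → P y → P (x + y)) (hmul : ∀ x y, P x → P y → P (x * y))
    (x : UqMod I h n) : P x := by
  obtain ⟨y, rfl⟩ := RingQuot.mkAlgHom_surjective R (Rel I h n) x
  induction y using FreeAlgebra.induction with
  | grade0 r => rw [AlgHom.commutes]; exact hr r
  | grade1 g =>
    cases g
    · exact hH
    · exact hEp
    · exact hEm
  | mul a b ha hb => rw [map_mul]; exact hmul _ _ ha hb
  | add a b ha hb => rw [map_add]; exact hadd _ _ ha hb

theorem uq_killed (I : Ideal R) (h : R) (hh : h ∈ I) (n : ℕ) : Killed I n ((Uq I h hh).obj n) :=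
  uqMod_ann I h n

theorem uq_triple (I : Ideal R) (h : R) (hh : h ∈ I) (n : ℕ) :
    SlTriple n h (UqH I h hh n) (UqEp I h hh n) (UqEm I h hh n) :=
  uqMod_triple I h n

/-- Three elements that satisfy the relations define a map from `U_q(sl(2))`. -/
def uqLift (hh : h ∈ I) (hB : Killed I n B) {H Ep Em : B} (t : SlTriple n h H Ep Em) :
    (Uq I h hh).obj n →ₐ[R] B :=
  uqModLift (I := I) hB t

theorem uqLift_gen (hh : h ∈ I) (hB : Killed I n B) {H Ep Em : B} (t : SlTriple n h H Ep Em) :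
    uqLift hh hB t (UqH I h hh n) = H ∧ uqLift hh hB t (UqEp I h hh n) = Ep ∧
      uqLift hh hB t (UqEm I h hh n) = Em :=
  uqModLift_gen hB t

theorem uq_hom_ext {hh : h ∈ I} {f g : (Uq I h hh).obj n →ₐ[R] B}
    (hH : f (UqH I h hh n) = g (UqH I h hh n)) (hEp : f (UqEp I h hh n) = g (UqEp I h hh n))
    (hEm : f (UqEm I h hh n) = g (UqEm I h hh n)) : f = g :=
  uqMod_hom_ext hH hEp hEm

theorem uq_induction {hh : h ∈ I} {P : (Uq I h hh).obj n → Prop}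
    (hr : ∀ r : R, P (algebraMap R _ r))
    (hH : P (UqH I h hh n)) (hEp : P (UqEp I h hh n)) (hEm : P (UqEm I h hh n))
    (hadd : ∀ x y, P x → P y → P (x + y)) (hmul : ∀ x y, P x → P y → P (x * y))
    (x : (Uq I h hh).obj n) : P x :=
  uqMod_induction hr hH hEp hEm hadd hmul x

theorem uq_tr_gen (hh : h ∈ I) (n : ℕ) :
    (Uq I h hh).tr n (UqH I h hh (n + 1)) = UqH I h hh n ∧
      (Uq I h hh).tr n (UqEp I h hh (n + 1)) = UqEp I h hh n ∧
      (Uq I h hh).tr n (UqEm I h hh (n + 1)) = UqEm I h hh n := by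
  have : ∀ g, uqTr I h hh n (gen I h (n + 1) g) = gen I h n g := fun g => by simp [uqTr, gen]
  exact ⟨this _, this _, this _⟩

end UqHopf

/-! ### The Hopf algebra `U_q(sl(2))`. -/

section UqHopf

open PowerSeries

variable {R : Type u} [CommRing R] {I : Ideal R} {n : ℕ} {h : R}

theorem quotient_killed (I : Ideal R) (n : ℕ) : Killed I n (R ⧸ I ^ n) := by
  intro c hc x
  obtain ⟨r, rfl⟩ := Ideal.Quotient.mk_surjective x
  rw [Algebra.smul_def]
  change Ideal.Quotient.mk _ c * _ = 0
  rw [Ideal.Quotient.eq_zero_iff_mem.mpr hc, zero_mul]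

theorem op_killed {A : Type u} [Ring A] [Algebra R A] (hA : Killed I n A) :
    Killed I n Aᵐᵒᵖ := by
  intro c hc x
  rw [← MulOpposite.unop_eq_zero_iff, MulOpposite.unop_smul, hA c hc]

variable [Algebra ℂ R]

/-- The coproduct of `U_q(sl(2))`. -/
def uqComul (hh : h ∈ I) (n : ℕ) : (Uq I h hh).obj n →ₐ[R] (Uq I h hh).obj n ⊗[R] (Uq I h hh).obj n :=
  uqLift hh (uq_killed I h hh n).tensor ((uq_triple I h hh n).comul (uq_killed I h hh n) hh)

/-- The counit of `U_q(sl(2))`. -/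
def uqCounit (I : Ideal R) (h : R) (hh : h ∈ I) (n : ℕ) : (Uq I h hh).obj n →ₐ[R] R ⧸ I ^ n :=
  uqLift (H := 0) (Ep := 0) (Em := 0) hh (quotient_killed I n)
    ⟨by simp, by simp, by simp [qbracket_zero]⟩

/-- The antipode of `U_q(sl(2))`, as a map to the opposite algebra. -/
def uqAntipodeOp (hh : h ∈ I) (n : ℕ) : (Uq I h hh).obj n →ₐ[R] ((Uq I h hh).obj n)ᵐᵒᵖ :=
  uqLift hh (op_killed (uq_killed I h hh n))
    ((uq_triple I h hh n).antipode (uq_killed I h hh n) hh)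

/-- The antipode of `U_q(sl(2))`. -/
def uqAntipode (hh : h ∈ I) (n : ℕ) : (Uq I h hh).obj n →ₗ[R] (Uq I h hh).obj n :=
  (MulOpposite.opLinearEquiv R).symm.toLinearMap ∘ₗ (uqAntipodeOp hh n).toLinearMap

theorem uqAntipode_apply (hh : h ∈ I) (x : (Uq I h hh).obj n) :
    uqAntipode hh n x = MulOpposite.unop (uqAntipodeOp hh n x) := rfl

theorem uqAntipode_mul (hh : h ∈ I) (x y : (Uq I h hh).obj n) :
    uqAntipode hh n (x * y) = uqAntipode hh n y * uqAntipode hh n x := by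
  simp [uqAntipode_apply]

theorem uqComul_H (hh : h ∈ I) : uqComul hh n (UqH I h hh n) =
    UqH I h hh n ⊗ₜ[R] 1 + 1 ⊗ₜ[R] UqH I h hh n :=
  (uqLift_gen hh _ _).1

theorem uqComul_Ep (hh : h ∈ I) : uqComul hh n (UqEp I h hh n) =
    UqEp I h hh n ⊗ₜ[R] 1 + nexp R n (h • UqH I h hh n) ⊗ₜ[R] UqEp I h hh n :=
  (uqLift_gen hh _ _).2.1

theorem uqComul_Em (hh : h ∈ I) : uqComul hh n (UqEm I h hh n) =
    UqEm I h hh n ⊗ₜ[R] nexp R n (-(h • UqH I h hh n)) + 1 ⊗ₜ[R] UqEm I h hh n :=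
  (uqLift_gen hh _ _).2.2

theorem uqCounit_gen (hh : h ∈ I) (n : ℕ) : uqCounit I h hh n (UqH I h hh n) = 0 ∧
    uqCounit I h hh n (UqEp I h hh n) = 0 ∧ uqCounit I h hh n (UqEm I h hh n) = 0 :=
  uqLift_gen hh _ _

theorem uqAntipode_H (hh : h ∈ I) : uqAntipode hh n (UqH I h hh n) = -UqH I h hh n :=
  congrArg MulOpposite.unop (uqLift_gen hh (op_killed (uq_killed I h hh n)) _).1

theorem uqAntipode_Ep (hh : h ∈ I) : uqAntipode hh n (UqEp I h hh n) =
    -(nexp R n (-(h • UqH I h hh n)) * UqEp I h hh n) :=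
  congrArg MulOpposite.unop (uqLift_gen hh (op_killed (uq_killed I h hh n)) _).2.1

theorem uqAntipode_Em (hh : h ∈ I) : uqAntipode hh n (UqEm I h hh n) =
    -(UqEm I h hh n * nexp R n (h • UqH I h hh n)) :=
  congrArg MulOpposite.unop (uqLift_gen hh (op_killed (uq_killed I h hh n)) _).2.2

/-- `e ^ {c h x}` is group-like for a primitive element `x`. -/
theorem Killed.nexp_primitive {A : Type u} [Ring A] [Algebra R A] (hA : Killed I n A) {x : A}
    (hx : Small I x) :
    nexp R n (x ⊗ₜ[R] (1 : A) + (1 : A) ⊗ₜ[R] x) = nexp R n x ⊗ₜ[R] nexp R n x := by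
  have hc : Commute (x ⊗ₜ[R] (1 : A)) ((1 : A) ⊗ₜ[R] x) := by
    simp [Commute, SemiconjBy]
  have e1 : nexp R n (x ⊗ₜ[R] (1 : A)) = nexp R n x ⊗ₜ[R] 1 :=
    (map_nexp (Algebra.TensorProduct.includeLeft : A →ₐ[R] A ⊗[R] A) n x).symm
  have e2 : nexp R n ((1 : A) ⊗ₜ[R] x) = 1 ⊗ₜ[R] nexp R n x :=
    (map_nexp (Algebra.TensorProduct.includeRight : A →ₐ[R] A ⊗[R] A) n x).symm
  rw [hA.tensor.nexp_add hc (hx.tmul_left _) (hx.tmul_right _), e1, e2]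
  simp

theorem uqComul_nexp (hh : h ∈ I) (c : R) (hc : c ∈ I) :
    uqComul hh n (nexp R n (c • UqH I h hh n)) =
      nexp R n (c • UqH I h hh n) ⊗ₜ[R] nexp R n (c • UqH I h hh n) := by
  rw [map_nexp, map_smul, uqComul_H, smul_add, TensorProduct.smul_tmul',
    ← TensorProduct.tmul_smul, (uq_killed I h hh n).nexp_primitive (small_smul hc _)]

theorem uqCounit_nexp (hh : h ∈ I) : uqCounit I h hh n (nexp R n (h • UqH I h hh n)) = 1 ∧
    uqCounit I h hh n (nexp R n (-(h • UqH I h hh n))) = 1 := by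
  simp only [map_nexp, map_neg, map_smul, uqCounit_gen hh n, smul_zero, neg_zero,
    (quotient_killed I n).nexp_zero, and_self]

theorem uqTr_nexp (hh : h ∈ I) (c : R) (hc : c ∈ I) :
    (Uq I h hh).tr n (nexp R (n + 1) (c • UqH I h hh (n + 1))) =
      nexp R n (c • UqH I h hh n) := by
  rw [map_nexp, map_smul, (uq_tr_gen hh n).1, nexp_succ ((uq_killed I h hh n).pow (small_smul hc _))]

theorem uqAntipode_nexp (hh : h ∈ I) (c : R) :
    uqAntipode hh n (nexp R n (c • UqH I h hh n)) = nexp R n (-(c • UqH I h hh n)) := by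
  have h1 : uqAntipodeOp hh n (UqH I h hh n) = MulOpposite.op (-UqH I h hh n) :=
    (uqLift_gen hh (op_killed (uq_killed I h hh n)) _).1
  rw [uqAntipode_apply, map_nexp, map_smul, h1, ← MulOpposite.op_smul, nexp, op_ev,
    MulOpposite.unop_op, smul_neg, nexp]

theorem uqComul_coassoc (hh : h ∈ I) (x : (Uq I h hh).obj n) :
    comulLeft (uqComul hh n) (uqComul hh n x) = comulRight (uqComul hh n) (uqComul hh n x) := by
  refine DFunLike.congr_fun (uq_hom_ext (f := (comulLeft (uqComul hh n)).comp (uqComul hh n))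
    (g := (comulRight (uqComul hh n)).comp (uqComul hh n)) ?_ ?_ ?_) x
  · simp only [AlgHom.comp_apply, uqComul_H, map_add, comulLeft_tmul, comulRight_tmul, map_one,
      TensorProduct.add_tmul, TensorProduct.tmul_add, Algebra.TensorProduct.one_def,
      assocInv_tmul]
    abel
  · simp only [AlgHom.comp_apply, uqComul_Ep, map_add, comulLeft_tmul, comulRight_tmul, map_one,
      TensorProduct.add_tmul, TensorProduct.tmul_add, Algebra.TensorProduct.one_def,
      assocInv_tmul, uqComul_nexp hh h hh]
    abel
  · have e := uqComul_nexp (n := n) hh (-h) (neg_mem hh)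
    simp only [neg_smul] at e
    simp only [AlgHom.comp_apply, uqComul_Em, map_add, comulLeft_tmul, comulRight_tmul, map_one,
      TensorProduct.add_tmul, TensorProduct.tmul_add, Algebra.TensorProduct.one_def,
      assocInv_tmul, e]
    abel

theorem uqComul_counit_left (hh : h ∈ I) (x : (Uq I h hh).obj n) :
    Algebra.TensorProduct.map (uqCounit I h hh n) (AlgHom.id R _) (uqComul hh n x) = 1 ⊗ₜ[R] x := by
  refine DFunLike.congr_fun (uq_hom_ext
    (f := (Algebra.TensorProduct.map (uqCounit I h hh n) (AlgHom.id R _)).comp (uqComul hh n))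
    (g := Algebra.TensorProduct.includeRight) ?_ ?_ ?_) x
  · simp [uqComul_H, uqCounit_gen hh n]
  · simp [uqComul_Ep, uqCounit_gen hh n, uqCounit_nexp hh]
  · simp [uqComul_Em, uqCounit_gen hh n]

theorem uqComul_counit_right (hh : h ∈ I) (x : (Uq I h hh).obj n) :
    Algebra.TensorProduct.map (AlgHom.id R _) (uqCounit I h hh n) (uqComul hh n x) = x ⊗ₜ[R] 1 := by
  refine DFunLike.congr_fun (uq_hom_ext
    (f := (Algebra.TensorProduct.map (AlgHom.id R _) (uqCounit I h hh n)).comp (uqComul hh n))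
    (g := Algebra.TensorProduct.includeLeft) ?_ ?_ ?_) x
  · simp [uqComul_H, uqCounit_gen hh n]
  · simp [uqComul_Ep, uqCounit_gen hh n]
  · simp [uqComul_Em, uqCounit_gen hh n, uqCounit_nexp hh]

/-- The unit, on `R ⧸ I ^ n`. -/
def uqUnit (I : Ideal R) (h : R) (hh : h ∈ I) (n : ℕ) : R ⧸ I ^ n →ₐ[R] (Uq I h hh).obj n :=
  Ideal.Quotient.liftₐ (I ^ n) (Algebra.ofId R ((Uq I h hh).obj n)) fun c hc => by
    have := uq_killed I h hh n c hc 1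
    rwa [Algebra.smul_def, mul_one] at this

theorem exists_uqUnit (hh : h ∈ I) (x : R ⧸ I ^ n) : ∃ r : R, uqUnit I h hh n x = algebraMap R _ r := by
  obtain ⟨r, rfl⟩ := Ideal.Quotient.mk_surjective x
  exact ⟨r, rfl⟩

theorem uqAntipode_one (hh : h ∈ I) : uqAntipode hh n 1 = 1 := by
  rw [uqAntipode_apply, map_one, MulOpposite.unop_one]

/-- The map `m (S ⊗ id) Δ` is not an algebra map, so agreement on generators does not suffice
directly. But the elements satisfying the axiom are closed under products, since the inner value is
a scalar and slides out. -/
theorem uqAntipode_left (hh : h ∈ I) (x : (Uq I h hh).obj n) :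
    mulSLeft (uqAntipode hh n) (uqComul hh n x) = uqUnit I h hh n (uqCounit I h hh n x) := by
  have hs := (uq_killed I h hh n).nexp_neg_mul (small_smul hh (UqH I h hh n))
  induction x using uq_induction with
  | hr r =>
    rw [AlgHom.commutes, AlgHom.commutes, AlgHom.commutes, Algebra.algebraMap_eq_smul_one,
      map_smul, Algebra.TensorProduct.one_def, mulSLeft_tmul, uqAntipode_one, mul_one,
      ← Algebra.algebraMap_eq_smul_one]
  | hH => simp [uqComul_H, uqCounit_gen hh n, uqAntipode_H, uqAntipode_one]
  | hEp => simp [uqComul_Ep, uqCounit_gen hh n, uqAntipode_Ep, uqAntipode_nexp]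
  | hEm =>
    have hs' := (uq_killed I h hh n).nexp_mul_neg (small_smul hh (UqH I h hh n))
    simp [uqComul_Em, uqCounit_gen hh n, uqAntipode_Em, uqAntipode_one, mul_assoc, hs']
  | hadd x y hx hy => simp only [map_add, hx, hy]
  | hmul x y hx hy =>
    obtain ⟨r, hr⟩ := exists_uqUnit hh (uqCounit I h hh n x)
    rw [map_mul, mulSLeft_mul_of_central (uqAntipode_mul hh) (hx.trans hr), hy, map_mul, map_mul,
      hr]

theorem uqAntipode_right (hh : h ∈ I) (x : (Uq I h hh).obj n) :
    mulSRight (uqAntipode hh n) (uqComul hh n x) = uqUnit I h hh n (uqCounit I h hh n x) := by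
  have hs := (uq_killed I h hh n).nexp_neg_mul (small_smul hh (UqH I h hh n))
  have hs' := (uq_killed I h hh n).nexp_mul_neg (small_smul hh (UqH I h hh n))
  induction x using uq_induction with
  | hr r =>
    rw [AlgHom.commutes, AlgHom.commutes, AlgHom.commutes, Algebra.algebraMap_eq_smul_one,
      map_smul, Algebra.TensorProduct.one_def, mulSRight_tmul, uqAntipode_one, mul_one,
      ← Algebra.algebraMap_eq_smul_one]
  | hH => simp [uqComul_H, uqCounit_gen hh n, uqAntipode_H, uqAntipode_one]
  | hEp => simp [uqComul_Ep, uqCounit_gen hh n, uqAntipode_Ep, uqAntipode_one, ← mul_assoc, hs']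
  | hEm =>
    have e := uqAntipode_nexp (n := n) hh (-h)
    simp only [neg_smul, neg_neg] at e
    simp [uqComul_Em, uqCounit_gen hh n, uqAntipode_Em, e]
  | hadd x y hx hy => simp only [map_add, hx, hy]
  | hmul x y hx hy =>
    obtain ⟨r, hr⟩ := exists_uqUnit hh (uqCounit I h hh n y)
    rw [map_mul, mulSRight_mul_of_central (uqAntipode_mul hh) (hy.trans hr), hx, map_mul, map_mul,
      hr, Algebra.commutes]

theorem uqComul_tr (hh : h ∈ I) (x : (Uq I h hh).obj (n + 1)) :
    Algebra.TensorProduct.map ((Uq I h hh).tr n) ((Uq I h hh).tr n) (uqComul hh (n + 1) x) =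
      uqComul hh n ((Uq I h hh).tr n x) := by
  refine DFunLike.congr_fun (uq_hom_ext
    (f := (Algebra.TensorProduct.map ((Uq I h hh).tr n) ((Uq I h hh).tr n)).comp (uqComul hh (n + 1)))
    (g := (uqComul hh n).comp ((Uq I h hh).tr n)) ?_ ?_ ?_) x
  · simp [uqComul_H, uq_tr_gen hh n]
  · simp [uqComul_Ep, uq_tr_gen hh n, uqTr_nexp hh h hh]
  · have e := uqTr_nexp (n := n) hh (-h) (neg_mem hh)
    simp only [neg_smul] at e
    simp [uqComul_Em, uq_tr_gen hh n, e]

theorem uqCounit_tr (hh : h ∈ I) (x : (Uq I h hh).obj (n + 1)) :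
    uqCounit I h hh n ((Uq I h hh).tr n x) =
      Ideal.Quotient.factorₐ R (Ideal.pow_le_pow_right (Nat.le_succ n)) (uqCounit I h hh (n + 1) x) := by
  refine DFunLike.congr_fun (uq_hom_ext
    (f := (uqCounit I h hh n).comp ((Uq I h hh).tr n))
    (g := (Ideal.Quotient.factorₐ R (Ideal.pow_le_pow_right (Nat.le_succ n))).comp
      (uqCounit I h hh (n + 1))) ?_ ?_ ?_) x <;>
  simp [uq_tr_gen hh n, uqCounit_gen hh n, uqCounit_gen hh (n + 1)]

theorem uqAntipode_tr (hh : h ∈ I) (x : (Uq I h hh).obj (n + 1)) :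
    (Uq I h hh).tr n (uqAntipode hh (n + 1) x) = uqAntipode hh n ((Uq I h hh).tr n x) := by
  induction x using uq_induction with
  | hr r =>
    simp only [Algebra.algebraMap_eq_smul_one, map_smul, uqAntipode_one, map_one]
  | hH => simp [uqAntipode_H, uq_tr_gen hh n]
  | hEp =>
    have e := uqTr_nexp (n := n) hh (-h) (neg_mem hh)
    simp only [neg_smul] at e
    simp [uqAntipode_Ep, uq_tr_gen hh n, e]
  | hEm => simp [uqAntipode_Em, uq_tr_gen hh n, uqTr_nexp hh h hh]
  | hadd x y hx hy => simp only [map_add, hx, hy]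
  | hmul x y hx hy => simp only [map_mul, uqAntipode_mul, hx, hy]

/-- The Hopf algebra `U_q(sl(2))`. -/
def uqHopf (I : Ideal R) (h : R) (hh : h ∈ I) : Hopf (Uq I h hh) where
  Δ := uqComul hh
  ε := uqCounit I h hh
  S := uqAntipode hh
  Δ_tr _ x := uqComul_tr hh x
  ε_tr n x r hr := by
    have h1 : uqCounit I h hh (n + 1) x = Ideal.Quotient.mk _ r := hr
    have := uqCounit_tr hh x
    rw [h1] at this
    exact this
  S_tr _ x := uqAntipode_tr hh x
  coassoc _ x := uqComul_coassoc hh x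
  counit_left _ x := uqComul_counit_left hh x
  counit_right _ x := uqComul_counit_right hh x
  antipode_left n x r hr := by
    have h1 : uqCounit I h hh n x = Ideal.Quotient.mk _ r := hr
    have := uqAntipode_left hh x
    rw [h1] at this
    exact this
  antipode_right n x r hr := by
    have h1 : uqCounit I h hh n x = Ideal.Quotient.mk _ r := hr
    have := uqAntipode_right hh x
    rw [h1] at this
    exact this

theorem uqHopf_isStandard (I : Ideal R) (h : R) (hh : h ∈ I) : IsStandard (uqHopf I h hh) where
  comul_H _ := uqComul_H hh
  comul_Ep _ := uqComul_Ep hh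
  comul_Em _ := uqComul_Em hh

/-- Supplies the hypothesis `hS` of `Hopf.twist`; the structure `Hopf` records the antipode only as
a linear map. -/
theorem uqHopf_S_mul (hh : h ∈ I) (n : ℕ) (x y : (Uq I h hh).obj n) :
    (uqHopf I h hh).S n (x * y) = (uqHopf I h hh).S n y * (uqHopf I h hh).S n x :=
  uqAntipode_mul hh x y

end UqHopf

/-! ### The `q`-exponential and commutators with powers of `E₋` and `E₊`. -/

section QExp

open PowerSeries

/-- `1 + p + ⋯ + p ^ (m - 1)`, with `p = e ^ {-h}`. -/
def qint (m : ℕ) : ℂ⟦X⟧ := ∑ j ∈ Finset.range m, expS (-1) ^ j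

theorem expS_neg_natCast (m : ℕ) : expS (-(m : ℂ)) = expS (-1) ^ m := by
  induction m with
  | zero => simp [expS_zero]
  | succ m ih => rw [pow_succ, ← ih, ← expS_add]; push_cast; ring_nf

theorem constantCoeff_expS (c : ℂ) : constantCoeff (expS c) = 1 := by
  rw [← coeff_zero_eq_constantCoeff_apply, expS, coeff_rescale]
  simp

theorem qint_mul (m : ℕ) : qint m * (1 - expS (-1)) = 1 - expS (-1) ^ m := by
  rw [qint, geom_sum_mul_neg]

theorem constantCoeff_qint (m : ℕ) : constantCoeff (qint m) = m := by
  simp [qint, constantCoeff_expS]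

theorem isUnit_qint (m : ℕ) : IsUnit (qint (m + 1)) := by
  rw [isUnit_iff_constantCoeff, constantCoeff_qint]
  exact (Nat.cast_ne_zero.2 (Nat.succ_ne_zero m)).isUnit

theorem coeff_one_expS (c : ℂ) : coeff 1 (expS c) = c := by
  simp [expS, coeff_rescale]

theorem expS_sub_ne_zero {a b : ℂ} (hab : a ≠ b) : expS a - expS b ≠ 0 := by
  intro h
  have := congrArg (coeff 1) h
  rw [map_sub, coeff_one_expS, coeff_one_expS, map_zero, sub_eq_zero] at this
  exact hab this

/-- Compares the symmetric `q`-number with the geometric sum in `p = e^{-h}`: they differ by a power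
of `e^{h/2}`. In the domain `ℂ⟦X⟧` the common denominator may be cancelled. -/
theorem qint_eq (m : ℕ) : qint (m + 1) = expS (-(m / 2 : ℂ)) * qnum (m + 1) := by
  have hne : expS (1 / 2) - expS (-(1 / 2)) ≠ 0 := expS_sub_ne_zero (by norm_num)
  have h1 : qnum (m + 1) * (expS (1 / 2) - expS (-(1 / 2))) =
      expS (((m + 1 : ℕ) : ℂ) / 2) - expS (-(((m + 1 : ℕ) : ℂ) / 2)) := by
    rw [qnum, quo_mul]
    · simp [constantCoeff_expS]
    · simp [constantCoeff_expS]
    · rw [map_sub, coeff_one_expS, coeff_one_expS]; norm_num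
  apply mul_right_cancel₀ hne
  have h2 : expS (1 / 2) * (1 - expS (-1)) = expS (1 / 2) - expS (-(1 / 2)) := by
    rw [mul_sub, mul_one, ← expS_add]; norm_num
  rw [mul_assoc, h1, ← h2, mul_left_comm, qint_mul, ← expS_neg_natCast, mul_sub, mul_sub, mul_one,
    ← expS_add, ← expS_add, ← expS_add]
  congr 2 <;> push_cast <;> ring

theorem constantCoeff_qnum (m : ℕ) : constantCoeff (qnum (m + 1)) ≠ 0 := by
  have h := congrArg constantCoeff (qint_eq m)
  rw [map_mul, constantCoeff_expS, one_mul, constantCoeff_qint] at h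
  rw [← h]
  exact Nat.cast_ne_zero.2 (Nat.succ_ne_zero m)

theorem rcoeff_zero : rcoeff 0 = 1 := by
  simp [rcoeff, qfact, expS_zero]

/-- The factor `e^{h m (m - 1) / 4}` absorbs exactly the powers of `e^{h/2}` from `qint_eq`, because
`(m + 1) m / 4 - m / 2 = m (m - 1) / 4`. The coefficients are thus `(1 - p) ^ m` over the factorial
of the geometric sums, and the later arguments use only this recursion, `rcoeff 0 = 1` and
divisibility by `X ^ m`. -/
theorem rcoeff_succ (m : ℕ) :
    rcoeff (m + 1) * qint (m + 1) = (1 - expS (-1)) * rcoeff m := by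
  have h1 : qfact (m + 1) = qfact m * qnum (m + 1) := Finset.prod_range_succ _ _
  have h2 := PowerSeries.inv_mul_cancel _ (constantCoeff_qnum m)
  rw [rcoeff, rcoeff, qint_eq, h1, PowerSeries.mul_inv_rev]
  calc (1 - expS (-1)) ^ (m + 1) * ((qnum (m + 1))⁻¹ * (qfact m)⁻¹) *
        expS (((m + 1 : ℕ) : ℂ) * (((m + 1 : ℕ) : ℂ) - 1) / 4) *
        (expS (-(m / 2 : ℂ)) * qnum (m + 1))
      = (1 - expS (-1)) * ((1 - expS (-1)) ^ m * (qfact m)⁻¹ *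
        (expS (((m + 1 : ℕ) : ℂ) * (((m + 1 : ℕ) : ℂ) - 1) / 4) * expS (-(m / 2 : ℂ)))) *
        ((qnum (m + 1))⁻¹ * qnum (m + 1)) := by ring
    _ = _ := by
      rw [h2, mul_one, ← expS_add]
      congr 4
      push_cast
      ring

theorem X_pow_dvd_rcoeff (m : ℕ) : (X : ℂ⟦X⟧) ^ m ∣ rcoeff m := by
  have h : (X : ℂ⟦X⟧) ∣ 1 - expS (-1) := by
    rw [X_dvd_iff]
    simp [constantCoeff_expS]
  exact ((pow_dvd_pow_of_dvd h m).mul_right _).mul_right _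

theorem qint_succ (m : ℕ) : qint (m + 1) = qint m * expS (-1) + 1 := by
  rw [qint, Finset.sum_range_succ', pow_zero, qint, Finset.sum_mul]
  simp [pow_succ]

theorem qint_succ' (m : ℕ) : qint (m + 1) = qint m + expS (-1) ^ m := Finset.sum_range_succ _ _

theorem qint_add (i j : ℕ) : qint (i + j) = qint j + expS (-1) ^ j * qint i := by
  rw [add_comm, qint, Finset.sum_range_add, qint, qint, Finset.mul_sum]
  simp [pow_add]

section Abstract

variable {B : Type u} [Ring B] [Algebra ℂ⟦X⟧ B]

/-- The binomial formula behind the `q`-exponential. -/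
theorem rcoeff_smul_add_pow {x y : B} (hxy : x * y = expS (-1) • (y * x)) (m : ℕ) :
    rcoeff m • (x + y) ^ m = ∑ ij ∈ Finset.HasAntidiagonal.antidiagonal m,
      (rcoeff ij.1 * rcoeff ij.2) • (y ^ ij.1 * x ^ ij.2) := by
  have hpow : ∀ j : ℕ, x ^ j * y = expS (-1) ^ j • (y * x ^ j) := by
    intro j
    induction j with
    | zero => simp
    | succ j ih =>
      rw [pow_succ', mul_assoc, ih, mul_smul_comm, ← mul_assoc, hxy, smul_mul_assoc, smul_smul,
        mul_assoc, pow_succ]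
  induction m with
  | zero => simp [rcoeff_zero]
  | succ m ih =>
    have hu := isUnit_qint m
    apply hu.smul_left_cancel.1
    -- After multiplication by the unit `qint (m + 1)`, the splitting `qint (i + j) = qint j + p ^ j
    -- qint i` gives two sums. In the first a factor `x` is peeled off, in the second a factor `y`;
    -- the boundary terms vanish as `qint 0 = 0`.
    have e1 : qint (m + 1) • ∑ ij ∈ Finset.HasAntidiagonal.antidiagonal (m + 1),
        (rcoeff ij.1 * rcoeff ij.2) • (y ^ ij.1 * x ^ ij.2) =
        ∑ ij ∈ Finset.HasAntidiagonal.antidiagonal (m + 1),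
          (rcoeff ij.1 * (rcoeff ij.2 * qint ij.2)) • (y ^ ij.1 * x ^ ij.2) +
        ∑ ij ∈ Finset.HasAntidiagonal.antidiagonal (m + 1),
          (rcoeff ij.1 * qint ij.1 * (rcoeff ij.2 * expS (-1) ^ ij.2)) •
            (y ^ ij.1 * x ^ ij.2) := by
      rw [Finset.smul_sum, ← Finset.sum_add_distrib]
      refine Finset.sum_congr rfl fun ij hij => ?_
      rw [smul_smul, ← add_smul, ← Finset.HasAntidiagonal.mem_antidiagonal.1 hij, qint_add]
      congr 1
      ring
    have hq0 : qint 0 = 0 := by simp [qint]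
    rw [e1, Finset.Nat.sum_antidiagonal_succ', Finset.Nat.sum_antidiagonal_succ, smul_smul,
      mul_comm (qint (m + 1)), rcoeff_succ, mul_smul, pow_succ, ← smul_mul_assoc, ih,
      Finset.sum_mul, Finset.smul_sum]
    simp only [hq0, mul_zero, zero_mul, zero_smul, zero_add]
    rw [← Finset.sum_add_distrib]
    refine Finset.sum_congr rfl fun ij _ => ?_
    rw [rcoeff_succ, rcoeff_succ, mul_add, smul_mul_assoc, smul_mul_assoc, mul_assoc _ _ y, hpow,
      mul_assoc _ _ x, ← pow_succ, mul_smul_comm, ← mul_assoc, ← pow_succ, smul_add, smul_smul,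
      smul_smul, smul_smul]
    congr 2 <;> ring

end Abstract

variable {R : Type u} [CommRing R] [Algebra ℂ R] {A B : Type u} [Ring A] [Algebra R A]
  [Ring B] [Algebra R B] {I : Ideal R} {n : ℕ} {h : R}

/-- Power series in `h` act on an algebra in which `h ^ n = 0`. -/
abbrev Killed.evAlgebra (hA : Killed I n A) (hh : h ∈ I) : Algebra ℂ⟦X⟧ A :=
  RingHom.toAlgebra'
    { toFun := fun p => ev R n p (algebraMap R A h)
      map_zero' := by simp [ev]
      map_one' := ev_one (hA.pow (small_algebraMap hh))
      map_add' := fun p q => ev_add n p q _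
      map_mul' := fun p q => ev_mul p q (hA.pow (small_algebraMap hh)) }
    fun p x => ev_algebraMap_commute h x n p

theorem Killed.evAlgebra_smul (hA : Killed I n A) (hh : h ∈ I) (p : ℂ⟦X⟧) (x : A) :
    letI := hA.evAlgebra hh
    p • x = ev R n p h • x := by
  rw [smul_ev]; rfl

/-- The `q`-exponential `∑ₘ (1 - e^{-h})^m / [m]! · e^{h m (m - 1) / 4} x^m`. -/
def qexp (n : ℕ) (h : R) (x : A) : A := ∑ m ∈ Finset.range n, ev R n (rcoeff m) h • x ^ m

theorem map_qexp (f : A →ₐ[R] B) (n : ℕ) (h : R) (x : A) : f (qexp n h x) = qexp n h (f x) := by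
  simp [qexp]

theorem qexp_intertwine {a x z : A} (e : a * x = z * a) (n : ℕ) (h : R) :
    a * qexp n h x = qexp n h z * a := by
  have h1 : ∀ i : ℕ, a * x ^ i = z ^ i * a := by
    intro i
    induction i with
    | zero => simp
    | succ i ih => rw [pow_succ, ← mul_assoc, ih, mul_assoc, e, pow_succ, mul_assoc]
  simp [qexp, Finset.sum_mul, Finset.mul_sum, h1]

theorem Killed.ev_smul_eq_zero (hA : Killed I n A) (hh : h ∈ I) {p : ℂ⟦X⟧} {k : ℕ}
    (hk : n ≤ k) (hp : X ^ k ∣ p) (x : A) : ev R n p h • x = 0 := by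
  have h0 := hA.pow (small_algebraMap hh)
  obtain ⟨q, rfl⟩ := hp
  rw [smul_ev, ev_X_pow_mul _ _ h0, pow_eq_zero_of_le hk h0, zero_mul, zero_mul]

/-- Sum the binomial formula over `m` and regroup by the two exponents. -/
theorem Killed.qexp_add (hA : Killed I n A) (hh : h ∈ I) {x y : A}
    (hxy : x * y = ev R n (expS (-1)) h • (y * x)) :
    qexp n h (x + y) = qexp n h y * qexp n h x := by
  let := hA.evAlgebra hh
  have hs := hA.evAlgebra_smul hh
  simp only [qexp, ← hs] at hxy ⊢
  simp only [rcoeff_smul_add_pow hxy, Finset.Nat.sum_antidiagonal_eq_sum_range_succ_mk]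
  rw [Finset.sum_range_diag_flip n fun i j => (rcoeff i * rcoeff j) • (y ^ i * x ^ j),
    Finset.sum_mul]
  refine Finset.sum_congr rfl fun i _ => ?_
  rw [Finset.mul_sum]
  simp only [smul_mul_smul_comm]
  -- The triangle `i + j < n` is enlarged to the square `i, j < n`; the added coefficients are
  -- divisible by `X ^ (i + j)` with `i + j ≥ n`, hence vanish at `h`.
  refine Finset.sum_subset (fun j hj => ?_) (fun j _ hj => ?_)
  · simp only [Finset.mem_range] at hj ⊢
    omega
  · rw [hs]
    refine hA.ev_smul_eq_zero hh (k := i + j) ?_ ?_ _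
    · simp only [Finset.mem_range] at hj
      omega
    · rw [pow_add]
      exact mul_dvd_mul (X_pow_dvd_rcoeff i) (X_pow_dvd_rcoeff j)

theorem Killed.small_qexp_sub_one (hA : Killed I n A) (hh : h ∈ I) (x : A) :
    Small I (qexp n h x - 1) := by
  cases n with
  | zero =>
    have : Subsingleton A := subsingleton_of_zero_eq_one (by simpa using hA.zero_pow.symm)
    rw [Subsingleton.elim (qexp 0 h x - 1) 0]
    exact Small.zero
  | succ n =>
    rw [qexp, Finset.sum_range_succ', rcoeff_zero, hA.ev_one_smul hh, pow_zero, add_sub_cancel_right]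
    refine Submodule.sum_mem _ fun m _ => ?_
    rw [smul_ev]
    refine (small_ev ?_ (small_algebraMap hh)).mul_right _
    exact X_dvd_iff.1 ((dvd_pow_self X (Nat.succ_ne_zero m)).trans (X_pow_dvd_rcoeff (m + 1)))

theorem Killed.isUnit_qexp (hA : Killed I n A) (hh : h ∈ I) (x : A) : IsUnit (qexp n h x) :=
  hA.isUnit_of_small_sub_one (hA.small_qexp_sub_one hh x)

namespace SlTriple

variable {H Ep Em : A} (t : SlTriple n h H Ep Em)
include t

/-- Reversing products and exchanging `E₊` with `E₋` is a symmetry of the relations; it yields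
`Ep_pow_Em` from `Ep_Em_pow`. -/
theorem opposite : SlTriple n h (MulOpposite.op H) (MulOpposite.op Em) (MulOpposite.op Ep) where
  H_Ep := by
    have := t.H_Em
    rw [← MulOpposite.op_mul, ← MulOpposite.op_mul, ← MulOpposite.op_sub, ← neg_sub, this, neg_neg]
  H_Em := by
    have := t.H_Ep
    rw [← MulOpposite.op_mul, ← MulOpposite.op_mul, ← MulOpposite.op_sub, ← neg_sub, this,
      MulOpposite.op_neg]
  Ep_Em := by
    rw [← MulOpposite.op_mul, ← MulOpposite.op_mul, ← MulOpposite.op_sub, t.Ep_Em, op_qbracket]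

/-- Induction gives `(1 - p) [E₊, E₋ ^ (m + 1)] = qint (m + 1) (E₋ ^ m e^{hH} - e^{-hH} E₋ ^ m)`.
The recursion for `rcoeff` trades `1 - p` and `qint (m + 1)` for consecutive coefficients, which is
the form that telescopes. -/
theorem Ep_Em_pow (hA : Killed I n A) (hh : h ∈ I) (m : ℕ) :
    ev R n (rcoeff (m + 1)) h • (Ep * Em ^ (m + 1) - Em ^ (m + 1) * Ep) =
      ev R n (rcoeff m) h • (Em ^ m * nexp R n (h • H) - nexp R n (-(h • H)) * Em ^ m) := by
  let := hA.evAlgebra hh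
  have hs := hA.evAlgebra_smul hh
  have e1 := hA.nexp_mul_of_shift hh t.shift_Em
  have e2 := hA.nexp_neg_mul_of_shift hh t.shift_Em
  have e3 : (1 - expS (-1)) • qbracket R n h H = nexp R n (h • H) - nexp R n (-(h • H)) :=
    hA.one_sub_mul_qbracket hh H
  simp only [neg_neg, ← hs] at e1 e2 ⊢
  set K := nexp R n (h • H)
  set K' := nexp R n (-(h • H))
  have e4 : Em * K' = expS (-1) • (K' * Em) := by
    rw [e2, smul_smul, ← expS_add, neg_add_cancel, expS_zero, one_smul]
  have e5 : ∀ m : ℕ, Em ^ m * K' = expS (-1) ^ m • (K' * Em ^ m) := by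
    intro m
    induction m with
    | zero => simp
    | succ m ih =>
      rw [pow_succ', mul_assoc, ih, mul_smul_comm, ← mul_assoc, e4, smul_mul_assoc, smul_smul,
        mul_assoc, pow_succ]
  have key : ∀ m : ℕ, (1 - expS (-1)) • (Ep * Em ^ (m + 1) - Em ^ (m + 1) * Ep) =
      qint (m + 1) • (Em ^ m * K - K' * Em ^ m) := by
    intro m
    induction m with
    | zero => simp [t.Ep_Em, e3, qint]
    | succ m ih =>
      have hX : Ep * Em ^ (m + 1 + 1) - Em ^ (m + 1 + 1) * Ep =
          (Ep * Em ^ (m + 1) - Em ^ (m + 1) * Ep) * Em + Em ^ (m + 1) * qbracket R n h H := by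
        rw [← t.Ep_Em, pow_succ Em (m + 1)]
        simp only [sub_mul, mul_sub, mul_assoc]
        abel
      have hK : Em ^ m * K * Em = expS (-1) • (Em ^ (m + 1) * K) := by
        rw [mul_assoc, e1, mul_smul_comm, ← mul_assoc, pow_succ]
      rw [hX, smul_add, ← smul_mul_assoc, ih, smul_mul_assoc, sub_mul, hK, mul_assoc, ← pow_succ,
        ← mul_smul_comm (1 - expS (-1)), e3, mul_sub, e5, smul_sub, smul_sub, smul_smul]
      nth_rewrite 1 [qint_succ (m + 1)]
      rw [qint_succ' (m + 1), add_smul, add_smul, one_smul]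
      abel
  apply (isUnit_qint m).smul_left_cancel.1
  rw [smul_smul, mul_comm, rcoeff_succ, mul_comm, mul_smul, key, smul_smul, smul_smul, mul_comm]

theorem Ep_pow_Em (hA : Killed I n A) (hh : h ∈ I) (m : ℕ) :
    ev R n (rcoeff (m + 1)) h • (Ep ^ (m + 1) * Em - Em * Ep ^ (m + 1)) =
      ev R n (rcoeff m) h • (nexp R n (h • H) * Ep ^ m - Ep ^ m * nexp R n (-(h • H))) := by
  have := congrArg MulOpposite.unop (t.opposite.Ep_Em_pow (op_killed hA) hh m)
  rw [← MulOpposite.op_smul, ← MulOpposite.op_neg, nexp, nexp, op_ev, op_ev] at this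
  exact this

end SlTriple

end QExp

/-! ### The universal R-matrix of `U_q(sl(2))`. -/

section RMatrix

open PowerSeries

variable {R : Type u} [CommRing R] [Algebra ℂ R] {A : Type u} [Ring A] [Algebra R A]
  {I : Ideal R} {n : ℕ} {h : R}

theorem nexp_tmul_one (n : ℕ) (x : A) :
    nexp R n (x ⊗ₜ[R] (1 : A)) = nexp R n x ⊗ₜ[R] (1 : A) :=
  (map_nexp (Algebra.TensorProduct.includeLeft : A →ₐ[R] A ⊗[R] A) n x).symm

theorem nexp_one_tmul (n : ℕ) (x : A) :
    nexp R n ((1 : A) ⊗ₜ[R] x) = (1 : A) ⊗ₜ[R] nexp R n x :=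
  (map_nexp (Algebra.TensorProduct.includeRight : A →ₐ[R] A ⊗[R] A) n x).symm

/-- `e^{H ⊗ w} (x ⊗ 1) = (x ⊗ e^{c w}) e^{H ⊗ w}` if `[H, x] = c x`. -/
theorem Killed.nexp_tmul_left (hA : Killed I n A) {H x w : A} {c : ℂ} (hw : Small I w)
    (hx : H * x = x * (H + algebraMap ℂ R c • (1 : A))) :
    nexp R n (H ⊗ₜ[R] w) * (x ⊗ₜ[R] 1) =
      (x ⊗ₜ[R] nexp R n (algebraMap ℂ R c • w)) * nexp R n (H ⊗ₜ[R] w) := by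
  have hw' : Small I (algebraMap ℂ R c • w) := hw.smul _
  have hc : Commute (H ⊗ₜ[R] w) ((1 : A) ⊗ₜ[R] (algebraMap ℂ R c • w)) := by
    simp [Commute, SemiconjBy]
  rw [hA.tensor.nexp_shift (b := (1 : A) ⊗ₜ[R] (algebraMap ℂ R c • w)) ?_ hc (hw.tmul_right _)
    (hw'.tmul_right _), nexp_one_tmul]
  · simp
  · simp [hx, mul_add, TensorProduct.add_tmul, TensorProduct.smul_tmul']

/-- `e^{w ⊗ H} (1 ⊗ x) = (e^{c w} ⊗ x) e^{w ⊗ H}` if `[H, x] = c x`. -/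
theorem Killed.nexp_tmul_right (hA : Killed I n A) {H x w : A} {c : ℂ} (hw : Small I w)
    (hx : H * x = x * (H + algebraMap ℂ R c • (1 : A))) :
    nexp R n (w ⊗ₜ[R] H) * (1 ⊗ₜ[R] x) =
      (nexp R n (algebraMap ℂ R c • w) ⊗ₜ[R] x) * nexp R n (w ⊗ₜ[R] H) := by
  have hw' : Small I (algebraMap ℂ R c • w) := hw.smul _
  have hc : Commute (w ⊗ₜ[R] H) ((algebraMap ℂ R c • w) ⊗ₜ[R] (1 : A)) := by
    simp only [Commute, SemiconjBy, Algebra.TensorProduct.tmul_mul_tmul, one_mul, mul_one,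
      smul_mul_assoc, mul_smul_comm]
  rw [hA.tensor.nexp_shift (b := (algebraMap ℂ R c • w) ⊗ₜ[R] (1 : A)) ?_ hc (hw.tmul_left _)
    (hw'.tmul_left _), nexp_tmul_one]
  · simp
  · simp [hx, mul_add, TensorProduct.tmul_add, TensorProduct.smul_tmul]

theorem nexp_tmul_commute (n : ℕ) {a b x y : A} (hx : Commute a x) (hy : Commute b y) :
    Commute (nexp R n (a ⊗ₜ[R] b)) (x ⊗ₜ[R] y) :=
  nexp_commute (by simp [Commute, SemiconjBy, hx.eq, hy.eq]) n

/-- The formulas for the coproduct of `U_q(sl(2))`. -/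
structure IsQComul (Δ : A →ₐ[R] A ⊗[R] A) (n : ℕ) (h : R) (H Ep Em : A) :
    Prop where
  comul_H : Δ H = H ⊗ₜ[R] 1 + 1 ⊗ₜ[R] H
  comul_Ep : Δ Ep = Ep ⊗ₜ[R] 1 + nexp R n (h • H) ⊗ₜ[R] Ep
  comul_Em : Δ Em = Em ⊗ₜ[R] nexp R n (-(h • H)) + 1 ⊗ₜ[R] Em

theorem IsQComul.comulLeft_tmul {Δ : A →ₐ[R] A ⊗[R] A} {H Ep Em : A} (d : IsQComul Δ n h H Ep Em) (w : A) :
    comulLeft Δ (H ⊗ₜ[R] w) = leg13 A (H ⊗ₜ[R] w) + leg23 A (H ⊗ₜ[R] w) := by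
  rw [HybridSl2.comulLeft_tmul, d.comul_H, TensorProduct.add_tmul, leg13_tmul, leg23_tmul]

theorem IsQComul.comulRight_tmul {Δ : A →ₐ[R] A ⊗[R] A} {H Ep Em : A} (d : IsQComul Δ n h H Ep Em) (w : A) :
    comulRight Δ (w ⊗ₜ[R] H) = leg13 A (w ⊗ₜ[R] H) + leg12 A (w ⊗ₜ[R] H) := by
  rw [HybridSl2.comulRight_tmul, d.comul_H, TensorProduct.tmul_add, map_add, assocInv_tmul,
    assocInv_tmul, leg13_tmul, leg12_apply, add_comm]

namespace SlTriple

variable {H Ep Em : A} (t : SlTriple n h H Ep Em)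
include t

theorem nexp_HH_Ep_left (hA : Killed I n A) {c : R} (hc : c ∈ I) :
    nexp R n (c • (H ⊗ₜ[R] H)) * (Ep ⊗ₜ[R] 1) =
      (Ep ⊗ₜ[R] nexp R n (c • H)) * nexp R n (c • (H ⊗ₜ[R] H)) := by
  have := hA.nexp_tmul_left (small_smul hc H) t.shift_Ep
  rwa [map_one, one_smul, TensorProduct.tmul_smul] at this

theorem nexp_HH_Em_left (hA : Killed I n A) {c : R} (hc : c ∈ I) :
    nexp R n (c • (H ⊗ₜ[R] H)) * (Em ⊗ₜ[R] 1) =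
      (Em ⊗ₜ[R] nexp R n (-(c • H))) * nexp R n (c • (H ⊗ₜ[R] H)) := by
  have := hA.nexp_tmul_left (small_smul hc H) t.shift_Em
  rwa [map_neg, map_one, neg_one_smul, TensorProduct.tmul_smul] at this

theorem nexp_HH_Ep_right (hA : Killed I n A) {c : R} (hc : c ∈ I) :
    nexp R n (c • (H ⊗ₜ[R] H)) * (1 ⊗ₜ[R] Ep) =
      (nexp R n (c • H) ⊗ₜ[R] Ep) * nexp R n (c • (H ⊗ₜ[R] H)) := by
  have := hA.nexp_tmul_right (small_smul hc H) t.shift_Ep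
  rwa [map_one, one_smul, ← TensorProduct.smul_tmul'] at this

theorem nexp_HH_Em_right (hA : Killed I n A) {c : R} (hc : c ∈ I) :
    nexp R n (c • (H ⊗ₜ[R] H)) * (1 ⊗ₜ[R] Em) =
      (nexp R n (-(c • H)) ⊗ₜ[R] Em) * nexp R n (c • (H ⊗ₜ[R] H)) := by
  have := hA.nexp_tmul_right (small_smul hc H) t.shift_Em
  rwa [map_neg, map_one, neg_one_smul, ← TensorProduct.smul_tmul'] at this

omit t in
theorem commute_nexp_H (c : R) : Commute H (nexp R n (c • H)) :=
  (nexp_commute ((Commute.refl H).smul_left c) n).symm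

omit t in
theorem nexp_HH_commute (c : R) {x y : A} (hx : Commute H x) (hy : Commute H y) :
    Commute (nexp R n (c • (H ⊗ₜ[R] H))) (x ⊗ₜ[R] y) :=
  nexp_commute (Commute.smul_left (by simp [Commute, SemiconjBy, hx.eq, hy.eq]) c) n

/-- By `Ep_Em_pow` the degree `m + 1` term of the commutator with `E₊ ⊗ 1` equals the degree `m`
term coming from the two summands with `E₊` on the right. The degree `0` term is zero and the one of
degree `n` is killed by `h ^ n`. -/
theorem qexp_comul_Ep (hA : Killed I n A) (hh : h ∈ I) :
    qexp n h (Em ⊗ₜ[R] Ep) * (Ep ⊗ₜ[R] 1 + nexp R n (h • H) ⊗ₜ[R] Ep) =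
      (nexp R n (-(h • H)) ⊗ₜ[R] Ep + Ep ⊗ₜ[R] 1) * qexp n h (Em ⊗ₜ[R] Ep) := by
  have h1 : (Ep ⊗ₜ[R] 1) * qexp n h (Em ⊗ₜ[R] Ep) - qexp n h (Em ⊗ₜ[R] Ep) * (Ep ⊗ₜ[R] 1) =
      ∑ m ∈ Finset.range n,
        (ev R n (rcoeff m) h • (Ep * Em ^ m - Em ^ m * Ep)) ⊗ₜ[R] (Ep ^ m) := by
    rw [qexp, Finset.mul_sum, Finset.sum_mul, ← Finset.sum_sub_distrib]
    refine Finset.sum_congr rfl fun m _ => ?_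
    simp [smul_sub, TensorProduct.sub_tmul, TensorProduct.smul_tmul']
  have h2 : qexp n h (Em ⊗ₜ[R] Ep) * (nexp R n (h • H) ⊗ₜ[R] Ep) -
      (nexp R n (-(h • H)) ⊗ₜ[R] Ep) * qexp n h (Em ⊗ₜ[R] Ep) =
      ∑ m ∈ Finset.range n, (ev R n (rcoeff m) h •
        (Em ^ m * nexp R n (h • H) - nexp R n (-(h • H)) * Em ^ m)) ⊗ₜ[R] (Ep ^ (m + 1)) := by
    rw [qexp, Finset.mul_sum, Finset.sum_mul, ← Finset.sum_sub_distrib]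
    refine Finset.sum_congr rfl fun m _ => ?_
    simp [smul_sub, TensorProduct.sub_tmul, TensorProduct.smul_tmul', ← pow_succ, ← pow_succ']
  have h3 := Finset.sum_range_succ' (fun m =>
    (ev R n (rcoeff m) h • (Ep * Em ^ m - Em ^ m * Ep)) ⊗ₜ[R] (Ep ^ m)) n
  rw [Finset.sum_range_succ, hA.ev_smul_eq_zero hh le_rfl (X_pow_dvd_rcoeff n)] at h3
  simp only [t.Ep_Em_pow hA hh, pow_zero, mul_one, one_mul, sub_self, smul_zero,
    TensorProduct.zero_tmul, add_zero] at h3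
  have h4 := h1.trans (h3.trans h2.symm)
  rw [sub_eq_sub_iff_add_eq_add] at h4
  rw [mul_add, add_mul, add_comm, ← h4, add_comm]

theorem qexp_comul_Em (hA : Killed I n A) (hh : h ∈ I) :
    qexp n h (Em ⊗ₜ[R] Ep) * (Em ⊗ₜ[R] nexp R n (-(h • H)) + 1 ⊗ₜ[R] Em) =
      (Em ⊗ₜ[R] nexp R n (h • H) + 1 ⊗ₜ[R] Em) * qexp n h (Em ⊗ₜ[R] Ep) := by
  have h1 : qexp n h (Em ⊗ₜ[R] Ep) * (1 ⊗ₜ[R] Em) - (1 ⊗ₜ[R] Em) * qexp n h (Em ⊗ₜ[R] Ep) =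
      ∑ m ∈ Finset.range n,
        (Em ^ m) ⊗ₜ[R] (ev R n (rcoeff m) h • (Ep ^ m * Em - Em * Ep ^ m)) := by
    rw [qexp, Finset.mul_sum, Finset.sum_mul, ← Finset.sum_sub_distrib]
    refine Finset.sum_congr rfl fun m _ => ?_
    simp [smul_sub, TensorProduct.tmul_sub]
  have h2 : (Em ⊗ₜ[R] nexp R n (h • H)) * qexp n h (Em ⊗ₜ[R] Ep) -
      qexp n h (Em ⊗ₜ[R] Ep) * (Em ⊗ₜ[R] nexp R n (-(h • H))) =
      ∑ m ∈ Finset.range n, (Em ^ (m + 1)) ⊗ₜ[R] (ev R n (rcoeff m) h •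
        (nexp R n (h • H) * Ep ^ m - Ep ^ m * nexp R n (-(h • H)))) := by
    rw [qexp, Finset.mul_sum, Finset.sum_mul, ← Finset.sum_sub_distrib]
    refine Finset.sum_congr rfl fun m _ => ?_
    simp [smul_sub, TensorProduct.tmul_sub, ← pow_succ, ← pow_succ']
  have h3 := Finset.sum_range_succ' (fun m =>
    (Em ^ m) ⊗ₜ[R] (ev R n (rcoeff m) h • (Ep ^ m * Em - Em * Ep ^ m))) n
  rw [Finset.sum_range_succ, hA.ev_smul_eq_zero hh le_rfl (X_pow_dvd_rcoeff n)] at h3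
  simp only [t.Ep_pow_Em hA hh, pow_zero, mul_one, one_mul, sub_self, smul_zero,
    TensorProduct.tmul_zero, add_zero] at h3
  have h4 := h1.trans (h3.trans h2.symm)
  rw [sub_eq_sub_iff_add_eq_add] at h4
  rw [mul_add, add_mul, add_comm, h4]

theorem matQ_comul_H (n : ℕ) :
    matQ R n h H Ep Em * (H ⊗ₜ[R] 1 + 1 ⊗ₜ[R] H) =
      (H ⊗ₜ[R] 1 + 1 ⊗ₜ[R] H) * matQ R n h H Ep Em := by
  have e1 := t.H_Ep
  have e2 := t.H_Em
  rw [sub_eq_iff_eq_add] at e1 e2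
  have h1 : (H ⊗ₜ[R] 1 + 1 ⊗ₜ[R] H) * (Em ⊗ₜ[R] Ep) =
      (Em ⊗ₜ[R] Ep) * (H ⊗ₜ[R] 1 + 1 ⊗ₜ[R] H) := by
    simp only [add_mul, mul_add, Algebra.TensorProduct.tmul_mul_tmul, one_mul, mul_one, e1, e2,
      TensorProduct.add_tmul, TensorProduct.tmul_add, TensorProduct.neg_tmul]
    abel
  have h2 := qexp_intertwine h1 n h
  have h3 : Commute (nexp R n (h • (H ⊗ₜ[R] H))) (H ⊗ₜ[R] 1 + 1 ⊗ₜ[R] H) :=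
    (nexp_HH_commute h (Commute.refl H) (Commute.one_right H)).add_right
      (nexp_HH_commute h (Commute.one_right H) (Commute.refl H))
  change nexp R n (h • (H ⊗ₜ[R] H)) * qexp n h (Em ⊗ₜ[R] Ep) * _ =
    _ * (nexp R n (h • (H ⊗ₜ[R] H)) * qexp n h (Em ⊗ₜ[R] Ep))
  rw [mul_assoc, ← h2, ← mul_assoc, h3.eq, mul_assoc]

/-- The `q`-exponential has already exchanged `e^{hH}` for `e^{-hH}`. The factor `e^{h H ⊗ H}` then
removes `e^{-hH}` from beside `1 ⊗ E₊` and attaches `e^{hH}` to `E₊ ⊗ 1`, which gives the opposite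
coproduct. -/
theorem matQ_comul_Ep (hA : Killed I n A) (hh : h ∈ I) :
    matQ R n h H Ep Em * (Ep ⊗ₜ[R] 1 + nexp R n (h • H) ⊗ₜ[R] Ep) =
      (1 ⊗ₜ[R] Ep + Ep ⊗ₜ[R] nexp R n (h • H)) * matQ R n h H Ep Em := by
  change nexp R n (h • (H ⊗ₜ[R] H)) * qexp n h (Em ⊗ₜ[R] Ep) * _ =
    _ * (nexp R n (h • (H ⊗ₜ[R] H)) * qexp n h (Em ⊗ₜ[R] Ep))
  have hK := hA.nexp_mul_neg (small_smul hh H)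
  have h1 : nexp R n (h • (H ⊗ₜ[R] H)) * (nexp R n (-(h • H)) ⊗ₜ[R] Ep) =
      (1 ⊗ₜ[R] Ep) * nexp R n (h • (H ⊗ₜ[R] H)) := by
    have hc : Commute (nexp R n (h • (H ⊗ₜ[R] H))) (nexp R n (-(h • H)) ⊗ₜ[R] (1 : A)) :=
      nexp_HH_commute h (by rw [← neg_smul]; exact commute_nexp_H _) (Commute.one_right H)
    have e : nexp R n (-(h • H)) ⊗ₜ[R] Ep =
        (1 ⊗ₜ[R] Ep) * (nexp R n (-(h • H)) ⊗ₜ[R] (1 : A)) := by simp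
    rw [e, ← mul_assoc, t.nexp_HH_Ep_right hA hh, mul_assoc, hc.eq, ← mul_assoc]
    simp [hK]
  rw [mul_assoc, t.qexp_comul_Ep hA hh, ← mul_assoc, mul_add, h1, t.nexp_HH_Ep_left hA hh,
    ← add_mul, mul_assoc]

theorem matQ_comul_Em (hA : Killed I n A) (hh : h ∈ I) :
    matQ R n h H Ep Em * (Em ⊗ₜ[R] nexp R n (-(h • H)) + 1 ⊗ₜ[R] Em) =
      (nexp R n (-(h • H)) ⊗ₜ[R] Em + Em ⊗ₜ[R] 1) * matQ R n h H Ep Em := by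
  change nexp R n (h • (H ⊗ₜ[R] H)) * qexp n h (Em ⊗ₜ[R] Ep) * _ =
    _ * (nexp R n (h • (H ⊗ₜ[R] H)) * qexp n h (Em ⊗ₜ[R] Ep))
  have hK := hA.nexp_neg_mul (small_smul hh H)
  have h1 : nexp R n (h • (H ⊗ₜ[R] H)) * (Em ⊗ₜ[R] nexp R n (h • H)) =
      (Em ⊗ₜ[R] 1) * nexp R n (h • (H ⊗ₜ[R] H)) := by
    have hc : Commute (nexp R n (h • (H ⊗ₜ[R] H))) ((1 : A) ⊗ₜ[R] nexp R n (h • H)) :=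
      nexp_HH_commute h (Commute.one_right H) (commute_nexp_H _)
    have e : Em ⊗ₜ[R] nexp R n (h • H) =
        (Em ⊗ₜ[R] 1) * ((1 : A) ⊗ₜ[R] nexp R n (h • H)) := by simp
    rw [e, ← mul_assoc, t.nexp_HH_Em_left hA hh, mul_assoc, hc.eq, ← mul_assoc]
    simp [hK]
  rw [mul_assoc, t.qexp_comul_Em hA hh, ← mul_assoc, mul_add, h1, t.nexp_HH_Em_right hA hh,
    ← add_mul, mul_assoc, add_comm]

variable {Δ : A →ₐ[R] A ⊗[R] A} (d : IsQComul Δ n h H Ep Em)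
include d

/-- `Δ(E₋) ⊗ E₊` is a sum of two terms that commute up to `p`, so its `q`-exponential factors.
Moving the first factor past `e^{h H ⊗ H}` on legs 2 and 3 strips off `e^{-hH}` in the middle and
leaves an expression on legs 1 and 3. -/
theorem matQ_comulLeft (hA : Killed I n A) (hh : h ∈ I) :
    comulLeft Δ (matQ R n h H Ep Em) =
      leg13 A (matQ R n h H Ep Em) * leg23 A (matQ R n h H Ep Em) := by
  have hA2 : Killed I n (A ⊗[R] A) := hA.tensor
  have hA3 : Killed I n ((A ⊗[R] A) ⊗[R] A) := hA2.tensor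
  set W := nexp R n (h • (H ⊗ₜ[R] H)) with hW
  set K := nexp R n (h • H)
  set K' := nexp R n (-(h • H))
  have hKK : K * K' = 1 := hA.nexp_mul_neg (small_smul hh H)
  have hsm : Small I (h • (H ⊗ₜ[R] H)) := small_smul hh _
  have e1 : comulLeft Δ W = leg13 A W * leg23 A W := by
    have hc : Commute (leg13 A (h • (H ⊗ₜ[R] H))) (leg23 A (h • (H ⊗ₜ[R] H))) := by
      rw [map_smul, map_smul]
      refine (Commute.smul_left ?_ h).smul_right h
      simp [Commute, SemiconjBy]
    rw [hW, map_nexp, map_smul, d.comulLeft_tmul, smul_add, ← map_smul, ← map_smul,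
      hA3.nexp_add hc (hsm.map _) (hsm.map _), map_nexp, map_nexp]
  have e2 : W * (K' ⊗ₜ[R] Ep) = (1 ⊗ₜ[R] Ep) * W := by
    have hc : Commute W (K' ⊗ₜ[R] (1 : A)) :=
      nexp_HH_commute h (by simp only [K', ← neg_smul]; exact commute_nexp_H _)
        (Commute.one_right H)
    have e : K' ⊗ₜ[R] Ep = (1 ⊗ₜ[R] Ep) * (K' ⊗ₜ[R] (1 : A)) := by simp
    rw [e, ← mul_assoc, t.nexp_HH_Ep_right hA hh, mul_assoc, hc.eq, ← mul_assoc]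
    simp [K, hKK]
  have e3 : leg23 A W * ((Em ⊗ₜ[R] K') ⊗ₜ[R] Ep) = leg13 A (Em ⊗ₜ[R] Ep) * leg23 A W := by
    have h1 : (Em ⊗ₜ[R] K') ⊗ₜ[R] Ep = leg12 A (Em ⊗ₜ[R] 1) * leg23 A (K' ⊗ₜ[R] Ep) := by simp
    have h2 : leg13 A (Em ⊗ₜ[R] Ep) = leg12 A (Em ⊗ₜ[R] 1) * leg23 A (1 ⊗ₜ[R] Ep) := by simp
    have h3 : ∀ z, Commute (leg23 A z) (leg12 A (Em ⊗ₜ[R] (1 : A))) := by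
      intro z
      induction z using TensorProduct.induction_on with
      | zero => simp
      | tmul a b => simp [Commute, SemiconjBy]
      | add x y hx hy => rw [map_add]; exact hx.add_left hy
    rw [h1, h2, ← mul_assoc, (h3 W).eq, mul_assoc, ← map_mul, e2, map_mul, mul_assoc]
  have e4 := qexp_intertwine e3 n h
  have e5 : (leg23 A (Em ⊗ₜ[R] Ep)) * ((Em ⊗ₜ[R] K') ⊗ₜ[R] Ep) =
      ev R n (expS (-1)) h • (((Em ⊗ₜ[R] K') ⊗ₜ[R] Ep) * (leg23 A (Em ⊗ₜ[R] Ep))) := by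
    have h1 := hA.nexp_neg_mul_of_shift hh t.shift_Em
    rw [neg_neg] at h1
    simp only [leg23_tmul, Algebra.TensorProduct.tmul_mul_tmul, one_mul, mul_one, K', h1,
      TensorProduct.tmul_smul, ← TensorProduct.smul_tmul']
    rw [← hA3.ev_mul_smul hh, ← expS_add, neg_add_cancel, expS_zero, hA3.ev_one_smul hh]
  have e6 : comulLeft Δ (qexp n h (Em ⊗ₜ[R] Ep)) =
      qexp n h ((Em ⊗ₜ[R] K') ⊗ₜ[R] Ep) * leg23 A (qexp n h (Em ⊗ₜ[R] Ep)) := by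
    rw [map_qexp, map_qexp, ← hA3.qexp_add hh e5, HybridSl2.comulLeft_tmul, d.comul_Em,
      TensorProduct.add_tmul, add_comm, leg23_tmul]
  change comulLeft Δ (W * qexp n h (Em ⊗ₜ[R] Ep)) =
    leg13 A (W * qexp n h (Em ⊗ₜ[R] Ep)) * leg23 A (W * qexp n h (Em ⊗ₜ[R] Ep))
  rw [map_mul, e1, e6, map_mul, map_mul, mul_assoc, ← mul_assoc (leg23 A W), e4,
    map_qexp (leg13 (R := R) A)]
  simp only [mul_assoc]

theorem matQ_comulRight (hA : Killed I n A) (hh : h ∈ I) :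
    comulRight Δ (matQ R n h H Ep Em) =
      leg13 A (matQ R n h H Ep Em) * leg12 A (matQ R n h H Ep Em) := by
  have hA2 : Killed I n (A ⊗[R] A) := hA.tensor
  have hA3 : Killed I n ((A ⊗[R] A) ⊗[R] A) := hA2.tensor
  set W := nexp R n (h • (H ⊗ₜ[R] H)) with hW
  set K := nexp R n (h • H)
  set K' := nexp R n (-(h • H))
  have hKK : K' * K = 1 := hA.nexp_neg_mul (small_smul hh H)
  have hsm : Small I (h • (H ⊗ₜ[R] H)) := small_smul hh _
  have e1 : comulRight Δ W = leg13 A W * leg12 A W := by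
    have hc : Commute (leg13 A (h • (H ⊗ₜ[R] H))) (leg12 A (h • (H ⊗ₜ[R] H))) := by
      rw [map_smul, map_smul]
      refine (Commute.smul_left ?_ h).smul_right h
      simp [Commute, SemiconjBy]
    rw [hW, map_nexp, map_smul, d.comulRight_tmul, smul_add, ← map_smul, ← map_smul,
      hA3.nexp_add hc (hsm.map _) (hsm.map _), map_nexp, map_nexp]
  have e2 : W * (Em ⊗ₜ[R] K) = (Em ⊗ₜ[R] 1) * W := by
    have hc : Commute W ((1 : A) ⊗ₜ[R] K) :=
      nexp_HH_commute h (Commute.one_right H) (commute_nexp_H _)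
    have e : Em ⊗ₜ[R] K = (Em ⊗ₜ[R] 1) * ((1 : A) ⊗ₜ[R] K) := by simp
    rw [e, ← mul_assoc, t.nexp_HH_Em_left hA hh, mul_assoc, hc.eq, ← mul_assoc]
    simp [K', hKK]
  have e3 : leg12 A W * ((Em ⊗ₜ[R] K) ⊗ₜ[R] Ep) = leg13 A (Em ⊗ₜ[R] Ep) * leg12 A W := by
    have h1 : leg12 A W * ((Em ⊗ₜ[R] K) ⊗ₜ[R] Ep) = (W * Em ⊗ₜ[R] K) ⊗ₜ[R] Ep := by simp
    rw [h1, e2]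
    simp
  have e4 := qexp_intertwine e3 n h
  have e5 : (leg12 A (Em ⊗ₜ[R] Ep)) * ((Em ⊗ₜ[R] K) ⊗ₜ[R] Ep) =
      ev R n (expS (-1)) h • (((Em ⊗ₜ[R] K) ⊗ₜ[R] Ep) * (leg12 A (Em ⊗ₜ[R] Ep))) := by
    have h1 := hA.nexp_mul_of_shift hh t.shift_Ep
    simp only [leg12_apply, Algebra.TensorProduct.tmul_mul_tmul, one_mul, mul_one, K, h1,
      TensorProduct.tmul_smul, ← TensorProduct.smul_tmul']
    rw [← hA3.ev_mul_smul hh, ← expS_add, neg_add_cancel, expS_zero, hA3.ev_one_smul hh]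
  have e6 : comulRight Δ (qexp n h (Em ⊗ₜ[R] Ep)) =
      qexp n h ((Em ⊗ₜ[R] K) ⊗ₜ[R] Ep) * leg12 A (qexp n h (Em ⊗ₜ[R] Ep)) := by
    rw [map_qexp, map_qexp, ← hA3.qexp_add hh e5, HybridSl2.comulRight_tmul, d.comul_Ep,
      TensorProduct.tmul_add, map_add, assocInv_tmul, assocInv_tmul, leg12_apply]
  change comulRight Δ (W * qexp n h (Em ⊗ₜ[R] Ep)) =
    leg13 A (W * qexp n h (Em ⊗ₜ[R] Ep)) * leg12 A (W * qexp n h (Em ⊗ₜ[R] Ep))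
  rw [map_mul, e1, e6, map_mul, map_mul, mul_assoc, ← mul_assoc (leg12 A W), e4,
    map_qexp (leg13 (R := R) A)]
  simp only [mul_assoc]

end SlTriple

theorem Killed.isUnit_nexp (hA : Killed I n A) {a : A} (ha : Small I a) : IsUnit (nexp R n a) :=
  hA.isUnit_of_small_sub_one (hA.small_nexp_sub_one ha)

theorem Killed.isUnit_matQ (hA : Killed I n A) (hh : h ∈ I) (H Ep Em : A) :
    IsUnit (matQ R n h H Ep Em) :=
  (hA.tensor.isUnit_nexp (small_smul hh _)).mul (hA.tensor.isUnit_qexp hh _)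

variable {hh : h ∈ I}

theorem uq_isQComul (hh : h ∈ I) (n : ℕ) :
    IsQComul ((uqHopf I h hh).Δ n) n h (UqH I h hh n) (UqEp I h hh n) (UqEm I h hh n) :=
  ⟨uqComul_H hh, uqComul_Ep hh, uqComul_Em hh⟩

theorem uq_tr2_tmul (hh : h ∈ I) (n : ℕ) (x y : (Uq I h hh).obj (n + 1)) :
    (Uq I h hh).tr2 n (x ⊗ₜ y) = (Uq I h hh).tr n x ⊗ₜ (Uq I h hh).tr n y := rfl

theorem Killed.qexp_succ (hA : Killed I n A) (hh : h ∈ I) (x : A) :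
    qexp (n + 1) h x = qexp n h x := by
  have h0 := hA.pow (small_algebraMap hh)
  have h1 : ∀ (p : ℂ⟦X⟧) (y : A), ev R (n + 1) p h • y = ev R n p h • y := by
    intro p y
    rw [smul_ev, smul_ev, ev_succ p h0]
  rw [qexp, Finset.sum_range_succ, h1, hA.ev_smul_eq_zero hh le_rfl (X_pow_dvd_rcoeff n), add_zero]
  simp only [h1, qexp]

theorem uqR_isUniversalR (I : Ideal R) (h : R) (hh : h ∈ I) :
    (uqHopf I h hh).IsUniversalR (UqR I h hh) where
  compat n := by
    have hA := (uq_killed I h hh n).tensor (B := (Uq I h hh).obj n)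
    change (Uq I h hh).tr2 n (_ * qexp _ _ _) = _ * qexp _ _ _
    obtain ⟨h1, h2, h3⟩ := uq_tr_gen hh n
    rw [map_mul, map_nexp, map_qexp, map_smul, uq_tr2_tmul, uq_tr2_tmul, h1, h2, h3,
      hA.qexp_succ hh, nexp_succ (hA.pow (small_smul hh _))]
  isUnit n := (uq_killed I h hh n).isUnit_matQ hh _ _ _
  comm n x := by
    have hA := uq_killed I h hh n
    have t := uq_triple I h hh n
    have d := uq_isQComul hh n
    induction x using uq_induction with
    | hr r => rw [AlgHom.commutes, AlgHom.commutes, Algebra.commutes]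
    | hH =>
      rw [d.comul_H, map_add, swap_tmul, swap_tmul, add_comm (1 ⊗ₜ[R] _)]
      exact t.matQ_comul_H n
    | hEp =>
      rw [d.comul_Ep, map_add, swap_tmul, swap_tmul]
      exact t.matQ_comul_Ep hA hh
    | hEm =>
      rw [d.comul_Em, map_add, swap_tmul, swap_tmul]
      exact t.matQ_comul_Em hA hh
    | hadd x y hx hy => simp only [map_add, mul_add, add_mul, hx, hy]
    | hmul x y hx hy => rw [map_mul, map_mul, ← mul_assoc, hx, mul_assoc, hy, mul_assoc]
  comul_left n := (uq_triple I h hh n).matQ_comulLeft (uq_isQComul hh n) (uq_killed I h hh n) hh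
  comul_right n := (uq_triple I h hh n).matQ_comulRight (uq_isQComul hh n) (uq_killed I h hh n) hh

end RMatrix

/-! ### The quantum Jordanian twist and its cocycle identity. -/

section JordanTwist

open PowerSeries

variable {R : Type u} [CommRing R] [Algebra ℂ R] {A : Type u} [Ring A] [Algebra R A]
  {I : Ideal R} {n : ℕ} {h ξ : R}

theorem Killed.small_omega_arg (hA : Killed I n A) (hh : h ∈ I) (hξ : ξ ∈ I) (H Ep : A) :
    Small I ((ξ • Ep + 1) * nexp R n (h • H) - 1) := by
  have e : (ξ • Ep + 1) * nexp R n (h • H) - 1 =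
      ξ • (Ep * nexp R n (h • H)) + (nexp R n (h • H) - 1) := by
    rw [add_mul, one_mul, smul_mul_assoc, add_sub_assoc]
  rw [e]
  exact (small_smul hξ _).add (hA.small_nexp_sub_one (small_smul hh _))

theorem Killed.small_omega (hA : Killed I n A) (hh : h ∈ I) (hξ : ξ ∈ I) (H Ep : A) :
    Small I (omega R n h ξ H Ep) :=
  small_nlog (hA.small_omega_arg hh hξ H Ep)

theorem Killed.nexp_omega (hA : Killed I n A) (hh : h ∈ I) (hξ : ξ ∈ I) (H Ep : A) :
    nexp R n (omega R n h ξ H Ep) = (ξ • Ep + 1) * nexp R n (h • H) :=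
  nexp_nlog (hA.pow (hA.small_omega_arg hh hξ H Ep))

theorem map_omega {B : Type u} [Ring B] [Algebra R B] (f : A →ₐ[R] B) (H Ep : A) :
    f (omega R n h ξ H Ep) = omega R n h ξ (f H) (f Ep) := by
  simp [omega, map_nlog, map_nexp]

theorem nlog_one (n : ℕ) : nlog R n (1 : A) = 0 := by
  rw [nlog, ev, sub_self]
  refine Finset.sum_eq_zero fun i _ => ?_
  cases i <;> simp

theorem nlog_intertwine {a b x : A} (e : a * x = x * b) (n : ℕ) :
    nlog R n a * x = x * nlog R n b :=
  ev_intertwine (by rw [sub_mul, mul_sub, e, one_mul, mul_one]) n _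

namespace SlTriple

variable {H Ep Em : A} (t : SlTriple n h H Ep Em) (hA : Killed I n A) (hh : h ∈ I) (hξ : ξ ∈ I)
  {Δ : A →ₐ[R] A ⊗[R] A} (d : IsQComul Δ n h H Ep Em)
include t hA hh hξ

include d in
-- Write `K = e^{hH}`, so `e^ω = (ξ E₊ + 1) K`. Conjugation by `e^{-h H ⊗ H}` turns `Δ(e^ω)` into `K
-- ⊗ e^ω + ξ E₊ K ⊗ 1`. Conjugation by `e^{H ⊗ ω}` fixes the first term and multiplies the second by
-- `1 ⊗ e^ω`, because `[H, E₊] = E₊`. The sum is `e^ω ⊗ e^ω`.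
theorem twistQJ_comul_nexp_omega :
    twistQJ R n h ξ H Ep * Δ (nexp R n (omega R n h ξ H Ep)) =
      (nexp R n (omega R n h ξ H Ep) ⊗ₜ[R] nexp R n (omega R n h ξ H Ep)) *
        twistQJ R n h ξ H Ep := by
  set e := nexp R n (omega R n h ξ H Ep) with he
  set K := nexp R n (h • H) with hK
  have hKK : nexp R n (-(h • H)) * K = 1 := hA.nexp_neg_mul (small_smul hh H)
  have e0 : e = (ξ • Ep + 1) * K := hA.nexp_omega hh hξ H Ep
  have hω := hA.small_omega hh hξ H Ep
  set V := nexp R n (H ⊗ₜ[R] omega R n h ξ H Ep) with hV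
  set W := nexp R n (-(h • (H ⊗ₜ[R] H))) with hW
  have hKc : Commute H K := commute_nexp_H h
  have hWc : ∀ {x y : A}, Commute H x → Commute H y → Commute W (x ⊗ₜ[R] y) := by
    intro x y hx hy
    rw [hW, ← neg_smul]
    exact nexp_HH_commute _ hx hy
  have w1 : W * (Ep ⊗ₜ[R] 1) = (Ep ⊗ₜ[R] nexp R n (-(h • H))) * W := by
    have := t.nexp_HH_Ep_left hA (neg_mem hh)
    rwa [neg_smul, neg_smul] at this
  have w2 : W * (1 ⊗ₜ[R] Ep) = (nexp R n (-(h • H)) ⊗ₜ[R] Ep) * W := by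
    have := t.nexp_HH_Ep_right hA (neg_mem hh)
    rwa [neg_smul, neg_smul] at this
  have v1 : V * (Ep ⊗ₜ[R] 1) = (Ep ⊗ₜ[R] e) * V := by
    have := hA.nexp_tmul_left hω t.shift_Ep
    rwa [map_one, one_smul] at this
  have v2 : Commute V (K ⊗ₜ[R] 1) := nexp_tmul_commute n hKc (Commute.one_right _)
  have v3 : Commute V (1 ⊗ₜ[R] e) :=
    nexp_tmul_commute n (Commute.one_right _) (nexp_commute (Commute.refl _) n).symm
  have dK : Δ K = K ⊗ₜ[R] K := by
    rw [hK, map_nexp, map_smul, d.comul_H, smul_add, TensorProduct.smul_tmul',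
      ← TensorProduct.tmul_smul, hA.nexp_primitive (small_smul hh _)]
  have a1 : W * Δ e = ((K ⊗ₜ[R] 1) * (1 ⊗ₜ[R] e) + ξ • ((Ep ⊗ₜ[R] 1) * (K ⊗ₜ[R] 1))) * W := by
    have b1 : W * (Ep ⊗ₜ[R] 1) * (K ⊗ₜ[R] K) = (Ep ⊗ₜ[R] 1) * (K ⊗ₜ[R] 1) * W := by
      rw [w1, mul_assoc, (hWc hKc hKc).eq, ← mul_assoc]
      simp [hKK]
    have b2 : W * (K ⊗ₜ[R] Ep) * (K ⊗ₜ[R] K) = (K ⊗ₜ[R] (Ep * K)) * W := by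
      have c1 : K ⊗ₜ[R] Ep = (1 ⊗ₜ[R] Ep) * (K ⊗ₜ[R] (1 : A)) := by simp
      rw [c1, ← mul_assoc, w2, mul_assoc, mul_assoc, ← mul_assoc W, (hWc hKc (Commute.one_right _)).eq,
        mul_assoc, (hWc hKc hKc).eq]
      simp only [← mul_assoc, Algebra.TensorProduct.tmul_mul_tmul, hKK, one_mul]
    have c2 : Δ e = ξ • ((Ep ⊗ₜ[R] 1) * (K ⊗ₜ[R] K)) + ξ • ((K ⊗ₜ[R] Ep) * (K ⊗ₜ[R] K)) +
        K ⊗ₜ[R] K := by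
      rw [e0, map_mul, map_add, map_smul, map_one, dK, d.comul_Ep, add_mul, one_mul,
        smul_mul_assoc, add_mul, smul_add]
    have c4 : (K ⊗ₜ[R] 1) * ((1 : A) ⊗ₜ[R] e) = ξ • (K ⊗ₜ[R] (Ep * K)) + K ⊗ₜ[R] K := by
      rw [e0, Algebra.TensorProduct.tmul_mul_tmul, one_mul, mul_one, add_mul, one_mul,
        smul_mul_assoc, TensorProduct.tmul_add, TensorProduct.tmul_smul]
    rw [c2, mul_add, mul_add, mul_smul_comm, mul_smul_comm, ← mul_assoc, ← mul_assoc, b1, b2,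
      (hWc hKc hKc).eq, add_mul, c4, add_mul, smul_mul_assoc, smul_mul_assoc]
    abel
  change V * W * Δ e = (e ⊗ₜ[R] e) * (V * W)
  rw [mul_assoc, a1, ← mul_assoc, mul_add, mul_smul_comm, ← mul_assoc, v2.eq, mul_assoc _ V,
    v3.eq, ← mul_assoc, ← mul_assoc V, v1, mul_assoc _ V, v2.eq]
  have c3 : e ⊗ₜ[R] e = (K ⊗ₜ[R] 1) * (1 ⊗ₜ[R] e) + ξ • ((Ep ⊗ₜ[R] e) * (K ⊗ₜ[R] 1)) := by
    nth_rewrite 1 [e0]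
    simp only [Algebra.TensorProduct.tmul_mul_tmul, one_mul, mul_one, add_mul, smul_mul_assoc,
      TensorProduct.add_tmul, TensorProduct.smul_tmul']
    abel
  rw [c3]
  simp only [add_mul, mul_assoc, smul_mul_assoc]

include d in
-- Take logarithms in the previous identity, using `e^ω ⊗ e^ω = e^{ω ⊗ 1 + 1 ⊗ ω}`.
theorem twistQJ_comul_omega :
    twistQJ R n h ξ H Ep * Δ (omega R n h ξ H Ep) =
      (omega R n h ξ H Ep ⊗ₜ[R] 1 + 1 ⊗ₜ[R] omega R n h ξ H Ep) * twistQJ R n h ξ H Ep := by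
  have h1 := t.twistQJ_comul_nexp_omega hA hh hξ d
  have hω := hA.small_omega hh hξ H Ep
  have hω2 : Small I (omega R n h ξ H Ep ⊗ₜ[R] (1 : A) + (1 : A) ⊗ₜ[R] omega R n h ξ H Ep) :=
    (hω.tmul_left _).add (hω.tmul_right _)
  rw [← hA.nexp_primitive hω] at h1
  have h2 := nlog_intertwine (R := R) h1.symm n
  rw [nlog_nexp (hA.tensor.pow hω2), ← map_nlog Δ, nlog_nexp (hA.pow hω)] at h2
  exact h2.symm

include d in
-- Since `H` is primitive, `(Δ ⊗ id) F` is a product of exponentials in `Hᵢ ω₃` and `Hᵢ H₃`. In `(id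
-- ⊗ Δ) F` the element `Δ(ω)` appears, and moving it past `F₂₃` replaces it by `ω₂ + ω₃`. Both sides
-- then contain the same six exponentials.
theorem twistQJ_cocycle :
    leg12 A (twistQJ R n h ξ H Ep) * comulLeft Δ (twistQJ R n h ξ H Ep) =
      leg23 A (twistQJ R n h ξ H Ep) * comulRight Δ (twistQJ R n h ξ H Ep) := by
  have h1 := t.twistQJ_comul_omega hA hh hξ d
  have hω := hA.small_omega hh hξ H Ep
  have hA2 : Killed I n (A ⊗[R] A) := hA.tensor
  have hA3 : Killed I n ((A ⊗[R] A) ⊗[R] A) := hA2.tensor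
  set F := twistQJ R n h ξ H Ep with hF
  set ω := omega R n h ξ H Ep with hωdef
  have hsa : Small I (H ⊗ₜ[R] ω) := hω.tmul_right H
  have hsb : Small I (-(h • (H ⊗ₜ[R] H))) := (small_smul hh _).neg
  have cb : ∀ {x y : (A ⊗[R] A) ⊗[R] A}, Commute x y → Commute (-(h • x)) (-(h • y)) :=
    fun hxy => ((hxy.smul_left h).smul_right h).neg_left.neg_right
  have lF : leg12 A F = nexp R n (leg12 A (H ⊗ₜ[R] ω)) * nexp R n (-(h • leg12 A (H ⊗ₜ[R] H))) := by
    rw [hF, twistQJ, map_mul, map_nexp, map_nexp, map_neg, map_smul]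
  have rF : leg23 A F = nexp R n (leg23 A (H ⊗ₜ[R] ω)) * nexp R n (-(h • leg23 A (H ⊗ₜ[R] H))) := by
    rw [hF, twistQJ, map_mul, map_nexp, map_nexp, map_neg, map_smul]
  have sa : ∀ f : A ⊗[R] A →ₐ[R] (A ⊗[R] A) ⊗[R] A, Small I (f (H ⊗ₜ[R] ω)) := fun f => hsa.map f
  have sb : ∀ f : A ⊗[R] A →ₐ[R] (A ⊗[R] A) ⊗[R] A, Small I (-(h • f (H ⊗ₜ[R] H))) := fun f => by
    have := hsb.map f
    rwa [map_neg, map_smul] at this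
  have e1 : comulLeft Δ F = nexp R n (leg13 A (H ⊗ₜ[R] ω)) * nexp R n (leg23 A (H ⊗ₜ[R] ω)) *
      nexp R n (-(h • leg13 A (H ⊗ₜ[R] H)) + -(h • leg23 A (H ⊗ₜ[R] H))) := by
    rw [hF, twistQJ, map_mul, map_nexp, map_nexp, map_neg, map_smul, d.comulLeft_tmul,
      d.comulLeft_tmul, hA3.nexp_add (by simp [Commute, SemiconjBy]) (sa _) (sa _), smul_add,
      neg_add]
  have e2 : comulRight Δ F = nexp R n (assocInv A (H ⊗ₜ[R] Δ ω)) *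
      nexp R n (-(h • leg12 A (H ⊗ₜ[R] H)) + -(h • leg13 A (H ⊗ₜ[R] H))) := by
    rw [hF, twistQJ, map_mul, map_nexp, map_nexp, map_neg, map_smul, d.comulRight_tmul,
      HybridSl2.comulRight_tmul, smul_add, neg_add, add_comm (-(h • leg13 A (H ⊗ₜ[R] H)))]
  have e3 : leg23 A F * assocInv A (H ⊗ₜ[R] Δ ω) =
      (leg12 A (H ⊗ₜ[R] ω) + leg13 A (H ⊗ₜ[R] ω)) * leg23 A F := by
    have h2 : leg12 A (H ⊗ₜ[R] ω) + leg13 A (H ⊗ₜ[R] ω) =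
        assocInv A (H ⊗ₜ[R] (ω ⊗ₜ[R] 1 + 1 ⊗ₜ[R] ω)) := by
      rw [TensorProduct.tmul_add, map_add, assocInv_tmul, assocInv_tmul, leg12_apply, leg13_tmul]
    rw [h2, leg23_eq, ← map_mul, ← map_mul, Algebra.TensorProduct.tmul_mul_tmul,
      Algebra.TensorProduct.tmul_mul_tmul, h1, one_mul, mul_one]
  have e4 := (nexp_intertwine (R := R) e3.symm n).symm
  rw [hA3.nexp_add (by simp [Commute, SemiconjBy]) (sa _) (sa _)] at e4
  have cc : ∀ {x y : (A ⊗[R] A) ⊗[R] A}, Commute x y →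
      Commute (nexp R n (-(h • x))) (nexp R n y) := fun {x y} hxy =>
    nexp_commute (R := R) (nexp_commute (R := R) ((hxy.smul_left h).neg_left).symm n).symm n
  have cc2 : ∀ {x y : (A ⊗[R] A) ⊗[R] A}, Commute x y →
      Commute (nexp R n (-(h • x))) (nexp R n (-(h • y))) := fun {x y} hxy =>
    cc ((hxy.smul_right h).neg_right)
  have e5 : Commute (nexp R n (-(h • leg12 A (H ⊗ₜ[R] H))))
      (nexp R n (leg13 A (H ⊗ₜ[R] ω)) * nexp R n (leg23 A (H ⊗ₜ[R] ω))) :=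
    Commute.mul_right (cc (by simp [Commute, SemiconjBy])) (cc (by simp [Commute, SemiconjBy]))
  rw [e1, e2, ← mul_assoc (leg23 A F), e4, lF, rF]
  rw [hA3.nexp_add (cb (by simp [Commute, SemiconjBy])) (sb _) (sb _),
    hA3.nexp_add (cb (by simp [Commute, SemiconjBy])) (sb _) (sb _)]
  have e6 : Commute (nexp R n (-(h • leg23 A (H ⊗ₜ[R] H))))
      (nexp R n (-(h • leg12 A (H ⊗ₜ[R] H))) * nexp R n (-(h • leg13 A (H ⊗ₜ[R] H)))) :=
    Commute.mul_right
      (cc2 (by simp [Commute, SemiconjBy])) (cc2 (by simp [Commute, SemiconjBy]))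
  set a := nexp R n (leg12 A (H ⊗ₜ[R] ω))
  set b := nexp R n (leg13 A (H ⊗ₜ[R] ω))
  set c := nexp R n (leg23 A (H ⊗ₜ[R] ω))
  set a' := nexp R n (-(h • leg12 A (H ⊗ₜ[R] H)))
  set b' := nexp R n (-(h • leg13 A (H ⊗ₜ[R] H)))
  set c' := nexp R n (-(h • leg23 A (H ⊗ₜ[R] H)))
  -- The remaining reordering moves `e^{-h H₁H₂}` past `e^{H₁ω₃} e^{H₂ω₃}` and `e^{-h H₂H₃}` past
  -- the other two Cartan exponentials.
  calc a * a' * (b * c * (b' * c')) = a * (a' * (b * c)) * (b' * c') := by simp only [mul_assoc]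
    _ = a * b * c * ((a' * b') * c') := by rw [e5.eq]; simp only [mul_assoc]
    _ = a * b * (c * c') * (a' * b') := by rw [← e6.eq]; simp only [mul_assoc]

omit hξ in
theorem nexp_neg_HH_left_Em : nexp R n (-(h • (H ⊗ₜ[R] H))) * (Em ⊗ₜ[R] nexp R n (-(h • H))) =
    (Em ⊗ₜ[R] 1) * nexp R n (-(h • (H ⊗ₜ[R] H))) := by
  have h1 := t.nexp_HH_Em_left hA (neg_mem hh)
  rw [neg_smul, neg_smul, neg_neg] at h1
  have hc : Commute (nexp R n (-(h • (H ⊗ₜ[R] H)))) ((1 : A) ⊗ₜ[R] nexp R n (-(h • H))) := by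
    rw [← neg_smul, ← neg_smul]
    exact nexp_HH_commute _ (Commute.one_right H) (commute_nexp_H _)
  have e : Em ⊗ₜ[R] nexp R n (-(h • H)) =
      (Em ⊗ₜ[R] 1) * ((1 : A) ⊗ₜ[R] nexp R n (-(h • H))) := by simp
  rw [e, ← mul_assoc, h1, mul_assoc, hc.eq, ← mul_assoc]
  simp [hA.nexp_mul_neg (small_smul hh H)]

include d

omit t in
theorem twistQJ_comul_H : twistQJ R n h ξ H Ep * Δ H =
    (H ⊗ₜ[R] 1 + expAd R n (H ⊗ₜ[R] omega R n h ξ H Ep) (1 ⊗ₜ[R] H)) *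
      twistQJ R n h ξ H Ep := by
  have hs : Small I (H ⊗ₜ[R] omega R n h ξ H Ep) := (hA.small_omega hh hξ H Ep).tmul_right H
  have hw : ∀ {x y : A}, Commute H x → Commute H y →
      Commute (nexp R n (-(h • (H ⊗ₜ[R] H)))) (x ⊗ₜ[R] y) := by
    intro x y hx hy
    rw [← neg_smul]
    exact nexp_HH_commute _ hx hy
  have hv : Commute (nexp R n (H ⊗ₜ[R] omega R n h ξ H Ep)) (H ⊗ₜ[R] (1 : A)) :=
    nexp_tmul_commute n (Commute.refl H) (Commute.one_right _)
  rw [hA.tensor.expAd_eq hs, d.comul_H, mul_add, add_mul, twistQJ]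
  congr 1
  · rw [mul_assoc, (hw (Commute.refl H) (Commute.one_right H)).eq, ← mul_assoc, hv.eq, mul_assoc]
  · rw [mul_assoc, (hw (Commute.one_right H) (Commute.refl H)).eq, mul_assoc _ (nexp R n (-_)),
      ← mul_assoc (nexp R n (-_)), hA.tensor.nexp_neg_mul hs, one_mul, mul_assoc]

/-- On `E₋ ⊗ e^{-hH}` the factor `e^{-h H ⊗ H}` cancels the Cartan part, and `e^{H ⊗ ω}` contributes
`e^{-ω}`. On `1 ⊗ E₋` it creates `e^{hH} ⊗ E₋`, and the conjugation by `e^{H ⊗ ω}` is left as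
`expAd`. -/
theorem twistQJ_comul_Em : twistQJ R n h ξ H Ep * Δ Em =
    (Em ⊗ₜ[R] nexp R n (-omega R n h ξ H Ep) + expAd R n (H ⊗ₜ[R] omega R n h ξ H Ep)
      (nexp R n (h • H) ⊗ₜ[R] Em)) * twistQJ R n h ξ H Ep := by
  have hω := hA.small_omega hh hξ H Ep
  have hs : Small I (H ⊗ₜ[R] omega R n h ξ H Ep) := hω.tmul_right H
  have v1 := hA.nexp_tmul_left hω t.shift_Em
  rw [map_neg, map_one, neg_one_smul] at v1
  have w2 := t.nexp_HH_Em_right hA (neg_mem hh)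
  rw [neg_smul, neg_smul, neg_neg] at w2
  rw [hA.tensor.expAd_eq hs, d.comul_Em, mul_add, add_mul, twistQJ]
  congr 1
  · rw [mul_assoc, t.nexp_neg_HH_left_Em hA hh, ← mul_assoc, v1, mul_assoc]
  · rw [mul_assoc, w2, mul_assoc _ (nexp R n (-(_ ⊗ₜ[R] _))),
      ← mul_assoc (nexp R n (-(_ ⊗ₜ[R] _))), hA.tensor.nexp_neg_mul hs, one_mul, mul_assoc]

/-- Use `ξ E₊ = e^ω e^{-hH} - 1`. The first factor becomes group-like under the twist; the second is
group-like for `Δ`, commutes with `e^{-h H ⊗ H}`, and is conjugated only by `e^{H ⊗ ω}`. -/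
theorem twistQJ_comul_Ep : ξ • (twistQJ R n h ξ H Ep * Δ Ep) =
    ((nexp R n (omega R n h ξ H Ep) ⊗ₜ[R] nexp R n (omega R n h ξ H Ep)) *
      expAd R n (H ⊗ₜ[R] omega R n h ξ H Ep)
        (nexp R n (-(h • H)) ⊗ₜ[R] nexp R n (-(h • H))) - 1 ⊗ₜ[R] 1) *
      twistQJ R n h ξ H Ep := by
  have hω := hA.small_omega hh hξ H Ep
  have hs : Small I (H ⊗ₜ[R] omega R n h ξ H Ep) := hω.tmul_right H
  have hw : Commute (nexp R n (-(h • (H ⊗ₜ[R] H))))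
      (nexp R n (-(h • H)) ⊗ₜ[R] nexp R n (-(h • H))) := by
    rw [← neg_smul, ← neg_smul]
    exact nexp_HH_commute _ (commute_nexp_H _) (commute_nexp_H _)
  have h1 : ξ • Ep = nexp R n (omega R n h ξ H Ep) * nexp R n (-(h • H)) - 1 := by
    rw [hA.nexp_omega hh hξ, mul_assoc, hA.nexp_mul_neg (small_smul hh H), mul_one,
      add_sub_cancel_right]
  have dK : Δ (nexp R n (-(h • H))) = nexp R n (-(h • H)) ⊗ₜ[R] nexp R n (-(h • H)) := by
    rw [← neg_smul, map_nexp, map_smul, d.comul_H, smul_add, TensorProduct.smul_tmul',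
      ← TensorProduct.tmul_smul, hA.nexp_primitive (small_smul (neg_mem hh) _)]
  rw [← mul_smul_comm, ← map_smul, h1, map_sub, map_mul, mul_sub, sub_mul, ← mul_assoc,
    t.twistQJ_comul_nexp_omega hA hh hξ d, dK, map_one, mul_one,
    ← Algebra.TensorProduct.one_def, one_mul, hA.tensor.expAd_eq hs]
  congr 1
  rw [twistQJ]
  simp only [mul_assoc]
  rw [hw.eq, ← mul_assoc (nexp R n (-(_ ⊗ₜ[R] _))) (nexp R n (_ ⊗ₜ[R] _)),
    hA.tensor.nexp_neg_mul hs, one_mul]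

end SlTriple

theorem Killed.isUnit_twistQJ (hA : Killed I n A) (hh : h ∈ I) (hξ : ξ ∈ I) (H Ep : A) :
    IsUnit (twistQJ R n h ξ H Ep) :=
  (hA.tensor.isUnit_nexp ((hA.small_omega hh hξ H Ep).tmul_right H)).mul
    (hA.tensor.isUnit_nexp (small_smul hh _).neg)

theorem Killed.omega_succ (hA : Killed I n A) (hh : h ∈ I) (hξ : ξ ∈ I) (H Ep : A) :
    omega R (n + 1) h ξ H Ep = omega R n h ξ H Ep := by
  rw [omega, nexp_succ (hA.pow (small_smul hh _)), nlog,
    ev_succ _ (hA.pow (hA.small_omega_arg hh hξ H Ep)), omega, nlog]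

theorem uqF_isTwist (I : Ideal R) (h ξ : R) (hh : h ∈ I) (hξ : ξ ∈ I) :
    (uqHopf I h hh).IsTwist (UqF I h ξ hh) where
  compat n := by
    have hA := uq_killed I h hh n
    obtain ⟨h1, h2, -⟩ := uq_tr_gen hh n
    change (Uq I h hh).tr2 n (nexp R (n + 1) _ * nexp R (n + 1) _) = nexp R n _ * nexp R n _
    rw [map_mul, map_nexp, map_nexp, map_neg, map_smul, uq_tr2_tmul, uq_tr2_tmul, map_omega, h1, h2,
      nexp_succ (hA.tensor.pow (small_smul hh _).neg), hA.omega_succ hh hξ,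
      nexp_succ (hA.tensor.pow ((hA.small_omega hh hξ _ _).tmul_right _))]
  isUnit n := (uq_killed I h hh n).isUnit_twistQJ hh hξ _ _
  counit_left n := by
    have hQ : Killed I n ((R ⧸ I ^ n) ⊗[R] (Uq I h hh).obj n) := (quotient_killed I n).tensor
    have h1 : (uqHopf I h hh).ε n (UqH I h hh n) = 0 := (uqCounit_gen hh n).1
    rw [UqF, twistQJ, map_mul, map_nexp, map_nexp, map_neg, map_smul,
      Algebra.TensorProduct.map_tmul, Algebra.TensorProduct.map_tmul, h1, TensorProduct.zero_tmul,
      TensorProduct.zero_tmul, smul_zero, neg_zero, hQ.nexp_zero, one_mul]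
  counit_right n := by
    have hQ' := quotient_killed I n
    have hQ : Killed I n ((Uq I h hh).obj n ⊗[R] (R ⧸ I ^ n)) := (uq_killed I h hh n).tensor
    have h1 : (uqHopf I h hh).ε n (UqH I h hh n) = 0 := (uqCounit_gen hh n).1
    have h2 : (uqHopf I h hh).ε n (UqEp I h hh n) = 0 := (uqCounit_gen hh n).2.1
    rw [UqF, twistQJ, map_mul, map_nexp, map_nexp, map_neg, map_smul,
      Algebra.TensorProduct.map_tmul, Algebra.TensorProduct.map_tmul, map_omega, h1, h2, omega,
      smul_zero, smul_zero, zero_add, one_mul, hQ'.nexp_zero, nlog_one, TensorProduct.tmul_zero,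
      smul_zero, neg_zero, hQ.nexp_zero, one_mul]
  cocycle n := (uq_triple I h hh n).twistQJ_cocycle (uq_killed I h hh n) hh hξ (uq_isQComul hh n)

end JordanTwist

/-! ### The hybrid Hopf algebra and its structure formulas. -/

section Hybrid

variable {R : Type u} [CommRing R] [Algebra ℂ R]

section Formulas

variable {A : Type u} [Ring A] [Algebra R A] {I : Ideal R} {n : ℕ} {h ξ : R}

theorem Killed.inverse_twistQJ (hA : Killed I n A) (hh : h ∈ I) (hξ : ξ ∈ I) (H Ep : A) :
    Ring.inverse (twistQJ R n h ξ H Ep) =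
      nexp R n (h • (H ⊗ₜ[R] H)) * nexp R n (-(H ⊗ₜ[R] omega R n h ξ H Ep)) := by
  have hs : Small I (H ⊗ₜ[R] omega R n h ξ H Ep) := (hA.small_omega hh hξ H Ep).tmul_right H
  have hs2 : Small I (h • (H ⊗ₜ[R] H)) := small_smul hh _
  refine left_inv_eq_right_inv
    (Ring.inverse_mul_cancel _ (hA.isUnit_twistQJ hh hξ H Ep)) ?_
  rw [twistQJ, mul_assoc, ← mul_assoc (nexp R n (-(h • _))), hA.tensor.nexp_neg_mul hs2, one_mul,
    hA.tensor.nexp_mul_neg hs]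

theorem swap_twistQJ (H Ep : A) :
    swap A (twistQJ R n h ξ H Ep) =
      nexp R n (omega R n h ξ H Ep ⊗ₜ[R] H) * nexp R n (-(h • (H ⊗ₜ[R] H))) := by
  rw [twistQJ, map_mul, map_nexp, map_nexp, map_neg, map_smul, swap_tmul, swap_tmul]

theorem Killed.matQJ_eq (hA : Killed I n A) (hh : h ∈ I) (hξ : ξ ∈ I) (H Ep Em : A) :
    matQJ R n h ξ H Ep Em = swap A (twistQJ R n h ξ H Ep) * matQ R n h H Ep Em *
      Ring.inverse (twistQJ R n h ξ H Ep) := by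
  rw [swap_twistQJ, hA.inverse_twistQJ hh hξ, matQJ, ← mul_assoc]

end Formulas

variable (I : Ideal R) (h ξ : R) (hh : h ∈ I) (hξ : ξ ∈ I)

/-- The hybrid quantization of `sl(2)`. -/
def hybridHopf : Hopf (Uq I h hh) :=
  (uqHopf I h hh).twist (UqF I h ξ hh) (uqF_isTwist I h ξ hh hξ) (uqHopf_S_mul hh)

theorem hybridHopf_isTwistOf :
    (hybridHopf I h ξ hh hξ).IsTwistOf (uqHopf I h hh) (UqF I h ξ hh) :=
  Hopf.twist_isTwistOf ..

include hξ in
theorem uqRJ_eq (n : ℕ) : UqRJ I h ξ hh n =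
    swap _ (UqF I h ξ hh n) * UqR I h hh n * Ring.inverse (UqF I h ξ hh n) :=
  (uq_killed I h hh n).matQJ_eq hh hξ _ _ _

theorem hybridHopf_isUniversalR :
    (hybridHopf I h ξ hh hξ).IsUniversalR (UqRJ I h ξ hh) := by
  have e : UqRJ I h ξ hh = fun n =>
      swap _ (UqF I h ξ hh n) * UqR I h hh n * Ring.inverse (UqF I h ξ hh n) :=
    funext fun n => uqRJ_eq I h ξ hh hξ n
  rw [e]
  exact Hopf.twist_isUniversalR _ _ (uqR_isUniversalR I h hh)

variable {I h ξ}

theorem hybridHopf_comul_of_mul {n : ℕ} {x : (Uq I h hh).obj n} {y : (Uq I h hh).T2 n}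
    (e : UqF I h ξ hh n * (uqHopf I h hh).Δ n x = y * UqF I h ξ hh n) :
    (hybridHopf I h ξ hh hξ).Δ n x = y := by
  rw [(hybridHopf_isTwistOf I h ξ hh hξ).comul, e, mul_assoc,
    (uqF_isTwist I h ξ hh hξ).mul_inverse, mul_one]

theorem hybridHopf_comul_H (n : ℕ) : (hybridHopf I h ξ hh hξ).Δ n (UqH I h hh n) =
    UqH I h hh n ⊗ₜ[R] 1 +
      expAd R n (UqH I h hh n ⊗ₜ[R] UqOmega I h ξ hh n) (1 ⊗ₜ[R] UqH I h hh n) :=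
  hybridHopf_comul_of_mul hh hξ
    (SlTriple.twistQJ_comul_H (uq_killed I h hh n) hh hξ (uq_isQComul hh n))

theorem hybridHopf_comul_Ep (n : ℕ) :
    ξ • (hybridHopf I h ξ hh hξ).Δ n (UqEp I h hh n) = UqEpRhs I h ξ hh n := by
  rw [← map_smul]
  refine hybridHopf_comul_of_mul hh hξ ?_
  rw [map_smul, mul_smul_comm]
  exact (uq_triple I h hh n).twistQJ_comul_Ep (uq_killed I h hh n) hh hξ (uq_isQComul hh n)

theorem hybridHopf_comul_Em (n : ℕ) : (hybridHopf I h ξ hh hξ).Δ n (UqEm I h hh n) =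
    UqEm I h hh n ⊗ₜ[R] nexp R n (-UqOmega I h ξ hh n) +
      expAd R n (UqH I h hh n ⊗ₜ[R] UqOmega I h ξ hh n)
        (nexp R n (h • UqH I h hh n) ⊗ₜ[R] UqEm I h hh n) :=
  hybridHopf_comul_of_mul hh hξ
    ((uq_triple I h hh n).twistQJ_comul_Em (uq_killed I h hh n) hh hξ (uq_isQComul hh n))

end Hybrid

/-! ### The boundary `ξ = 0`. -/

section Boundary

variable {R : Type u} [CommRing R]

/-- `a = b` modulo `ξ`. -/
def CongrMod (ξ : R) {M : Type u} [AddCommGroup M] [Module R M] (a b : M) : Prop :=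
  ∃ y, a - b = ξ • y

namespace CongrMod

variable {ξ : R} {M N : Type u} [AddCommGroup M] [Module R M] [AddCommGroup N] [Module R N]
  {A : Type u} [Ring A] [Algebra R A]

theorem refl (a : M) : CongrMod ξ a a := ⟨0, by simp⟩

theorem symm {a b : M} : CongrMod ξ a b → CongrMod ξ b a := by
  rintro ⟨y, hy⟩
  exact ⟨-y, by rw [smul_neg, ← hy, neg_sub]⟩

theorem trans {a b c : M} : CongrMod ξ a b → CongrMod ξ b c → CongrMod ξ a c := by
  rintro ⟨y, hy⟩ ⟨z, hz⟩
  exact ⟨y + z, by rw [smul_add, ← hy, ← hz, sub_add_sub_cancel]⟩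

theorem add {a b c d : M} : CongrMod ξ a b → CongrMod ξ c d → CongrMod ξ (a + c) (b + d) := by
  rintro ⟨y, hy⟩ ⟨z, hz⟩
  exact ⟨y + z, by rw [smul_add, ← hy, ← hz, add_sub_add_comm]⟩

theorem map (f : M →ₗ[R] N) {a b : M} : CongrMod ξ a b → CongrMod ξ (f a) (f b) := by
  rintro ⟨y, hy⟩
  exact ⟨f y, by rw [← map_sub, hy, map_smul]⟩

theorem smul_left (m : M) : CongrMod ξ (ξ • m) 0 := ⟨m, sub_zero _⟩

theorem mul {a b c d : A} (h₁ : CongrMod ξ a b) (h₂ : CongrMod ξ c d) :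
    CongrMod ξ (a * c) (b * d) :=
  (h₁.map (LinearMap.mulRight R c)).trans (h₂.map (LinearMap.mulLeft R b))

theorem pow {a b : A} (h₁ : CongrMod ξ a b) (i : ℕ) : CongrMod ξ (a ^ i) (b ^ i) := by
  induction i with
  | zero => simpa using refl (1 : A)
  | succ i ih => simpa only [pow_succ] using ih.mul h₁

theorem sum {ι : Type*} (s : Finset ι) {f g : ι → M} (hfg : ∀ i ∈ s, CongrMod ξ (f i) (g i)) :
    CongrMod ξ (∑ i ∈ s, f i) (∑ i ∈ s, g i) := by
  classical
  induction s using Finset.induction_on with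
  | empty => simpa using refl (0 : M)
  | insert i s hi ih =>
    rw [Finset.sum_insert hi, Finset.sum_insert hi]
    exact (hfg i (by simp)).add (ih fun j hj => hfg j (by simp [hj]))

variable [Algebra ℂ R]

theorem ev {a b : A} (h₁ : CongrMod ξ a b) (n : ℕ) (p : PowerSeries ℂ) :
    CongrMod ξ (HybridSl2.ev R n p a) (HybridSl2.ev R n p b) :=
  sum _ fun i _ => (h₁.pow i).map (LinearMap.lsmul R A _)

theorem nexp {a b : A} (h₁ : CongrMod ξ a b) (n : ℕ) :
    CongrMod ξ (HybridSl2.nexp R n a) (HybridSl2.nexp R n b) := h₁.ev n _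

theorem nlog {a b : A} (h₁ : CongrMod ξ a b) (n : ℕ) :
    CongrMod ξ (HybridSl2.nlog R n a) (HybridSl2.nlog R n b) := by
  refine CongrMod.ev ?_ n _
  simpa only [sub_eq_add_neg] using h₁.add (refl (-1))

/-- Modulo `ξ` the argument of the logarithm is `e^{hH}`. Hence the two exponentials of the twist
cancel modulo `ξ`. -/
theorem omega {I : Ideal R} {n : ℕ} {h : R} (hA : Killed I n A) (hh : h ∈ I) (H Ep : A) :
    CongrMod ξ (HybridSl2.omega R n h ξ H Ep) (h • H) := by
  have h1 : CongrMod ξ ((ξ • Ep + 1) * HybridSl2.nexp R n (h • H)) (HybridSl2.nexp R n (h • H)) := by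
    simpa using (((smul_left Ep).add (refl (1 : A))).mul (refl (HybridSl2.nexp R n (h • H))))
  have h2 := h1.nlog n
  rwa [nlog_nexp (hA.pow (small_smul hh H))] at h2

theorem twistQJ {I : Ideal R} {n : ℕ} {h : R} (hA : Killed I n A) (hh : h ∈ I) (H Ep : A) :
    CongrMod ξ (HybridSl2.twistQJ R n h ξ H Ep) 1 := by
  have h1 := (((omega (ξ := ξ) hA hh H Ep).map (TensorProduct.mk R A A H)).nexp n).mul
    (refl (HybridSl2.nexp R n (-(h • (H ⊗ₜ[R] H)))))
  simp only [map_smul, TensorProduct.mk_apply,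
    hA.tensor.nexp_mul_neg (small_smul hh (H ⊗ₜ[R] H))] at h1
  exact h1

omit [Algebra ℂ R] in
theorem inverse {a : A} (ha : IsUnit a) (h₁ : CongrMod ξ a 1) : CongrMod ξ (Ring.inverse a) 1 := by
  have h2 := (refl (Ring.inverse a)).mul h₁.symm
  rwa [Ring.inverse_mul_cancel _ ha, mul_one] at h2

end CongrMod

variable [Algebra ℂ R] (I : Ideal R) (h ξ : R) (hh : h ∈ I) (hξ : ξ ∈ I) (n : ℕ)

theorem uqF_congr : CongrMod ξ (UqF I h ξ hh n) 1 := CongrMod.twistQJ (uq_killed I h hh n) hh _ _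

include hξ in
theorem uqF_inverse_congr : CongrMod ξ (Ring.inverse (UqF I h ξ hh n)) 1 :=
  (uqF_congr I h ξ hh n).inverse ((uqF_isTwist I h ξ hh hξ).isUnit n)

theorem hybridHopf_comul_congr (x : (Uq I h hh).obj n) :
    CongrMod ξ ((hybridHopf I h ξ hh hξ).Δ n x) ((uqHopf I h hh).Δ n x) := by
  rw [(hybridHopf_isTwistOf I h ξ hh hξ).comul]
  simpa using ((uqF_congr I h ξ hh n).mul (CongrMod.refl ((uqHopf I h hh).Δ n x))).mul
    (uqF_inverse_congr I h ξ hh hξ n)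

theorem hybridHopf_antipode_congr (x : (Uq I h hh).obj n) :
    CongrMod ξ ((hybridHopf I h ξ hh hξ).S n x) ((uqHopf I h hh).S n x) := by
  have h1 : (hybridHopf I h ξ hh hξ).S n x =
      mulSRight ((uqHopf I h hh).S n) (UqF I h ξ hh n) * (uqHopf I h hh).S n x *
        mulSLeft ((uqHopf I h hh).S n) (Ring.inverse (UqF I h ξ hh n)) := rfl
  have h2 := (uqF_congr I h ξ hh n).map (mulSRight ((uqHopf I h hh).S n))
  have h3 := (uqF_inverse_congr I h ξ hh hξ n).map (mulSLeft ((uqHopf I h hh).S n))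
  have h4 : mulSRight ((uqHopf I h hh).S n) 1 = 1 := by
    simp [mulSRight, Algebra.TensorProduct.one_def, Hopf.S_one]
  have h5 : mulSLeft ((uqHopf I h hh).S n) 1 = 1 := by
    simp [mulSLeft, Algebra.TensorProduct.one_def, Hopf.S_one]
  rw [h4] at h2
  rw [h5] at h3
  rw [h1]
  simpa using (h2.mul (CongrMod.refl ((uqHopf I h hh).S n x))).mul h3

include hξ in
theorem uqRJ_congr : CongrMod ξ (UqRJ I h ξ hh n) (UqR I h hh n) := by
  rw [uqRJ_eq I h ξ hh hξ]
  have h1 := (uqF_congr I h ξ hh n).map (swap _).toLinearMap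
  simp only [AlgHom.toLinearMap_apply, map_one] at h1
  simpa using (h1.mul (CongrMod.refl (UqR I h hh n))).mul (uqF_inverse_congr I h ξ hh hξ n)

end Boundary

/-! ### A monomial basis, and uniqueness of division by `ξ`. -/

section PBW

open Polynomial

variable {R : Type u} [CommRing R] [Algebra ℂ R]

theorem qbracket_intertwine {A : Type u} [Ring A] [Algebra R A] {a b x : A} (e : a * x = x * b)
    (n : ℕ) (h : R) : qbracket R n h a * x = x * qbracket R n h b := by
  have h1 : ∀ i : ℕ, a ^ i * x = x * b ^ i := by
    intro i
    induction i with
    | zero => simp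
    | succ i ih => rw [pow_succ, mul_assoc, e, ← mul_assoc, ih, mul_assoc, ← pow_succ]
  simp only [qbracket, smul_mul_assoc, mul_smul_comm, Finset.sum_mul, Finset.mul_sum, h1]

omit [Algebra ℂ R] in
theorem aeval_intertwine {A : Type u} [Ring A] [Algebra R A] {a b x : A} (e : a * x = x * b)
    (f : R[X]) : aeval a f * x = x * aeval b f := by
  induction f using Polynomial.induction_on' with
  | add p q hp hq => rw [map_add, map_add, add_mul, mul_add, hp, hq]
  | monomial i r =>
    rw [aeval_monomial, aeval_monomial, ← Algebra.smul_def, ← Algebra.smul_def, smul_mul_assoc,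
      mul_smul_comm]
    congr 1
    induction i with
    | zero => simp
    | succ i ih => rw [pow_succ, mul_assoc, e, ← mul_assoc, ih, mul_assoc, ← pow_succ]

section Operators

variable (S : Type u) [CommRing S] [Algebra R S] (n : ℕ) (h : R)

/-- Normally ordered expressions `∑ E₋ ^ a f(H) E₊ ^ c`. -/
abbrev PbwSpace (S : Type u) [CommRing S] : Type u := (ℕ × ℕ) →₀ S[X]

/-- `[E₊, E₋ ^ a] = E₋ ^ (a - 1) f(H)` for this polynomial `f`. -/
def pbwCommutator (a : ℕ) : S[X] := ∑ j ∈ Finset.range a, qbracket R n h (X - (j : S[X]))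

variable (R) in
/-- `f(X) ↦ f(X - 1)`. -/
def pbwShift : S[X] →ₐ[R] S[X] := (aeval (X - 1 : S[X])).restrictScalars R

variable (R) in
/-- The action of `H` on normally ordered expressions. -/
def pbwH : Module.End R (PbwSpace S) :=
  Finsupp.lsum R fun p => Finsupp.lsingle p ∘ₗ LinearMap.mulLeft R (X - (p.1 : S[X]))

variable (R) in
/-- The action of `E₋` on normally ordered expressions. -/
def pbwEm : Module.End R (PbwSpace S) := Finsupp.lsum R fun p => Finsupp.lsingle (p.1 + 1, p.2)

/-- The action of `E₊` on normally ordered expressions. -/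
def pbwEp : Module.End R (PbwSpace S) :=
  Finsupp.lsum R fun p => Finsupp.lsingle (p.1, p.2 + 1) ∘ₗ (pbwShift R S).toLinearMap +
    Finsupp.lsingle (p.1 - 1, p.2) ∘ₗ LinearMap.mulLeft R (pbwCommutator S n h p.1)

variable {S}

omit [Algebra ℂ R] in
theorem pbwH_single (a c : ℕ) (f : S[X]) :
    pbwH R S (Finsupp.single (a, c) f) = Finsupp.single (a, c) ((X - (a : S[X])) * f) := by
  simp [pbwH]

omit [Algebra ℂ R] in
theorem pbwEm_single (a c : ℕ) (f : S[X]) :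
    pbwEm R S (Finsupp.single (a, c) f) = Finsupp.single (a + 1, c) f := by
  simp [pbwEm]

theorem pbwEp_single (a c : ℕ) (f : S[X]) :
    pbwEp S n h (Finsupp.single (a, c) f) = Finsupp.single (a, c + 1) (pbwShift R S f) +
      Finsupp.single (a - 1, c) (pbwCommutator S n h a * f) := by
  simp [pbwEp]

omit [Algebra ℂ R] in
theorem pbwH_pow_single (i a c : ℕ) (f : S[X]) :
    (pbwH R S ^ i) (Finsupp.single (a, c) f) =
      Finsupp.single (a, c) ((X - (a : S[X])) ^ i * f) := by
  induction i with
  | zero => simp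
  | succ i ih => rw [pow_succ', Module.End.mul_apply, ih, pbwH_single, pow_succ', mul_assoc]

theorem qbracket_pbwH_single (a c : ℕ) (f : S[X]) :
    qbracket R n h (pbwH R S) (Finsupp.single (a, c) f) =
      Finsupp.single (a, c) (qbracket R n h (X - (a : S[X])) * f) := by
  simp only [qbracket, LinearMap.smul_apply, LinearMap.sum_apply, pbwH_pow_single, smul_mul_assoc,
    Finset.sum_mul, Finsupp.smul_single]
  rw [← Finsupp.smul_single]
  exact congrArg _ (map_sum (Finsupp.singleAddHom (a, c)) _ _).symm

/-- Makes the truncated `a - 1` in `pbwEp` harmless at `a = 0`. -/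
theorem pbwCommutator_zero : pbwCommutator S n h 0 = 0 := by simp [pbwCommutator]

theorem pbwCommutator_succ (a : ℕ) : pbwCommutator S n h (a + 1) =
    pbwCommutator S n h a + qbracket R n h (X - (a : S[X])) := Finset.sum_range_succ _ _

omit [Algebra ℂ R] in
theorem pbwShift_X_sub (a : ℕ) : pbwShift R S (X - (a : S[X])) = X - 1 - (a : S[X]) := by
  simp [pbwShift]

/-- The operators imitate left multiplication on `E₋ ^ a f(H) E₊ ^ c`. That they satisfy the
relations gives a representation in which the monomials can be told apart. -/
theorem pbw_triple : SlTriple n h (pbwH R S) (pbwEp S n h) (pbwEm R S) where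
  H_Ep := by
    refine Finsupp.lhom_ext fun ⟨a, c⟩ f => ?_
    simp only [LinearMap.sub_apply, Module.End.mul_apply, pbwH_single, pbwEp_single, map_add,
      map_mul, pbwShift_X_sub]
    rcases a with _ | a
    · simp only [pbwCommutator_zero, zero_mul, mul_zero, Finsupp.single_zero, add_zero,
        ← Finsupp.single_sub]
      congr 1
      ring
    · rw [add_sub_add_comm, ← Finsupp.single_sub, ← Finsupp.single_sub]
      congr 2
      · ring
      · push_cast [Nat.add_sub_cancel]
        ring
  H_Em := by
    refine Finsupp.lhom_ext fun ⟨a, c⟩ f => ?_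
    simp only [LinearMap.sub_apply, LinearMap.neg_apply, Module.End.mul_apply, pbwH_single,
      pbwEm_single, ← Finsupp.single_sub, ← Finsupp.single_neg]
    congr 1
    push_cast
    ring
  Ep_Em := by
    refine Finsupp.lhom_ext fun ⟨a, c⟩ f => ?_
    simp only [LinearMap.sub_apply, Module.End.mul_apply, pbwEm_single, pbwEp_single, map_add,
      qbracket_pbwH_single, pbwCommutator_succ, Nat.add_sub_cancel]
    rcases a with _ | a
    · simp [pbwCommutator_zero]
    · simp only [Nat.add_sub_cancel, add_mul, Finsupp.single_add]
      abel

theorem pbwEp_pow_single (c : ℕ) :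
    (pbwEp S n h ^ c) (Finsupp.single (0, 0) 1) = Finsupp.single (0, c) 1 := by
  induction c with
  | zero => simp
  | succ c ih =>
    rw [pow_succ', Module.End.mul_apply, ih, pbwEp_single, pbwCommutator_zero]
    simp

omit [Algebra ℂ R] in
theorem pbwEm_pow_single (i a c : ℕ) (f : S[X]) :
    (pbwEm R S ^ i) (Finsupp.single (a, c) f) = Finsupp.single (a + i, c) f := by
  induction i with
  | zero => simp
  | succ i ih => rw [pow_succ', Module.End.mul_apply, ih, pbwEm_single, add_assoc]

end Operators

namespace SlTriple

variable {A : Type u} [Ring A] [Algebra R A] {n : ℕ} {h : R} {H Ep Em : A}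
  (t : SlTriple n h H Ep Em)
include t

theorem H_mul_Em_pow (a : ℕ) : H * Em ^ a = Em ^ a * (H - (a : A)) := by
  have e := t.H_Em
  rw [sub_eq_iff_eq_add] at e
  induction a with
  | zero => simp
  | succ a ih =>
    rw [pow_succ, ← mul_assoc, ih, mul_assoc, sub_mul, e, mul_assoc, mul_sub Em, (Nat.cast_commute a Em).eq]
    congr 1
    push_cast
    simp only [mul_add, mul_one]
    abel

theorem Ep_mul_H : Ep * H = (H - 1) * Ep := by
  rw [sub_mul, one_mul, eq_sub_iff_add_eq]
  nth_rewrite 2 [← t.H_Ep]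
  abel

theorem Ep_mul_Em_pow (a : ℕ) :
    Ep * Em ^ a = Em ^ a * Ep + Em ^ (a - 1) * aeval H (pbwCommutator R n h a) := by
  induction a with
  | zero => simp [pbwCommutator_zero]
  | succ a ih =>
    have e := t.Ep_Em
    rw [sub_eq_iff_eq_add] at e
    have e1 : Em * (Em ^ (a - 1) * aeval H (pbwCommutator R n h a)) =
        Em ^ a * aeval H (pbwCommutator R n h a) := by
      rcases a with _ | a
      · simp [pbwCommutator_zero]
      · rw [← mul_assoc, ← pow_succ', Nat.add_sub_cancel]
    rw [pow_succ', ← mul_assoc, e, add_mul, mul_assoc, ih, mul_add, e1,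
      qbracket_intertwine (t.H_mul_Em_pow a), pbwCommutator_succ, map_add, map_qbracket,
      Nat.add_sub_cancel, mul_add]
    simp only [map_sub, aeval_X, map_natCast, ← mul_assoc, ← pow_succ']
    abel

end SlTriple

section Span

variable {A : Type u} [Ring A] [Algebra R A] (n : ℕ) (h : R) (H Ep Em : A)

/-- The value `∑ E₋ ^ a f(H) E₊ ^ c` of a normally ordered expression. -/
def pbwEval : PbwSpace R →ₗ[R] A :=
  Finsupp.lsum R fun p => LinearMap.mulLeft R (Em ^ p.1) ∘ₗ LinearMap.mulRight R (Ep ^ p.2) ∘ₗ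
    (aeval H).toLinearMap

omit [Algebra ℂ R] in
theorem pbwEval_single (a c : ℕ) (f : R[X]) :
    pbwEval H Ep Em (Finsupp.single (a, c) f) = Em ^ a * (aeval H f * Ep ^ c) := by
  simp [pbwEval]

variable {n h H Ep Em} (t : SlTriple n h H Ep Em)
include t

theorem SlTriple.H_mul_pbwEval (v : PbwSpace R) :
    H * pbwEval H Ep Em v = pbwEval H Ep Em (pbwH R R v) := by
  suffices LinearMap.mulLeft R H ∘ₗ pbwEval H Ep Em = pbwEval H Ep Em ∘ₗ pbwH R R from
    LinearMap.congr_fun this v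
  refine Finsupp.lhom_ext fun ⟨a, c⟩ f => ?_
  simp only [LinearMap.comp_apply, LinearMap.mulLeft_apply, pbwEval_single, pbwH_single,
    ← mul_assoc, t.H_mul_Em_pow, map_mul, map_sub, aeval_X, map_natCast]

theorem SlTriple.Ep_mul_pbwEval (v : PbwSpace R) :
    Ep * pbwEval H Ep Em v = pbwEval H Ep Em (pbwEp R n h v) := by
  suffices LinearMap.mulLeft R Ep ∘ₗ pbwEval H Ep Em = pbwEval H Ep Em ∘ₗ pbwEp R n h from
    LinearMap.congr_fun this v
  refine Finsupp.lhom_ext fun ⟨a, c⟩ f => ?_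
  have e : Ep * aeval H f = aeval H (pbwShift R R f) * Ep := by
    have h1 : aeval H (pbwShift R R f) = aeval (H - 1) f := by
      have : (aeval H).comp (pbwShift R R) = aeval (R := R) (H - 1) := by
        ext; simp [pbwShift]
      exact AlgHom.congr_fun this f
    rw [h1, aeval_intertwine t.Ep_mul_H.symm]
  simp only [LinearMap.comp_apply, LinearMap.mulLeft_apply, pbwEval_single, pbwEp_single, map_add]
  rw [← mul_assoc, t.Ep_mul_Em_pow, add_mul, map_mul, mul_assoc, ← mul_assoc Ep, e, pow_succ']
  simp only [mul_assoc]

omit t [Algebra ℂ R] in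
theorem Em_mul_pbwEval (v : PbwSpace R) :
    Em * pbwEval H Ep Em v = pbwEval H Ep Em (pbwEm R R v) := by
  suffices LinearMap.mulLeft R Em ∘ₗ pbwEval H Ep Em = pbwEval H Ep Em ∘ₗ pbwEm R R from
    LinearMap.congr_fun this v
  refine Finsupp.lhom_ext fun ⟨a, c⟩ f => ?_
  simp only [LinearMap.comp_apply, LinearMap.mulLeft_apply, pbwEval_single, pbwEm_single,
    pow_succ', mul_assoc]

end Span

section Torsion

variable {I : Ideal R} {h : R} (hh : h ∈ I) (n : ℕ)

/-- The image of `pbwEval` is stable under left multiplication by the generators and contains `1`.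
-/
theorem pbwEval_surjective :
    Function.Surjective (pbwEval (R := R) (UqH I h hh n) (UqEp I h hh n) (UqEm I h hh n)) := by
  have t := uq_triple I h hh n
  suffices ∀ x : (Uq I h hh).obj n, ∀ v, ∃ w,
      pbwEval (R := R) (UqH I h hh n) (UqEp I h hh n) (UqEm I h hh n) w =
        x * pbwEval (R := R) (UqH I h hh n) (UqEp I h hh n) (UqEm I h hh n) v by
    intro x
    obtain ⟨w, hw⟩ := this x (Finsupp.single (0, 0) 1)
    refine ⟨w, ?_⟩
    rw [hw, pbwEval_single]
    simp
  intro x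
  induction x using uq_induction with
  | hr r => exact fun v => ⟨r • v, by rw [map_smul, Algebra.smul_def]⟩
  | hH => exact fun v => ⟨_, (t.H_mul_pbwEval v).symm⟩
  | hEp => exact fun v => ⟨_, (t.Ep_mul_pbwEval v).symm⟩
  | hEm => exact fun v => ⟨_, (Em_mul_pbwEval v).symm⟩
  | hadd x y hx hy =>
    intro v
    obtain ⟨w₁, h₁⟩ := hx v
    obtain ⟨w₂, h₂⟩ := hy v
    exact ⟨w₁ + w₂, by rw [map_add, h₁, h₂, add_mul]⟩
  | hmul x y hx hy =>
    intro v
    obtain ⟨w₁, h₁⟩ := hy v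
    obtain ⟨w₂, h₂⟩ := hx w₁
    exact ⟨w₂, by rw [h₂, h₁, mul_assoc]⟩

/-- The monomial `E₋ ^ a H ^ b E₊ ^ c`. -/
def pbwMonomial (p : (ℕ × ℕ) × ℕ) : (Uq I h hh).obj n :=
  UqEm I h hh n ^ p.1.1 * (UqH I h hh n ^ p.2 * UqEp I h hh n ^ p.1.2)

theorem span_pbwMonomial : Submodule.span R (Set.range (pbwMonomial hh n)) = ⊤ := by
  rw [eq_top_iff]
  intro x _
  obtain ⟨v, rfl⟩ := pbwEval_surjective hh n x
  induction v using Finsupp.induction_linear with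
  | zero => simp
  | add v w hv hw => rw [map_add]; exact add_mem (hv trivial) (hw trivial)
  | single p f =>
    induction f using Polynomial.induction_on' with
    | add f g hf hg => rw [Finsupp.single_add, map_add]; exact add_mem (hf trivial) (hg trivial)
    | monomial b r =>
      obtain ⟨a, c⟩ := p
      rw [pbwEval_single, aeval_monomial, ← Algebra.smul_def, smul_mul_assoc, mul_smul_comm]
      exact Submodule.smul_mem _ _ (Submodule.subset_span ⟨((a, c), b), rfl⟩)

omit [Algebra ℂ R] in
theorem pbw_killed : Killed I n (Module.End R (PbwSpace (R ⧸ I ^ n))) := by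
  intro c hc x
  refine LinearMap.ext fun v => Finsupp.ext fun p => Polynomial.ext fun i => ?_
  simpa using quotient_killed I n c hc ((x v p).coeff i)

/-- The representation of `U_q(sl(2))` on normally ordered expressions. -/
def pbwRep : (Uq I h hh).obj n →ₐ[R] Module.End R (PbwSpace (R ⧸ I ^ n)) :=
  uqLift hh (pbw_killed n) (pbw_triple n h)

/-- The coefficient of a monomial. -/
def pbwCoord (p : (ℕ × ℕ) × ℕ) : (Uq I h hh).obj n →ₗ[R] R ⧸ I ^ n :=
  (Polynomial.lcoeff (R ⧸ I ^ n) p.2).restrictScalars R ∘ₗ Finsupp.lapply p.1 ∘ₗ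
    LinearMap.applyₗ (Finsupp.single (0, 0) 1) ∘ₗ (pbwRep hh n).toLinearMap

/-- Applied to the vector `Finsupp.single (0, 0) 1`, the monomial `E₋ ^ a H ^ b E₊ ^ c` gives `X ^
b` at position `(a, c)`. So the coordinates are dual to the spanning monomials. -/
theorem pbwCoord_pbwMonomial (p q : (ℕ × ℕ) × ℕ) :
    pbwCoord hh n p (pbwMonomial hh n q) = if q = p then 1 else 0 := by
  obtain ⟨h1, h2, h3⟩ := uqLift_gen hh (pbw_killed n) (pbw_triple (S := R ⧸ I ^ n) n h)
  have e : pbwRep hh n (pbwMonomial hh n q) (Finsupp.single (0, 0) 1) =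
      Finsupp.single q.1 (X ^ q.2) := by
    rw [pbwMonomial, pbwRep, map_mul, map_mul, map_pow, map_pow, map_pow, h1, h2, h3,
      Module.End.mul_apply, Module.End.mul_apply, pbwEp_pow_single, pbwH_pow_single,
      pbwEm_pow_single]
    simp
  simp only [pbwCoord, LinearMap.comp_apply, AlgHom.toLinearMap_apply, LinearMap.applyₗ_apply_apply,
    e, Finsupp.lapply_apply, LinearMap.restrictScalars_apply, Polynomial.lcoeff_apply]
  obtain ⟨p1, p2⟩ := p
  obtain ⟨q1, q2⟩ := q
  by_cases hp : q1 = p1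
  · subst hp
    simp [Polynomial.coeff_X_pow, eq_comm]
  · simp [hp]

/-- Expand `y` in products of monomials. The dual coordinates show that `ξ` times each coefficient
lies in `I ^ (n + 1)`, so each coefficient lies in `I ^ n` and acts as zero one level down. -/
theorem tr2_eq_zero_of_smul_eq_zero {ξ : R}
    (hξ : ∀ c : R, ξ * c ∈ I ^ (n + 1) → c ∈ I ^ n) (y : (Uq I h hh).T2 (n + 1))
    (hy : ξ • y = 0) : (Uq I h hh).tr2 n y = 0 := by
  have h1 : y ∈ Submodule.span R (Set.range fun p : ((ℕ × ℕ) × ℕ) × ((ℕ × ℕ) × ℕ) =>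
      pbwMonomial hh (n + 1) p.1 ⊗ₜ[R] pbwMonomial hh (n + 1) p.2) := by
    have h2 := TensorProduct.map₂_mk_top_top_eq_top R ((Uq I h hh).obj (n + 1))
      ((Uq I h hh).obj (n + 1))
    rw [← span_pbwMonomial hh (n + 1), Submodule.map₂_span_span, Set.image2_range] at h2
    have h3 : y ∈ (⊤ : Submodule R _) := trivial
    rw [← h2] at h3
    exact h3
  obtain ⟨c, rfl⟩ := (Finsupp.mem_span_range_iff_exists_finsupp).1 h1
  have hc : ∀ p, c p ∈ I ^ n := by
    intro p
    have h2 := congrArg (LinearMap.mul' R (R ⧸ I ^ (n + 1)) ∘ₗ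
      TensorProduct.map (pbwCoord hh (n + 1) p.1) (pbwCoord hh (n + 1) p.2)) hy
    rw [map_smul, Finsupp.sum, map_sum, map_zero, Finset.sum_eq_single p] at h2
    · simp only [map_smul, LinearMap.comp_apply, TensorProduct.map_tmul, pbwCoord_pbwMonomial,
        LinearMap.mul'_apply, if_true, mul_one, smul_smul] at h2
      refine hξ _ (Ideal.Quotient.eq_zero_iff_mem.1 ?_)
      rw [Algebra.smul_def, mul_one] at h2
      exact h2
    · intro q _ hq
      have : ¬ (q.1 = p.1 ∧ q.2 = p.2) := fun e => hq (Prod.ext e.1 e.2)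
      simp only [map_smul, LinearMap.comp_apply, TensorProduct.map_tmul, pbwCoord_pbwMonomial,
        LinearMap.mul'_apply]
      by_cases e : q.1 = p.1
      · rw [if_neg (fun e' => this ⟨e, e'⟩), mul_zero, smul_zero]
      · rw [if_neg e, zero_mul, smul_zero]
    · intro hp
      rw [Finsupp.notMem_support_iff.1 hp, zero_smul, map_zero]
  rw [Finsupp.sum, map_sum]
  refine Finset.sum_eq_zero fun p _ => ?_
  rw [map_smul]
  exact (uq_killed I h hh n).tensor _ (hc p) _

end Torsion

theorem hybridHopf_isHybrid (I : Ideal R) (h ξ : R) (hh : h ∈ I) (hξ : ξ ∈ I) :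
    IsHybrid ξ (hybridHopf I h ξ hh hξ) where
  comul_H := hybridHopf_comul_H hh hξ
  comul_Ep := hybridHopf_comul_Ep hh hξ
  comul_Em := hybridHopf_comul_Em hh hξ
  comul_Ep_unique hreg x hx hx' n := by
    -- Cancelling `ξ` costs one level, so the comparison is made at `n + 1` and then pushed down to
    -- `n`.
    have h1 := tr2_eq_zero_of_smul_eq_zero hh n (hreg n)
      (x (n + 1) - (hybridHopf I h ξ hh hξ).Δ (n + 1) (UqEp I h hh (n + 1)))
      (by rw [smul_sub, hx', hybridHopf_comul_Ep, sub_self])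
    rwa [map_sub, hx n, (hybridHopf I h ξ hh hξ).Δ_tr, (uq_tr_gen hh n).2.1, sub_eq_zero] at h1

end PBW

/-! ### Hopf structures, twists and R-matrices on the quotient by `h`. -/

section Descent

variable {R : Type u} [CommRing R]

section Lift

variable {M N P : Type u} [AddCommGroup M] [Module R M] [AddCommGroup N] [Module R N]
  [AddCommGroup P] [Module R P]

theorem apply_surjInv {f : M →ₗ[R] N} (hf : Function.Surjective f) {g : M →ₗ[R] P}
    (hg : ∀ x, f x = 0 → g x = 0) (x : M) : g (Function.surjInv hf (f x)) = g x := by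
  rw [← sub_eq_zero, ← map_sub]
  exact hg _ (by rw [map_sub, Function.surjInv_eq hf, sub_self])

/-- The linear map that factors `g` through the surjection `f`. -/
def liftSurjective (f : M →ₗ[R] N) (hf : Function.Surjective f) (g : M →ₗ[R] P)
    (hg : ∀ x, f x = 0 → g x = 0) : N →ₗ[R] P where
  toFun y := g (Function.surjInv hf y)
  map_add' y z := by
    obtain ⟨y, rfl⟩ := hf y
    obtain ⟨z, rfl⟩ := hf z
    rw [← map_add, apply_surjInv hf hg, apply_surjInv hf hg, apply_surjInv hf hg, map_add]
  map_smul' r y := by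
    obtain ⟨y, rfl⟩ := hf y
    rw [← map_smul, apply_surjInv hf hg, apply_surjInv hf hg, map_smul, RingHom.id_apply]

theorem liftSurjective_apply {f : M →ₗ[R] N} (hf : Function.Surjective f) {g : M →ₗ[R] P}
    (hg : ∀ x, f x = 0 → g x = 0) (x : M) : liftSurjective f hf g hg (f x) = g x :=
  apply_surjInv hf hg x

variable {A B C : Type u} [Ring A] [Algebra R A] [Ring B] [Algebra R B] [Ring C] [Algebra R C]

/-- The algebra map that factors `g` through the surjection `f`. -/
def algLiftSurjective (f : A →ₐ[R] B) (hf : Function.Surjective f) (g : A →ₐ[R] C)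
    (hg : ∀ x, f x = 0 → g x = 0) : B →ₐ[R] C :=
  AlgHom.ofLinearMap (liftSurjective f.toLinearMap hf g.toLinearMap hg)
    (by
      have := liftSurjective_apply (f := f.toLinearMap) hf (g := g.toLinearMap) hg 1
      simpa using this)
    (by
      intro x y
      obtain ⟨x, rfl⟩ := hf x
      obtain ⟨y, rfl⟩ := hf y
      have := liftSurjective_apply (f := f.toLinearMap) hf (g := g.toLinearMap) hg
      simp only [AlgHom.toLinearMap_apply] at this
      rw [← map_mul, this, this, this, map_mul])

theorem algLiftSurjective_apply {f : A →ₐ[R] B} (hf : Function.Surjective f) {g : A →ₐ[R] C}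
    (hg : ∀ x, f x = 0 → g x = 0) (x : A) : algLiftSurjective f hf g hg (f x) = g x :=
  liftSurjective_apply (f := f.toLinearMap) hf (g := g.toLinearMap) hg x

end Lift

section Square

variable {A B : Type u} [Ring A] [Algebra R A] [Ring B] [Algebra R B]

/-- `f ⊗ f`. -/
abbrev map2 (f : A →ₐ[R] B) : A ⊗[R] A →ₐ[R] B ⊗[R] B := Algebra.TensorProduct.map f f

/-- `f ⊗ f ⊗ f`. -/
abbrev map3 (f : A →ₐ[R] B) : (A ⊗[R] A) ⊗[R] A →ₐ[R] (B ⊗[R] B) ⊗[R] B :=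
  Algebra.TensorProduct.map (map2 f) f

variable (f : A →ₐ[R] B)

theorem map3_leg12 (z : A ⊗[R] A) : map3 f (leg12 A z) = leg12 B (map2 f z) := by
  simp

theorem map3_leg13 (z : A ⊗[R] A) : map3 f (leg13 A z) = leg13 B (map2 f z) := by
  induction z using TensorProduct.induction_on with
  | zero => simp
  | tmul a b => simp
  | add x y hx hy => simp only [map_add, hx, hy]

theorem map3_leg23 (z : A ⊗[R] A) : map3 f (leg23 A z) = leg23 B (map2 f z) := by
  induction z using TensorProduct.induction_on with
  | zero => simp
  | tmul a b => simp
  | add x y hx hy => simp only [map_add, hx, hy]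

theorem map2_swap (z : A ⊗[R] A) : map2 f (swap A z) = swap B (map2 f z) := by
  induction z using TensorProduct.induction_on with
  | zero => simp
  | tmul a b => simp
  | add x y hx hy => simp only [map_add, hx, hy]

variable {f} {Δ : A →ₐ[R] A ⊗[R] A} {Δ' : B →ₐ[R] B ⊗[R] B} (hΔ : ∀ x, Δ' (f x) = map2 f (Δ x))
include hΔ

theorem comulLeft_map2 (z : A ⊗[R] A) : comulLeft Δ' (map2 f z) = map3 f (comulLeft Δ z) := by
  induction z using TensorProduct.induction_on with
  | zero => simp
  | tmul a b => simp [hΔ]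
  | add x y hx hy => simp only [map_add, hx, hy]

theorem comulRight_map2 (z : A ⊗[R] A) : comulRight Δ' (map2 f z) = map3 f (comulRight Δ z) := by
  have h1 : ∀ (a : A) (w : A ⊗[R] A),
      assocInv B (f a ⊗ₜ[R] map2 f w) = map3 f (assocInv A (a ⊗ₜ[R] w)) := by
    intro a w
    induction w using TensorProduct.induction_on with
    | zero => simp
    | tmul b c => simp
    | add x y hx hy => simp only [map_add, TensorProduct.tmul_add, hx, hy]
  induction z using TensorProduct.induction_on with
  | zero => simp
  | tmul a b => rw [comulRight_tmul, ← h1, ← hΔ]; simp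
  | add x y hx hy => simp only [map_add, hx, hy]

end Square

theorem map_inverse_of_isUnit {A B : Type u} [Ring A] [Ring B] [Algebra R A] [Algebra R B]
    (f : A →ₐ[R] B) {a : A} (ha : IsUnit a) : f (Ring.inverse a) = Ring.inverse (f a) := by
  refine left_inv_eq_right_inv ?_ (Ring.mul_inverse_cancel _ (ha.map f))
  rw [← map_mul, Ring.inverse_mul_cancel _ ha, map_one]

variable {J J' : ℕ → Ideal R} {T : Tower R J} {T' : Tower R J'} {h : R}

/-- `Φ` identifies `T'` with `T / h T`. -/
structure IsTowerReduction (h : R) (Φ : ∀ n, T.obj n →ₐ[R] T'.obj n) : Prop where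
  compat : ∀ n x, T'.tr n (Φ (n + 1) x) = Φ n (T.tr n x)
  surjective : ∀ n, Function.Surjective (Φ n)
  ker : ∀ n x, Φ n x = 0 ↔ ∃ y, x = h • y
  le : ∀ n, J n ≤ J' n
  mem : ∀ n, h ∈ J' n
  antitone : ∀ n, J' (n + 1) ≤ J' n

theorem tr2_map2 {Φ : ∀ n, T.obj n →ₐ[R] T'.obj n}
    (hc : ∀ n x, T'.tr n (Φ (n + 1) x) = Φ n (T.tr n x)) (n : ℕ) (z : T.T2 (n + 1)) :
    T'.tr2 n (map2 (Φ (n + 1)) z) = map2 (Φ n) (T.tr2 n z) := by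
  induction z using TensorProduct.induction_on with
  | zero => simp
  | tmul a b => simp [Tower.tr2, hc]
  | add x y hx hy => simp only [map_add, hx, hy]

namespace IsTowerReduction

variable {Φ : ∀ n, T.obj n →ₐ[R] T'.obj n} (r : IsTowerReduction h Φ)
include r

theorem smul_eq_zero (n : ℕ) (x : T'.obj n) : h • x = 0 := T'.ann n h (r.mem n) x

theorem smul_eq_zero2 (n : ℕ) (x : T'.T2 n) : h • x = 0 := by
  induction x using TensorProduct.induction_on with
  | zero => simp
  | tmul a b => rw [TensorProduct.smul_tmul', r.smul_eq_zero, TensorProduct.zero_tmul]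
  | add x y hx hy => rw [smul_add, hx, hy, add_zero]

theorem smul_quotient (n : ℕ) (x : R ⧸ J' n) : h • x = 0 := by
  obtain ⟨x, rfl⟩ := Ideal.Quotient.mk_surjective x
  rw [Algebra.smul_def]
  change Ideal.Quotient.mk _ h * _ = 0
  rw [Ideal.Quotient.eq_zero_iff_mem.mpr (r.mem n), zero_mul]

/-- The kernel of `Φ` consists of multiples of `h`, so any linear map into a module killed by `h`
factors through `Φ`. The coproduct, counit and antipode descend for this reason. -/
theorem map_eq_zero {n : ℕ} {M : Type u} [AddCommGroup M] [Module R M] (hM : ∀ m : M, h • m = 0)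
    (g : T.obj n →ₗ[R] M) (x : T.obj n) (hx : Φ n x = 0) : g x = 0 := by
  obtain ⟨y, rfl⟩ := (r.ker n x).1 hx
  rw [map_smul, hM]

/-- The coproduct of the reduction. -/
def comul (A : Hopf T) (n : ℕ) : T'.obj n →ₐ[R] T'.T2 n :=
  algLiftSurjective (Φ n) (r.surjective n) ((map2 (Φ n)).comp (A.Δ n))
    (r.map_eq_zero (r.smul_eq_zero2 n) ((map2 (Φ n)).comp (A.Δ n)).toLinearMap)

/-- The counit of the reduction. -/
def counit (A : Hopf T) (n : ℕ) : T'.obj n →ₐ[R] R ⧸ J' n :=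
  algLiftSurjective (Φ n) (r.surjective n) ((Ideal.Quotient.factorₐ R (r.le n)).comp (A.ε n))
    (r.map_eq_zero (r.smul_quotient n)
      ((Ideal.Quotient.factorₐ R (r.le n)).comp (A.ε n)).toLinearMap)

/-- The antipode of the reduction. -/
def antipode (A : Hopf T) (n : ℕ) : T'.obj n →ₗ[R] T'.obj n :=
  liftSurjective (Φ n).toLinearMap (r.surjective n) ((Φ n).toLinearMap ∘ₗ A.S n)
    (r.map_eq_zero (r.smul_eq_zero n) ((Φ n).toLinearMap ∘ₗ A.S n))

theorem comul_apply (A : Hopf T) (n : ℕ) (x : T.obj n) :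
    r.comul A n (Φ n x) = map2 (Φ n) (A.Δ n x) := algLiftSurjective_apply _ _ x

theorem counit_apply (A : Hopf T) (n : ℕ) (x : T.obj n) :
    r.counit A n (Φ n x) = Ideal.Quotient.factorₐ R (r.le n) (A.ε n x) :=
  algLiftSurjective_apply _ _ x

theorem antipode_apply (A : Hopf T) (n : ℕ) (x : T.obj n) :
    r.antipode A n (Φ n x) = Φ n (A.S n x) :=
  liftSurjective_apply (f := (Φ n).toLinearMap) (r.surjective n)
    (r.map_eq_zero (r.smul_eq_zero n) ((Φ n).toLinearMap ∘ₗ A.S n)) x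

theorem counit_eq (A : Hopf T) {n : ℕ} {x : T.obj n} {c : R}
    (hc : A.ε n x = Ideal.Quotient.mk (J n) c) :
    r.counit A n (Φ n x) = Ideal.Quotient.mk (J' n) c := by
  rw [r.counit_apply, hc]
  rfl

/-- The antipode axioms allow any representative of the counit. Representatives upstairs and
downstairs may differ, but only by an element of `J' n`, which acts as zero. -/
theorem algebraMap_eq_of_counit {A : Hopf T} {n : ℕ} {x : T.obj n} {c c' : R}
    (hc : A.ε n x = Ideal.Quotient.mk (J n) c)
    (hc' : r.counit A n (Φ n x) = Ideal.Quotient.mk (J' n) c') :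
    algebraMap R (T'.obj n) c' = algebraMap R (T'.obj n) c := by
  rw [r.counit_eq A hc] at hc'
  rw [← sub_eq_zero, ← map_sub, Algebra.algebraMap_eq_smul_one]
  exact T'.ann n _ (Ideal.Quotient.eq.1 hc'.symm) 1

/-- The reduction of a Hopf algebra. -/
def hopf (A : Hopf T) : Hopf T' where
  Δ := r.comul A
  ε := r.counit A
  S := r.antipode A
  Δ_tr n x := by
    obtain ⟨x, rfl⟩ := r.surjective _ x
    rw [r.comul_apply, tr2_map2 r.compat, A.Δ_tr, r.compat, r.comul_apply]
  ε_tr n x c hc := by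
    obtain ⟨x, rfl⟩ := r.surjective _ x
    obtain ⟨d, hd⟩ := A.exists_counit _ x
    have h1 := hc
    rw [r.compat, r.counit_eq A (A.ε_tr n x d hd)]
    rw [r.counit_eq A hd] at h1
    exact Ideal.Quotient.eq.2 (r.antitone n (Ideal.Quotient.eq.1 h1))
  S_tr n x := by
    obtain ⟨x, rfl⟩ := r.surjective _ x
    rw [r.antipode_apply, r.compat, A.S_tr, r.compat, r.antipode_apply]
  coassoc n x := by
    obtain ⟨x, rfl⟩ := r.surjective _ x
    change comulLeft (r.comul A n) (r.comul A n (Φ n x)) =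
      comulRight (r.comul A n) (r.comul A n (Φ n x))
    rw [r.comul_apply, comulLeft_map2 (r.comul_apply A n), comulRight_map2 (r.comul_apply A n),
      A.comul_coassoc]
  counit_left n x := by
    obtain ⟨x, rfl⟩ := r.surjective _ x
    rw [r.comul_apply]
    have h1 := congrArg (Algebra.TensorProduct.map (Ideal.Quotient.factorₐ R (r.le n)) (Φ n))
      (A.counit_left n x)
    rw [Algebra.TensorProduct.map_tmul, map_one, ← AlgHom.comp_apply,
      ← Algebra.TensorProduct.map_comp] at h1
    rw [← h1, ← AlgHom.comp_apply, ← Algebra.TensorProduct.map_comp]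
    congr 2
    exact AlgHom.ext fun y => r.counit_apply A n y
  counit_right n x := by
    obtain ⟨x, rfl⟩ := r.surjective _ x
    rw [r.comul_apply]
    have h1 := congrArg (Algebra.TensorProduct.map (Φ n) (Ideal.Quotient.factorₐ R (r.le n)))
      (A.counit_right n x)
    rw [Algebra.TensorProduct.map_tmul, map_one, ← AlgHom.comp_apply,
      ← Algebra.TensorProduct.map_comp] at h1
    rw [← h1, ← AlgHom.comp_apply, ← Algebra.TensorProduct.map_comp]
    congr 2
    exact AlgHom.ext fun y => r.counit_apply A n y
  antipode_left n x c hc := by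
    obtain ⟨x, rfl⟩ := r.surjective _ x
    obtain ⟨d, hd⟩ := A.exists_counit _ x
    rw [r.algebraMap_eq_of_counit hd hc, ← AlgHom.commutes (Φ n), ← A.antipode_left n x d hd,
      r.comul_apply]
    generalize A.Δ n x = z
    induction z using TensorProduct.induction_on with
    | zero => simp
    | tmul a b => simp [r.antipode_apply]
    | add x y hx hy => simp only [map_add, hx, hy]
  antipode_right n x c hc := by
    obtain ⟨x, rfl⟩ := r.surjective _ x
    obtain ⟨d, hd⟩ := A.exists_counit _ x
    rw [r.algebraMap_eq_of_counit hd hc, ← AlgHom.commutes (Φ n), ← A.antipode_right n x d hd,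
      r.comul_apply]
    generalize A.Δ n x = z
    induction z using TensorProduct.induction_on with
    | zero => simp
    | tmul a b => simp [r.antipode_apply]
    | add x y hx hy => simp only [map_add, hx, hy]

theorem hopf_isReduction (A : Hopf T) : IsReduction h A (r.hopf A) Φ where
  compat := r.compat
  surjective := r.surjective
  ker := r.ker
  comul := r.comul_apply A
  counit _ _ _ hc := r.counit_eq A hc
  antipode := r.antipode_apply A

end IsTowerReduction

namespace IsReduction

variable {Φ : ∀ n, T.obj n →ₐ[R] T'.obj n} {A B : Hopf T} {C D : Hopf T'} {F : ∀ n, T.T2 n}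

/-- Apply compatibility with the counit to `x = 0`, with `c ∈ J n` as the representative of its
counit. -/
theorem le (r : IsReduction h A C Φ) (n : ℕ) : J n ≤ J' n := by
  intro c hc
  have h1 := r.counit n 0 c (by rw [map_zero, Ideal.Quotient.eq_zero_iff_mem.2 hc])
  rw [map_zero, map_zero] at h1
  exact Ideal.Quotient.eq_zero_iff_mem.1 h1.symm

theorem counit_comp (r : IsReduction h A C Φ) (n : ℕ) :
    (C.ε n).comp (Φ n) = (Ideal.Quotient.factorₐ R (r.le n)).comp (A.ε n) := by
  refine AlgHom.ext fun x => ?_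
  obtain ⟨c, hc⟩ := A.exists_counit n x
  rw [AlgHom.comp_apply, AlgHom.comp_apply, r.counit n x c hc, hc]
  rfl

theorem isTwist (r : IsReduction h A C Φ) (hF : A.IsTwist F) :
    C.IsTwist fun n => map2 (Φ n) (F n) where
  compat n := by rw [tr2_map2 r.compat, hF.compat]
  isUnit n := (hF.isUnit n).map _
  counit_left n := by
    have h1 := congrArg (Algebra.TensorProduct.map (Ideal.Quotient.factorₐ R (r.le n)) (Φ n))
      (hF.counit_left n)
    rw [map_one, ← AlgHom.comp_apply, ← Algebra.TensorProduct.map_comp, ← r.counit_comp] at h1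
    rw [← h1, ← AlgHom.comp_apply, ← Algebra.TensorProduct.map_comp]
    rfl
  counit_right n := by
    have h1 := congrArg (Algebra.TensorProduct.map (Φ n) (Ideal.Quotient.factorₐ R (r.le n)))
      (hF.counit_right n)
    rw [map_one, ← AlgHom.comp_apply, ← Algebra.TensorProduct.map_comp, ← r.counit_comp] at h1
    rw [← h1, ← AlgHom.comp_apply, ← Algebra.TensorProduct.map_comp]
    rfl
  cocycle n := by
    change leg12 _ _ * comulLeft (C.Δ n) _ = leg23 _ _ * comulRight (C.Δ n) _
    rw [comulLeft_map2 (r.comul n), comulRight_map2 (r.comul n), ← map3_leg12, ← map3_leg23,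
      ← map_mul, ← map_mul, hF.cocycle_eq]

theorem isTwistOf (r : IsReduction h A C Φ) (r' : IsReduction h B D Φ) (hF : ∀ n, IsUnit (F n))
    (hB : B.IsTwistOf A F) : D.IsTwistOf C fun n => map2 (Φ n) (F n) where
  comul n x := by
    obtain ⟨x, rfl⟩ := r.surjective _ x
    rw [r'.comul, r.comul, hB.comul, map_mul, map_mul, map_inverse_of_isUnit _ (hF n)]
  counit n x := by
    obtain ⟨x, rfl⟩ := r.surjective _ x
    obtain ⟨c, hc⟩ := A.exists_counit n x
    rw [r.counit n x c hc, r'.counit n x c (by rw [hB.counit, hc])]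

theorem isUniversalR (r : IsReduction h A C Φ) (hF : A.IsUniversalR F) :
    C.IsUniversalR fun n => map2 (Φ n) (F n) where
  compat n := by rw [tr2_map2 r.compat, hF.compat]
  isUnit n := (hF.isUnit n).map _
  comm n x := by
    obtain ⟨x, rfl⟩ := r.surjective _ x
    rw [r.comul, ← map_mul, hF.comm, map_mul, map2_swap]
  comul_left n := by
    change comulLeft (C.Δ n) _ = _
    rw [comulLeft_map2 (r.comul n), ← map3_leg13, ← map3_leg23, ← map_mul]
    exact congrArg _ (hF.comul_left n)
  comul_right n := by
    change comulRight (C.Δ n) _ = _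
    rw [comulRight_map2 (r.comul n), ← map3_leg13, ← map3_leg12, ← map_mul]
    exact congrArg _ (hF.comul_right n)

end IsReduction

end Descent

/-! ### The Lie algebra `sl(2)` and maps out of it. -/

section Sl

attribute [local instance] LieRing.ofAssociativeRing LieAlgebra.ofAssociativeAlgebra

local notation "sl₂" => LieAlgebra.SpecialLinear.sl (Fin 2) ℂ

theorem slH_Ep : ⁅slH, slEp⁆ = slEp := by
  refine Subtype.ext ?_
  rw [LieAlgebra.SpecialLinear.sl_bracket]
  ext i j
  fin_cases i <;> fin_cases j <;> 
    (simp [slH, slEp, Matrix.mul_apply, Matrix.single]; try norm_num)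

theorem slH_Em : ⁅slH, slEm⁆ = -slEm := by
  refine Subtype.ext ?_
  rw [LieAlgebra.SpecialLinear.sl_bracket]
  ext i j
  fin_cases i <;> fin_cases j <;> 
    (simp [slH, slEm, Matrix.mul_apply, Matrix.single]; try norm_num)

theorem slEp_Em : ⁅slEp, slEm⁆ = (2 : ℂ) • slH := by
  refine Subtype.ext ?_
  rw [LieAlgebra.SpecialLinear.sl_bracket]
  ext i j
  fin_cases i <;> fin_cases j <;> simp [slH, slEp, slEm, Matrix.mul_apply, Matrix.single]

theorem sl_eq (x : sl₂) : x = (2 * x.1 0 0) • slH + x.1 0 1 • slEp + x.1 1 0 • slEm := by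
  have h0 : x.1 1 1 = -x.1 0 0 := by
    have h1 : Matrix.trace x.1 = 0 := x.2
    rw [Matrix.trace_fin_two] at h1
    linear_combination h1
  refine Subtype.ext ?_
  ext i j
  fin_cases i <;> fin_cases j <;> 
    simp [slH, slEp, slEm, Matrix.single, h0, mul_right_comm]

theorem sl_bracket_apply (x y : sl₂) :
    (⁅x, y⁆ : sl₂).1 0 0 = x.1 0 1 * y.1 1 0 - y.1 0 1 * x.1 1 0 ∧
    (⁅x, y⁆ : sl₂).1 0 1 = 2 * x.1 0 0 * y.1 0 1 - 2 * y.1 0 0 * x.1 0 1 ∧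
    (⁅x, y⁆ : sl₂).1 1 0 = 2 * y.1 0 0 * x.1 1 0 - 2 * x.1 0 0 * y.1 1 0 := by
  have h0 : ∀ z : sl₂, z.1 1 1 = -z.1 0 0 := by
    intro z
    have h1 : Matrix.trace z.1 = 0 := z.2
    rw [Matrix.trace_fin_two] at h1
    linear_combination h1
  rw [LieAlgebra.SpecialLinear.sl_bracket]
  simp only [Matrix.sub_apply, Matrix.mul_apply, Fin.sum_univ_two, h0]
  refine ⟨?_, ?_, ?_⟩ <;> ring

/-- The map of Lie algebras given by a triple. -/
def slLieHom {Q : Type u} [Ring Q] [Algebra ℂ Q] {H Ep Em : Q} (h1 : H * Ep - Ep * H = Ep)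
    (h2 : H * Em - Em * H = -Em) (h3 : Ep * Em - Em * Ep = (2 : ℂ) • H) : sl₂ →ₗ⁅ℂ⁆ Q where
  toFun x := (2 * x.1 0 0) • H + x.1 0 1 • Ep + x.1 1 0 • Em
  map_add' x y := by
    have e : ∀ i j, (x + y).1 i j = x.1 i j + y.1 i j := fun _ _ => rfl
    simp only [e, mul_add, add_smul]
    abel
  map_smul' c x := by
    have e : ∀ i j, (c • x).1 i j = c * x.1 i j := fun _ _ => rfl
    simp only [e, RingHom.id_apply, smul_add, smul_smul]
    congr 3
    ring
  map_lie' {x y} := by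
    obtain ⟨b1, b2, b3⟩ := sl_bracket_apply x y
    rw [b1, b2, b3, LieRing.of_associative_ring_bracket]
    have h1' := sub_eq_iff_eq_add.1 h1
    have h2' := sub_eq_iff_eq_add.1 h2
    have h3' := sub_eq_iff_eq_add.1 h3
    simp only [add_mul, mul_add, smul_mul_assoc, mul_smul_comm, smul_add, h1', h2', h3', smul_neg]
    module

theorem slLieHom_gen {Q : Type u} [Ring Q] [Algebra ℂ Q] {H Ep Em : Q}
    (h1 : H * Ep - Ep * H = Ep) (h2 : H * Em - Em * H = -Em)
    (h3 : Ep * Em - Em * Ep = (2 : ℂ) • H) :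
    slLieHom h1 h2 h3 slH = H ∧ slLieHom h1 h2 h3 slEp = Ep ∧ slLieHom h1 h2 h3 slEm = Em := by
  have e : ∀ x : sl₂, slLieHom h1 h2 h3 x =
    (2 * x.1 0 0) • H + x.1 0 1 • Ep + x.1 1 0 • Em := fun _ => rfl
  refine ⟨?_, ?_, ?_⟩ <;> rw [e] <;> simp [slH, slEp, slEm, Matrix.single]

theorem USl2_relations :
    UniversalEnvelopingAlgebra.ι ℂ slH * UniversalEnvelopingAlgebra.ι ℂ slEp -
      UniversalEnvelopingAlgebra.ι ℂ slEp * UniversalEnvelopingAlgebra.ι ℂ slH =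
      UniversalEnvelopingAlgebra.ι ℂ slEp ∧
    UniversalEnvelopingAlgebra.ι ℂ slH * UniversalEnvelopingAlgebra.ι ℂ slEm -
      UniversalEnvelopingAlgebra.ι ℂ slEm * UniversalEnvelopingAlgebra.ι ℂ slH =
      -UniversalEnvelopingAlgebra.ι ℂ slEm ∧
    UniversalEnvelopingAlgebra.ι ℂ slEp * UniversalEnvelopingAlgebra.ι ℂ slEm -
      UniversalEnvelopingAlgebra.ι ℂ slEm * UniversalEnvelopingAlgebra.ι ℂ slEp =
      (2 : ℂ) • UniversalEnvelopingAlgebra.ι ℂ slH := by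
  simp only [← LieRing.of_associative_ring_bracket, ← LieHom.map_lie, slH_Ep, slH_Em, slEp_Em,
    map_neg, map_smul, and_self]

end Sl

/-! ### Universal property of `U(sl(2))` over `R / J n`. -/

section Usl

attribute [local instance] LieRing.ofAssociativeRing LieAlgebra.ofAssociativeAlgebra

variable {R : Type u} [CommRing R] [Algebra ℂ R] {J : ℕ → Ideal R} (hJ : ∀ n, J (n + 1) ≤ J n)
  {n : ℕ} {Q : Type u} [Ring Q] [Algebra R Q]

theorem usl_hom_ext {f g : (Usl J hJ).obj n →ₐ[R] Q}
    (hfg : ∀ x, f (slElt J hJ x n) = g (slElt J hJ x n)) : f = g := by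
  let _ : Algebra ℂ Q := Algebra.compHom Q (algebraMap ℂ R)
  have _ : IsScalarTower ℂ R Q := IsScalarTower.of_algebraMap_eq fun _ => rfl
  change (R ⧸ J n) ⊗[ℂ] USl2 →ₐ[R] Q at f
  change (R ⧸ J n) ⊗[ℂ] USl2 →ₐ[R] Q at g
  refine Algebra.TensorProduct.ext (Ideal.Quotient.algHom_ext _ (by ext)) ?_
  exact UniversalEnvelopingAlgebra.hom_ext ℂ (LieHom.ext hfg)

/-- A triple defines a map from `U(sl(2))`. -/
def uslLift (hQ : ∀ c ∈ J n, ∀ x : Q, c • x = 0) {H Ep Em : Q} (h1 : H * Ep - Ep * H = Ep)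
    (h2 : H * Em - Em * H = -Em) (h3 : Ep * Em - Em * Ep = (2 : R) • H) :
    (Usl J hJ).obj n →ₐ[R] Q :=
  letI : Algebra ℂ Q := Algebra.compHom Q (algebraMap ℂ R)
  haveI : IsScalarTower ℂ R Q := IsScalarTower.of_algebraMap_eq fun _ => rfl
  have h3' : Ep * Em - Em * Ep = (2 : ℂ) • H := by
    rw [h3, ← algebraMap_smul R (2 : ℂ) H, map_ofNat]
  Algebra.TensorProduct.lift
    (Ideal.Quotient.liftₐ (J n) (Algebra.ofId R Q) fun c hc => by
      have := hQ c hc 1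
      rwa [Algebra.smul_def, mul_one] at this)
    (UniversalEnvelopingAlgebra.lift ℂ (slLieHom h1 h2 h3'))
    fun x y => by
      obtain ⟨x, rfl⟩ := Ideal.Quotient.mk_surjective x
      exact Algebra.commutes x _

theorem uslLift_gen (hQ : ∀ c ∈ J n, ∀ x : Q, c • x = 0) {H Ep Em : Q}
    (h1 : H * Ep - Ep * H = Ep) (h2 : H * Em - Em * H = -Em)
    (h3 : Ep * Em - Em * Ep = (2 : R) • H) :
    uslLift hJ hQ h1 h2 h3 (slElt J hJ slH n) = H ∧
      uslLift hJ hQ h1 h2 h3 (slElt J hJ slEp n) = Ep ∧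
      uslLift hJ hQ h1 h2 h3 (slElt J hJ slEm n) = Em := by
  let _ : Algebra ℂ Q := Algebra.compHom Q (algebraMap ℂ R)
  have _ : IsScalarTower ℂ R Q := IsScalarTower.of_algebraMap_eq fun _ => rfl
  have h3' : Ep * Em - Em * Ep = (2 : ℂ) • H := by
    rw [h3, ← algebraMap_smul R (2 : ℂ) H, map_ofNat]
  have e : ∀ x, uslLift hJ hQ h1 h2 h3 (slElt J hJ x n) = slLieHom h1 h2 h3' x := by
    intro x
    have : uslLift hJ hQ h1 h2 h3 (slElt J hJ x n) =
        1 * UniversalEnvelopingAlgebra.lift ℂ (slLieHom h1 h2 h3')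
          (UniversalEnvelopingAlgebra.ι ℂ x) :=
      (Algebra.TensorProduct.lift_tmul _ _ (fun x y => by
        obtain ⟨x, rfl⟩ := Ideal.Quotient.mk_surjective x
        exact Algebra.commutes x _) _ _).trans (by rw [map_one])
    rw [this, one_mul, UniversalEnvelopingAlgebra.lift_ι_apply]
  obtain ⟨g1, g2, g3⟩ := slLieHom_gen h1 h2 h3'
  exact ⟨(e _).trans g1, (e _).trans g2, (e _).trans g3⟩

end Usl

/-! ### The formulas in an algebra killed by `h`. -/

section ClassicalLimit

open PowerSeries

variable {R : Type u} [CommRing R] [Algebra ℂ R] {A : Type u} [Ring A] [Algebra R A]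
  {I : Ideal R} {n : ℕ} {h ξ : R}

omit [Algebra ℂ R] in
theorem Killed.eq_zero_of_zero (hA : Killed I 0 A) (x : A) : x = 0 := by
  simpa using hA 1 (by simp) x

theorem Killed.ev_smul_of_smul_eq_zero (hA : Killed I n A) (h0 : ∀ x : A, h • x = 0) (p : ℂ⟦X⟧)
    (x : A) : ev R n p h • x = algebraMap ℂ R (constantCoeff p) • x := by
  rcases n with _ | n
  · rw [hA.eq_zero_of_zero x, smul_zero, smul_zero]
  · rw [ev, Finset.sum_smul, Finset.sum_range_succ', Finset.sum_eq_zero, zero_add, pow_zero,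
      smul_assoc, one_smul, coeff_zero_eq_constantCoeff_apply]
    intro i _
    rw [smul_assoc, pow_succ, mul_smul, h0, smul_zero, smul_zero]

/-- Only constant terms survive: `(1 - e^{-h}) / h` becomes `1`, and the linear coefficient of `e^X
- e^{-X}` is `2`. -/
theorem Killed.qbracket_of_smul_eq_zero (hA : Killed I n A) (h0 : ∀ x : A, h • x = 0) (x : A) :
    qbracket R n h x = (2 : R) • x := by
  have c1 : constantCoeff (divX (1 - expS (-1)))⁻¹ = 1 := by
    rw [constantCoeff_inv, ← coeff_zero_eq_constantCoeff_apply, divX, coeff_mk, zero_add, map_sub,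
      coeff_one_expS]
    simp [PowerSeries.coeff_one]
  rw [qbracket, hA.ev_smul_of_smul_eq_zero h0, c1, map_one, one_smul]
  rcases n with _ | n
  · rw [hA.eq_zero_of_zero x]
    simp
  · rw [Finset.sum_range_succ', Finset.sum_eq_zero, zero_add, zero_add, pow_zero, pow_one, mul_one,
      map_sub, coeff_one_expS, coeff_one_expS, sub_neg_eq_add, one_add_one_eq_two, map_ofNat]
    intro i _
    rw [pow_succ h, ← mul_assoc, mul_smul, h0, smul_zero]

theorem Killed.twistQJ_of_smul_eq_zero (hA : Killed I n A) (h0 : ∀ x : A, h • x = 0) (H Ep : A) :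
    twistQJ R n h ξ H Ep = twistJ R n ξ H Ep := by
  rw [twistQJ, omega, h0, hA.nexp_zero, mul_one, TensorProduct.smul_tmul', h0,
    TensorProduct.zero_tmul, neg_zero, hA.tensor.nexp_zero, mul_one, add_comm, twistJ]

theorem Killed.matQ_of_smul_eq_zero (hA : Killed I n A) (h0 : ∀ x : A, h • x = 0) (H Ep Em : A) :
    matQ R n h H Ep Em = 1 := by
  have h02 : ∀ x : A ⊗[R] A, h • x = 0 := by
    intro x
    induction x using TensorProduct.induction_on with
    | zero => simp
    | tmul a b => rw [TensorProduct.smul_tmul', h0, TensorProduct.zero_tmul]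
    | add x y hx hy => rw [smul_add, hx, hy, add_zero]
  have hA2 : Killed I n (A ⊗[R] A) := hA.tensor
  rw [matQ, h02, hA2.nexp_zero, one_mul]
  simp only [hA2.ev_smul_of_smul_eq_zero h02]
  rcases n with _ | n
  · exact (hA2.eq_zero_of_zero _).trans (hA2.eq_zero_of_zero _).symm
  · rw [Finset.sum_range_succ', Finset.sum_eq_zero, zero_add, rcoeff_zero, map_one, map_one,
      one_smul, pow_zero]
    intro i _
    obtain ⟨q, hq⟩ := X_pow_dvd_rcoeff (i + 1)
    rw [hq, map_mul, map_pow, constantCoeff_X, _root_.zero_pow (Nat.succ_ne_zero i), zero_mul, map_zero,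
      zero_smul]

theorem Killed.matQJ_of_smul_eq_zero (hA : Killed I n A) (h0 : ∀ x : A, h • x = 0) (H Ep Em : A) :
    matQJ R n h ξ H Ep Em = matJ R n ξ H Ep := by
  rw [matQJ, hA.matQ_of_smul_eq_zero h0, omega, h0, hA.nexp_zero, mul_one,
    TensorProduct.smul_tmul', h0, TensorProduct.zero_tmul, neg_zero, hA.tensor.nexp_zero, mul_one,
    mul_one, mul_one, add_comm, matJ]

end ClassicalLimit

/-! ### Relations and transition maps for the image of `sl(2)`. -/

section UslTower

variable {R : Type u} [CommRing R] [Algebra ℂ R] {J : ℕ → Ideal R} (hJ : ∀ n, J (n + 1) ≤ J n)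
  (n : ℕ)

theorem slElt_mul (x y : LieAlgebra.SpecialLinear.sl (Fin 2) ℂ) :
    slElt J hJ x n * slElt J hJ y n = (show (Usl J hJ).obj n from (1 : R ⧸ J n) ⊗ₜ[ℂ]
      (UniversalEnvelopingAlgebra.ι ℂ x * UniversalEnvelopingAlgebra.ι ℂ y)) := by
  refine (Algebra.TensorProduct.tmul_mul_tmul _ _ _ _).trans ?_
  rw [one_mul]

theorem slElt_smul (c : ℂ) (x : LieAlgebra.SpecialLinear.sl (Fin 2) ℂ) :
    slElt J hJ (c • x) n = algebraMap ℂ R c • slElt J hJ x n := by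
  have : ∀ b : USl2, (1 : R ⧸ J n) ⊗ₜ[ℂ] (c • b) = algebraMap ℂ R c • ((1 : R ⧸ J n) ⊗ₜ[ℂ] b) := by
    intro b
    rw [algebraMap_smul, TensorProduct.tmul_smul]
  refine Eq.trans ?_ (this _)
  rw [slElt, map_smul]

theorem slElt_add (x y : LieAlgebra.SpecialLinear.sl (Fin 2) ℂ) :
    slElt J hJ (x + y) n = slElt J hJ x n + slElt J hJ y n := by
  refine Eq.trans ?_ (TensorProduct.tmul_add _ _ _)
  rw [slElt, map_add]

theorem slElt_H_Ep : slElt J hJ slH n * slElt J hJ slEp n - slElt J hJ slEp n * slElt J hJ slH n =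
    slElt J hJ slEp n := by
  rw [slElt_mul, slElt_mul]
  refine (TensorProduct.tmul_sub _ _ _).symm.trans ?_
  rw [USl2_relations.1, slElt]

theorem slElt_H_Em : slElt J hJ slH n * slElt J hJ slEm n - slElt J hJ slEm n * slElt J hJ slH n =
    -slElt J hJ slEm n := by
  rw [slElt_mul, slElt_mul]
  refine (TensorProduct.tmul_sub _ _ _).symm.trans ?_
  rw [USl2_relations.2.1]
  exact TensorProduct.tmul_neg _ _

theorem slElt_Ep_Em : slElt J hJ slEp n * slElt J hJ slEm n - slElt J hJ slEm n * slElt J hJ slEp n =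
    (2 : R) • slElt J hJ slH n := by
  rw [slElt_mul, slElt_mul, ← map_ofNat (algebraMap ℂ R) 2, ← slElt_smul, slElt, map_smul]
  refine (TensorProduct.tmul_sub _ _ _).symm.trans ?_
  rw [USl2_relations.2.2]

theorem usl_tr_slElt (x : LieAlgebra.SpecialLinear.sl (Fin 2) ℂ) :
    (Usl J hJ).tr n (slElt J hJ x (n + 1)) = slElt J hJ x n := by
  refine (Algebra.TensorProduct.map_tmul _ _ _ _).trans ?_
  rw [map_one]
  rfl

theorem slElt_eq (x : LieAlgebra.SpecialLinear.sl (Fin 2) ℂ) : slElt J hJ x n =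
    algebraMap ℂ R (2 * x.1 0 0) • slElt J hJ slH n + algebraMap ℂ R (x.1 0 1) • slElt J hJ slEp n +
      algebraMap ℂ R (x.1 1 0) • slElt J hJ slEm n := by
  rw [← slElt_smul, ← slElt_smul, ← slElt_smul, ← slElt_add, ← slElt_add, ← sl_eq]

end UslTower

/-! ### The boundary `h = 0`. -/

section Reduction

variable {R : Type u} [CommRing R] [Algebra ℂ R] (I : Ideal R) (h ξ : R) (hh : h ∈ I)
  (hξ : ξ ∈ I) (n : ℕ)

/-- `U(sl(2))` over the completion of `R / h R`. -/
abbrev UslMod : Tower R (modFilt I h) := Usl (modFilt I h) (modFilt_le I h)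

theorem uslMod_killed : Killed I n ((UslMod I h).obj n) :=
  fun c hc x => (UslMod I h).ann n c (Ideal.mem_sup_left hc) x

omit [Algebra ℂ R] in
theorem mem_modFilt : h ∈ modFilt I h n :=
  Ideal.mem_sup_right (Ideal.mem_span_singleton_self h)

theorem uslMod_smul (x : (UslMod I h).obj n) : h • x = 0 :=
  (UslMod I h).ann n h (mem_modFilt I h n) x

theorem uslMod_triple : SlTriple n h (slElt (modFilt I h) (modFilt_le I h) slH n)
    (slElt (modFilt I h) (modFilt_le I h) slEp n) (slElt (modFilt I h) (modFilt_le I h) slEm n) where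
  H_Ep := slElt_H_Ep _ n
  H_Em := slElt_H_Em _ n
  Ep_Em := by
    rw [slElt_Ep_Em, (uslMod_killed I h n).qbracket_of_smul_eq_zero (uslMod_smul I h n)]

/-- The reduction of `U_q(sl(2))` modulo `h`. -/
def uqToUsl : (Uq I h hh).obj n →ₐ[R] (UslMod I h).obj n :=
  uqLift hh (uslMod_killed I h n) (uslMod_triple I h n)

theorem uqToUsl_gen :
    uqToUsl I h hh n (UqH I h hh n) = slElt (modFilt I h) (modFilt_le I h) slH n ∧
      uqToUsl I h hh n (UqEp I h hh n) = slElt (modFilt I h) (modFilt_le I h) slEp n ∧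
      uqToUsl I h hh n (UqEm I h hh n) = slElt (modFilt I h) (modFilt_le I h) slEm n :=
  uqLift_gen hh _ _

/-- The ideal `h U_q(sl(2))`. -/
def uqIdeal : Ideal ((Uq I h hh).obj n) where
  carrier := {x | ∃ y, x = h • y}
  add_mem' := by
    rintro _ _ ⟨x, rfl⟩ ⟨y, rfl⟩
    exact ⟨x + y, (smul_add _ _ _).symm⟩
  zero_mem' := ⟨0, (smul_zero _).symm⟩
  smul_mem' := by
    rintro c _ ⟨x, rfl⟩
    exact ⟨c * x, by rw [smul_eq_mul, mul_smul_comm]⟩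

instance uqIdeal_isTwoSided : (uqIdeal I h hh n).IsTwoSided :=
  ⟨by
    rintro _ b ⟨x, rfl⟩
    exact ⟨x * b, by rw [smul_mul_assoc]⟩⟩

/-- The quotient map `U_q(sl(2)) → U_q(sl(2)) / h U_q(sl(2))`. -/
def uqMk : (Uq I h hh).obj n →ₐ[R] (Uq I h hh).obj n ⧸ uqIdeal I h hh n :=
  Ideal.Quotient.mkₐ R (uqIdeal I h hh n)

theorem uqMk_surjective : Function.Surjective (uqMk I h hh n) := Ideal.Quotient.mk_surjective

theorem uqMk_eq_zero {x : (Uq I h hh).obj n} : uqMk I h hh n x = 0 ↔ ∃ y, x = h • y :=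
  Ideal.Quotient.eq_zero_iff_mem

theorem uqMk_smul (x : (Uq I h hh).obj n ⧸ uqIdeal I h hh n) : h • x = 0 := by
  obtain ⟨x, rfl⟩ := uqMk_surjective I h hh n x
  rw [← map_smul]
  exact (uqMk_eq_zero I h hh n).2 ⟨x, rfl⟩

theorem uqMk_killed : Killed I n ((Uq I h hh).obj n ⧸ uqIdeal I h hh n) := by
  intro c hc x
  obtain ⟨x, rfl⟩ := uqMk_surjective I h hh n x
  rw [← map_smul, uq_killed I h hh n c hc, map_zero]

theorem uqMk_triple : SlTriple n h (uqMk I h hh n (UqH I h hh n)) (uqMk I h hh n (UqEp I h hh n))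
    (uqMk I h hh n (UqEm I h hh n)) := (uq_triple I h hh n).map _

theorem uqMk_ann (c : R) (hc : c ∈ modFilt I h n) (x : (Uq I h hh).obj n ⧸ uqIdeal I h hh n) :
    c • x = 0 := by
  obtain ⟨a, ha, b, hb, rfl⟩ := Submodule.mem_sup.1 hc
  obtain ⟨b, rfl⟩ := Ideal.mem_span_singleton'.1 hb
  rw [add_smul, uqMk_killed I h hh n a ha, mul_smul, uqMk_smul, smul_zero, add_zero]

/-- The map `U(sl(2)) → U_q(sl(2)) / h U_q(sl(2))`. -/
def uslToUq : (UslMod I h).obj n →ₐ[R] (Uq I h hh).obj n ⧸ uqIdeal I h hh n :=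
  uslLift (modFilt_le I h) (uqMk_ann I h hh n) (uqMk_triple I h hh n).H_Ep
    (uqMk_triple I h hh n).H_Em
    ((uqMk_triple I h hh n).Ep_Em.trans
      ((uqMk_killed I h hh n).qbracket_of_smul_eq_zero (uqMk_smul I h hh n) _))

/-- The quotient map factors through `uqToUsl`, so the kernel of `uqToUsl` is no larger than `h
U_q(sl(2))`. No basis of `U(sl(2))` is needed. -/
theorem uslToUq_comp (x : (Uq I h hh).obj n) :
    uslToUq I h hh n (uqToUsl I h hh n x) = uqMk I h hh n x := by
  have t := uqMk_triple I h hh n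
  obtain ⟨h1, h2, h3⟩ := uqToUsl_gen I h hh n
  obtain ⟨g1, g2, g3⟩ := uslLift_gen (modFilt_le I h) (uqMk_ann I h hh n) t.H_Ep t.H_Em
    (t.Ep_Em.trans ((uqMk_killed I h hh n).qbracket_of_smul_eq_zero (uqMk_smul I h hh n) _))
  have : (uslToUq I h hh n).comp (uqToUsl I h hh n) = uqMk I h hh n := by
    refine uq_hom_ext ?_ ?_ ?_
    · rw [AlgHom.comp_apply, h1]; exact g1
    · rw [AlgHom.comp_apply, h2]; exact g2
    · rw [AlgHom.comp_apply, h3]; exact g3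
  exact AlgHom.congr_fun this x

theorem uqToUsl_smul_eq_zero (x : (Uq I h hh).obj n) (hx : uqMk I h hh n x = 0) :
    uqToUsl I h hh n x = 0 := by
  obtain ⟨y, rfl⟩ := (uqMk_eq_zero I h hh n).1 hx
  rw [map_smul, uslMod_smul]

/-- The map induced by `uqToUsl` on the quotient by `h` has `uslToUq` as a right inverse, as one
checks on `sl(2)`. -/
theorem uqToUsl_surjective : Function.Surjective (uqToUsl I h hh n) := by
  have t := uqMk_triple I h hh n
  obtain ⟨h1, h2, h3⟩ := uqToUsl_gen I h hh n
  obtain ⟨g1, g2, g3⟩ := uslLift_gen (modFilt_le I h) (uqMk_ann I h hh n) t.H_Ep t.H_Em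
    (t.Ep_Em.trans ((uqMk_killed I h hh n).qbracket_of_smul_eq_zero (uqMk_smul I h hh n) _))
  let f := algLiftSurjective (uqMk I h hh n) (uqMk_surjective I h hh n) (uqToUsl I h hh n)
    (uqToUsl_smul_eq_zero I h hh n)
  have hf : ∀ x, f (uqMk I h hh n x) = uqToUsl I h hh n x := algLiftSurjective_apply _ _
  have e : f.comp (uslToUq I h hh n) = AlgHom.id R _ := by
    refine usl_hom_ext (modFilt_le I h) fun x => ?_
    rw [slElt_eq]
    simp only [map_add, map_smul, AlgHom.comp_apply, AlgHom.id_apply]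
    rw [uslToUq, g1, g2, g3, hf, hf, hf, h1, h2, h3]
  intro y
  obtain ⟨x, hx⟩ := uqMk_surjective I h hh n (uslToUq I h hh n y)
  refine ⟨x, ?_⟩
  rw [← hf, hx]
  exact AlgHom.congr_fun e y

theorem uqToUsl_isTowerReduction : IsTowerReduction h (uqToUsl I h hh) where
  compat n x := by
    obtain ⟨h1, h2, h3⟩ := uqToUsl_gen I h hh n
    obtain ⟨g1, g2, g3⟩ := uqToUsl_gen I h hh (n + 1)
    obtain ⟨t1, t2, t3⟩ := uq_tr_gen hh n
    have : ((UslMod I h).tr n).comp (uqToUsl I h hh (n + 1)) =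
        (uqToUsl I h hh n).comp ((Uq I h hh).tr n) := by
      refine uq_hom_ext ?_ ?_ ?_
      · rw [AlgHom.comp_apply, AlgHom.comp_apply, t1, g1, h1, usl_tr_slElt]
      · rw [AlgHom.comp_apply, AlgHom.comp_apply, t2, g2, h2, usl_tr_slElt]
      · rw [AlgHom.comp_apply, AlgHom.comp_apply, t3, g3, h3, usl_tr_slElt]
    exact AlgHom.congr_fun this x
  surjective := uqToUsl_surjective I h hh
  ker n x := by
    rw [← uqMk_eq_zero]
    exact ⟨fun hx => by rw [← uslToUq_comp, hx, map_zero], uqToUsl_smul_eq_zero I h hh n x⟩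
  le n := le_sup_left
  mem := mem_modFilt I h
  antitone := modFilt_le I h

/-- The Hopf algebra `U(sl(2))`. -/
def uslHopf : Hopf (UslMod I h) := (uqToUsl_isTowerReduction I h hh).hopf (uqHopf I h hh)

/-- The Hopf algebra `U_J(sl(2))`. -/
def jordanHopf : Hopf (UslMod I h) :=
  (uqToUsl_isTowerReduction I h hh).hopf (hybridHopf I h ξ hh hξ)

theorem uslHopf_isReduction :
    IsReduction h (uqHopf I h hh) (uslHopf I h hh) (uqToUsl I h hh) :=
  (uqToUsl_isTowerReduction I h hh).hopf_isReduction _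

theorem jordanHopf_isReduction :
    IsReduction h (hybridHopf I h ξ hh hξ) (jordanHopf I h ξ hh hξ) (uqToUsl I h hh) :=
  (uqToUsl_isTowerReduction I h hh).hopf_isReduction _

theorem map2_uqF : map2 (uqToUsl I h hh n) (UqF I h ξ hh n) = UslF (modFilt_le I h) ξ n := by
  obtain ⟨h1, h2, h3⟩ := uqToUsl_gen I h hh n
  rw [UslF, ← (uslMod_killed I h n).twistQJ_of_smul_eq_zero (uslMod_smul I h n), UqF, twistQJ,
    map_mul, map_nexp, map_nexp, map_neg, map_smul, Algebra.TensorProduct.map_tmul,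
    Algebra.TensorProduct.map_tmul, map_omega, h1, h2, twistQJ]

theorem map2_uqRJ : map2 (uqToUsl I h hh n) (UqRJ I h ξ hh n) = UslRJ (modFilt_le I h) ξ n := by
  obtain ⟨h1, h2, h3⟩ := uqToUsl_gen I h hh n
  rw [UslRJ, ← (uslMod_killed I h n).matQJ_of_smul_eq_zero (uslMod_smul I h n) _ _
    (slElt (modFilt I h) (modFilt_le I h) slEm n), UqRJ, matQJ, matQJ, matQ, matQ]
  simp only [map_mul, map_nexp, map_neg, map_smul, map_sum, map_pow,
    Algebra.TensorProduct.map_tmul, map_omega, h1, h2, h3]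

/-- The Hopf structure used on `U(sl(2))` is the one that descends from `U_q(sl(2))`. It is
cocommutative because `e^{± hH}` reduces to `1`, so the generators, and by linearity all of `sl(2)`,
are primitive. -/
theorem uslHopf_comul (x : LieAlgebra.SpecialLinear.sl (Fin 2) ℂ) :
    (uslHopf I h hh).Δ n (slElt (modFilt I h) (modFilt_le I h) x n) =
      slElt (modFilt I h) (modFilt_le I h) x n ⊗ₜ[R] 1 +
        1 ⊗ₜ[R] slElt (modFilt I h) (modFilt_le I h) x n := by
  have r := uslHopf_isReduction I h hh
  have s := uqHopf_isStandard I h hh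
  have hK := uslMod_killed I h n
  obtain ⟨h1, h2, h3⟩ := uqToUsl_gen I h hh n
  have e1 : (uslHopf I h hh).Δ n (slElt (modFilt I h) (modFilt_le I h) slH n) =
      slElt (modFilt I h) (modFilt_le I h) slH n ⊗ₜ[R] 1 +
        1 ⊗ₜ[R] slElt (modFilt I h) (modFilt_le I h) slH n := by
    rw [← h1, r.comul, s.comul_H, map_add, Algebra.TensorProduct.map_tmul,
      Algebra.TensorProduct.map_tmul, map_one]
  have e2 : (uslHopf I h hh).Δ n (slElt (modFilt I h) (modFilt_le I h) slEp n) =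
      slElt (modFilt I h) (modFilt_le I h) slEp n ⊗ₜ[R] 1 +
        1 ⊗ₜ[R] slElt (modFilt I h) (modFilt_le I h) slEp n := by
    rw [← h2, r.comul, s.comul_Ep, map_add, Algebra.TensorProduct.map_tmul,
      Algebra.TensorProduct.map_tmul, map_one, map_nexp, map_smul, uslMod_smul, hK.nexp_zero]
  have e3 : (uslHopf I h hh).Δ n (slElt (modFilt I h) (modFilt_le I h) slEm n) =
      slElt (modFilt I h) (modFilt_le I h) slEm n ⊗ₜ[R] 1 +
        1 ⊗ₜ[R] slElt (modFilt I h) (modFilt_le I h) slEm n := by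
    rw [← h3, r.comul, s.comul_Em, map_add, Algebra.TensorProduct.map_tmul,
      Algebra.TensorProduct.map_tmul, map_one, map_nexp, map_neg, map_smul, uslMod_smul, neg_zero,
      hK.nexp_zero]
  rw [slElt_eq, map_add, map_add, map_smul, map_smul, map_smul, e1, e2, e3]
  simp only [TensorProduct.add_tmul, TensorProduct.tmul_add, ← TensorProduct.smul_tmul',
    TensorProduct.tmul_smul, smul_add]
  abel

theorem jordanHopf_isJordanian : IsJordanian ξ (jordanHopf I h ξ hh hξ) := by
  have e : (fun n => map2 (uqToUsl I h hh n) (UqF I h ξ hh n)) = UslF (modFilt_le I h) ξ :=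
    funext (map2_uqF I h ξ hh)
  have hF := uqF_isTwist I h ξ hh hξ
  refine ⟨uslHopf I h hh, uslHopf_comul I h hh, ?_, ?_⟩
  · rw [← e]
    exact (uslHopf_isReduction I h hh).isTwist hF
  · rw [← e]
    exact (uslHopf_isReduction I h hh).isTwistOf (jordanHopf_isReduction I h ξ hh hξ) hF.isUnit
      (hybridHopf_isTwistOf I h ξ hh hξ)

theorem jordanHopf_isUniversalR :
    (jordanHopf I h ξ hh hξ).IsUniversalR (UslRJ (modFilt_le I h) ξ) := by
  have e : (fun n => map2 (uqToUsl I h hh n) (UqRJ I h ξ hh n)) = UslRJ (modFilt_le I h) ξ :=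
    funext (map2_uqRJ I h ξ hh)
  rw [← e]
  exact (jordanHopf_isReduction I h ξ hh hξ).isUniversalR (hybridHopf_isUniversalR I h ξ hh hξ)

end Reduction

/-! ### The first-order term of the R-matrix along `h = ζ ξ`. -/

section ClassicalR

open PowerSeries

variable {R : Type u} [CommRing R] [Algebra ℂ R] {A : Type u} [Ring A] [Algebra R A]
  {I : Ideal R} {ξ : R}

theorem nexp_two (a : A) : nexp R 2 a = 1 + a := by
  simp [nexp, ev, Finset.sum_range_succ, PowerSeries.coeff_exp]

theorem nlog_two (a : A) : nlog R 2 a = a - 1 := by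
  simp [nlog, ev, Finset.sum_range_succ, PowerSeries.coeff_log]

theorem coeff_rcoeff_one : coeff 0 (rcoeff 1) = 0 ∧ coeff 1 (rcoeff 1) = 1 := by
  have h := rcoeff_succ 0
  rw [rcoeff_zero, mul_one, qint, Finset.sum_range_one, pow_zero, mul_one] at h
  rw [h]
  constructor
  · rw [coeff_zero_eq_constantCoeff_apply, map_sub, constantCoeff_expS, map_one, sub_self]
  · rw [map_sub, coeff_one_expS]
    simp [PowerSeries.coeff_one]

omit [Algebra ℂ R] in
theorem Killed.smul_smul_eq_zero (hA : Killed I 2 A) (hξ : ξ ∈ I) (x : A) : ξ • ξ • x = 0 := by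
  rw [smul_smul, ← pow_two]
  exact hA _ (Ideal.pow_mem_pow hξ 2) x

omit [Algebra ℂ R] in
theorem Killed.one_add_mul_one_add (hA : Killed I 2 A) (hξ : ξ ∈ I) (a b : A) :
    (1 + ξ • a) * (1 + ξ • b) = 1 + ξ • (a + b) := by
  rw [add_mul, one_mul, smul_mul_assoc, mul_add, mul_one, mul_smul_comm, smul_add,
    hA.smul_smul_eq_zero hξ, add_zero, smul_add, add_assoc, add_comm (ξ • b)]

/-- Modulo `I ^ 2` every factor is `1 + ξ a`, and such factors multiply by adding the `a`. Five
terms `± ζ H ⊗ H` arise, with signs `+ - + + -`, and leave one; `ω` contributes `E₊ + ζ H`. -/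
theorem Killed.matQJ_two (hA : Killed I 2 A) (hξ : ξ ∈ I) (ζ : R) (H Ep Em : A) :
    matQJ R 2 (ζ * ξ) ξ H Ep Em = 1 + ξ • rHybrid R ζ H Ep Em := by
  have hA2 : Killed I 2 (A ⊗[R] A) := hA.tensor
  have e : ∀ {B : Type u} [Ring B] [Algebra R B] (x : B), (ζ * ξ) • x = ξ • ζ • x := by
    intro B _ _ x
    rw [mul_comm, mul_smul]
  have hω : omega R 2 (ζ * ξ) ξ H Ep = ξ • (Ep + ζ • H) := by
    rw [omega, nexp_two, nlog_two, e, add_comm (ξ • Ep), hA.one_add_mul_one_add hξ,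
      add_sub_cancel_left]
  have hev : ∀ x : A ⊗[R] A, ev R 2 (rcoeff 1) (ζ * ξ) • x = ξ • ζ • x := by
    intro x
    obtain ⟨c0, c1⟩ := coeff_rcoeff_one
    rw [ev, Finset.sum_range_succ, Finset.sum_range_one, c0, c1]
    simp [e]
  have hev0 : ev R 2 (1 : ℂ⟦X⟧) (ζ * ξ) = 1 := by
    simp [ev, PowerSeries.coeff_one]
  rw [matQJ, matQ, hω, Finset.sum_range_succ, Finset.sum_range_one, rcoeff_zero, hev0, hev, one_smul,
    pow_zero, pow_one]
  simp only [nexp_two, e, TensorProduct.tmul_smul, ← TensorProduct.smul_tmul', ← smul_neg]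
  simp only [hA2.one_add_mul_one_add hξ]
  congr 2
  rw [rHybrid]
  simp only [TensorProduct.add_tmul, TensorProduct.tmul_add, TensorProduct.tmul_smul,
    ← TensorProduct.smul_tmul', smul_add]
  module

end ClassicalR

/-! ### The classical Yang–Baxter equation. -/

section YangBaxter

variable {R : Type u} [CommRing R] {A : Type u} [Ring A] [Algebra R A]

/-- Each leg of a product has at most two generators. Rewriting with the relations puts them in the
order `E₋`, `E₊`, `H`, after which the equation is linear in pure tensors. -/
theorem rHybrid_cybe {H Ep Em : A} (h1 : H * Ep - Ep * H = Ep) (h2 : H * Em - Em * H = -Em)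
    (h3 : Ep * Em - Em * Ep = (2 : R) • H) (ζ : R) : CYBE (rHybrid R ζ H Ep Em) := by
  have h1' := sub_eq_iff_eq_add.1 h1
  have h2' := sub_eq_iff_eq_add.1 h2
  have h3' := sub_eq_iff_eq_add.1 h3
  rw [CYBE, rHybrid]
  simp only [map_add, map_sub, map_smul, leg12_apply, leg13_tmul, leg23_tmul, add_mul, mul_add,
    sub_mul, mul_sub, smul_mul_assoc, mul_smul_comm, TensorProduct.add_tmul,
    ← TensorProduct.smul_tmul', Algebra.TensorProduct.tmul_mul_tmul, mul_one, one_mul, h1', h2', h3',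
    TensorProduct.tmul_add, TensorProduct.tmul_smul, TensorProduct.neg_tmul,
    TensorProduct.tmul_neg]
  module

end YangBaxter

end HybridSl2

end

theorem mainTheorem3 {R : Type u} [CommRing R] [Algebra ℂ R] (I : Ideal R) (h ξ : R)
    (hh : h ∈ I) (hξ : ξ ∈ I) :
    ∃ A B : Hopf (Uq I h hh),
      -- `A` is the quasitriangular Hopf algebra `U_q(sl(2))`
      IsStandard A ∧ A.IsUniversalR (UqR I h hh) ∧
      -- `B` is its twist by the quantum Jordanian twist
      A.IsTwist (UqF I h ξ hh) ∧ B.IsTwistOf A (UqF I h ξ hh) ∧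
      -- the coproducts and the universal R-matrix of `B`
      IsHybrid ξ B ∧ B.IsUniversalR (UqRJ I h ξ hh) ∧
      (∀ n, UqRJ I h ξ hh n =
        swap _ (UqF I h ξ hh n) * UqR I h hh n * Ring.inverse (UqF I h ξ hh n)) ∧
      -- the boundary at `ξ = 0` is `U_q(sl(2))`
      ((∀ n, ∃ y, UqF I h ξ hh n - 1 = ξ • y) ∧
        (∀ n x, ∃ y, B.Δ n x - A.Δ n x = ξ • y) ∧
        (∀ n x, ∃ y, B.S n x - A.S n x = ξ • y) ∧
        (∀ n, ∃ y, UqRJ I h ξ hh n - UqR I h hh n = ξ • y)) ∧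
      -- the boundary at `h = 0` is `U_J(sl(2))`
      (∃ (D : Hopf (Usl (modFilt I h) (modFilt_le I h)))
          (Φ : ∀ n, (Uq I h hh).obj n →ₐ[R] (Usl (modFilt I h) (modFilt_le I h)).obj n),
        IsJordanian ξ D ∧ D.IsUniversalR (UslRJ (modFilt_le I h) ξ) ∧
        IsReduction h B D Φ ∧
        (∀ n, Φ n (UqH I h hh n) = slElt (modFilt I h) (modFilt_le I h) slH n ∧
          Φ n (UqEp I h hh n) = slElt (modFilt I h) (modFilt_le I h) slEp n ∧
          Φ n (UqEm I h hh n) = slElt (modFilt I h) (modFilt_le I h) slEm n) ∧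
        (∀ n, Algebra.TensorProduct.map (Φ n) (Φ n) (UqF I h ξ hh n) =
          UslF (modFilt_le I h) ξ n) ∧
        (∀ n, Algebra.TensorProduct.map (Φ n) (Φ n) (UqRJ I h ξ hh n) =
          UslRJ (modFilt_le I h) ξ n)) ∧
      -- the classical r-matrix along `h = ζ ξ`: `R_{qJ} = 1 + ξ r` modulo `I ^ 2`,
      -- where `r`, in `U(sl(2)) ⊗ U(sl(2))`, satisfies the classical Yang-Baxter equation
      (∀ ζ : ℂ, h = algebraMap ℂ R ζ * ξ →
        UqRJ I h ξ hh 2 = 1 + ξ • rHybrid R (algebraMap ℂ R ζ)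
          (UqH I h hh 2) (UqEp I h hh 2) (UqEm I h hh 2)) ∧
      (∀ ζ : ℂ, CYBE (rHybrid ℂ ζ (UniversalEnvelopingAlgebra.ι ℂ slH)
        (UniversalEnvelopingAlgebra.ι ℂ slEp) (UniversalEnvelopingAlgebra.ι ℂ slEm))) := by
  have hF := uqF_isTwist I h ξ hh hξ
  refine ⟨uqHopf I h hh, hybridHopf I h ξ hh hξ, uqHopf_isStandard I h hh,
    uqR_isUniversalR I h hh, hF, hybridHopf_isTwistOf I h ξ hh hξ,
    hybridHopf_isHybrid I h ξ hh hξ, hybridHopf_isUniversalR I h ξ hh hξ,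
    uqRJ_eq I h ξ hh hξ, ⟨uqF_congr I h ξ hh, hybridHopf_comul_congr I h ξ hh hξ,
    hybridHopf_antipode_congr I h ξ hh hξ, uqRJ_congr I h ξ hh hξ⟩,
    ⟨jordanHopf I h ξ hh hξ, uqToUsl I h hh, jordanHopf_isJordanian I h ξ hh hξ,
    jordanHopf_isUniversalR I h ξ hh hξ, jordanHopf_isReduction I h ξ hh hξ,
    uqToUsl_gen I h hh, map2_uqF I h ξ hh, map2_uqRJ I h ξ hh⟩, ?_, ?_⟩
  · rintro ζ rfl
    exact (uq_killed I _ hh 2).matQJ_two hξ _ _ _ _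
  · intro ζ
    exact rHybrid_cybe USl2_relations.1 USl2_relations.2.1 USl2_relations.2.2 ζ
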